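/- Theorem. Consider $$u_{xt}+uu_{xx}-u_x^2=-2\int_0^1u_x^2\,dx\quad(t>0),\qquad u(x,0)=u_0(x),$$ on $[0,1]$ with either periodic boundary conditions ($u$ is $1$-periodic in $x$ and smooth as a function on the line), or Dirichlet conditions $u(0,t)=u(1,t)=0$, or both. Let $u_0$ be smooth (up to the end points; in the periodic cases as a $1$-periodic function on $\mathbb R$) and satisfy the boundary conditions, and suppose that $u_0'$ attains its maximum $M_0>0$ over $[0,1]$ at only finitely many points $\overline\alpha_1,\dots,\overline\alpha_n\in[0,1]$. (a) If $u_0''(\overline\alpha_i)=0$ for at least one $i$, then solutions remain smooth for all time: there is a smooth solution on $[0,\infty)$; for every smooth solution on $[0,T)$ with $0<T<\infty$, $u_x$ and all higher spatial derivatives of $u$ are bounded on $[0,T)$; and every such solution extends to a smooth solution on $[0,\infty)$, where under the periodic condition alone it is assumed that the mean $\int_0^1u(x,t)\,dx$, which the equation leaves free, extends smoothly to $[0,\infty)$. (b) Suppose that for some $k\ge1$ the function $u_0''$ has a zero of order $k$ at every $\overline\alpha_i$, that is, $u_0''$ and its derivatives of order less than $k$ vanish at $\overline\alpha_i$ and its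 $k$-th derivative does not. Then the conclusions of (a) hold. Moreover, let $u$ be any smooth solution on $[0,\infty)$. If $k=1$, the flow $\gamma$ given by $\partial_t\gamma(\alpha,t)=u(\gamma(\alpha,t),t)$, $\gamma(\alpha,0)=\alpha$ exists for all $\alpha\in[0,1]$, $t\ge0$, and along it $u_x$ converges to a non-trivial steady state: as $t\to\infty$, $$u_x(\gamma(\overline\alpha_i,t),t)\to\lambda\ \text{ for every } i,\qquad u_x(\gamma(\alpha,t),t)\to-\lambda\ \text{ for every other }\alpha\in[0,1],$$ $$\lambda=\frac1{(2\pi)^2}\Big(\sum_{i=1}^n w_i\,|u_0'''(\overline\alpha_i)|^{-1/2}\Big)^{-2}>0,\qquad w_i=\begin{cases}1,&\overline\alpha_i\in(0,1),\\ \tfrac12,&\overline\alpha_i\in\{0,1\}.\end{cases}$$ In particular $\lambda=|u_0'''(\overline\alpha)|/(2\pi)^2$ if there is a single maximum point $\overline\alpha\in(0,1)$. If $k>1$, then $u_x(\cdot,t)\to0$ uniformly as $t\to\infty$. -/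

import Mathlib

open Set Filter Topology
open scoped ContDiff

namespace StagnationEuler

/-- The boundary conditions: spatial periodicity with period one, homogeneous Dirichlet
conditions at the end points of `[0,1]`, or both of them together. -/
inductive BoundaryCondition where
  | periodic
  | dirichlet
  | periodicDirichlet

/-- The spatial domain. A periodic function on `[0,1]` is regarded as a `1`-periodic function on
the line (so that smoothness includes smoothness across the identified end points). Otherwise the
domain is the closed interval `[0,1]`, with one-sided derivatives at its end points. -/
def BoundaryCondition.domain : BoundaryCondition → Set ℝ
  | .periodic => univ
  | .dirichlet => Icc 0 1
  | .periodicDirichlet => univ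

/-- The profile `v` satisfies the boundary condition. -/
def BoundaryCondition.Holds : BoundaryCondition → (ℝ → ℝ) → Prop
  | .periodic, v => Function.Periodic v 1
  | .dirichlet, v => v 0 = 0 ∧ v 1 = 0
  | .periodicDirichlet, v => Function.Periodic v 1 ∧ v 0 = 0 ∧ v 1 = 0

/-- The spatial derivative `u_x (x, t)` on the spatial domain `S`. -/
noncomputable def ux (S : Set ℝ) (u : ℝ → ℝ → ℝ) (x t : ℝ) : ℝ :=
  derivWithin (fun y => u y t) S x

/-- The second spatial derivative `u_xx (x, t)` on the spatial domain `S`. -/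
noncomputable def uxx (S : Set ℝ) (u : ℝ → ℝ → ℝ) (x t : ℝ) : ℝ :=
  derivWithin (fun y => ux S u y t) S x

/-- `u = u(x, t)` is a solution, jointly smooth up to the initial time and up to the boundary, of
`u_xt + u u_xx - u_x ^ 2 = - 2 ∫₀¹ u_x ^ 2 dx`, `u(x, 0) = u₀(x)`, with the given boundary
condition, on the time interval `J` (which is `[0, T)` or `[0, ∞)`). -/
structure IsSmoothSolution (bc : BoundaryCondition) (u₀ : ℝ → ℝ) (J : Set ℝ)
    (u : ℝ → ℝ → ℝ) : Prop where
  smooth : ContDiffOn ℝ ∞ (fun p : ℝ × ℝ => u p.1 p.2) (bc.domain ×ˢ J)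
  boundary : ∀ t ∈ J, bc.Holds (fun x => u x t)
  initial : ∀ x ∈ bc.domain, u x 0 = u₀ x
  equation : ∀ t ∈ J, 0 < t → ∀ x ∈ bc.domain,
    deriv (fun s => ux bc.domain u x s) t + u x t * uxx bc.domain u x t
        - (ux bc.domain u x t) ^ 2
      = -2 * ∫ y in (0 : ℝ)..1, (ux bc.domain u y t) ^ 2

/-- Solutions with initial data `u₀` remain smooth for all time:
* there is a global smooth solution;
* on no smooth solution on a bounded time interval `[0, T)` can `u_x`, or any higher spatial
  derivative, become unbounded;
* every smooth solution on `[0, T)` continues to a global smooth one. In the purely periodic case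
  the equation leaves the spatial mean `∫₀¹ u dx` an arbitrary function of time (the change of
  frame `u(x - c(t), t) + c'(t)` preserves it), so there one asks that this mean continue
  smoothly. -/
def SolutionsStaySmooth (bc : BoundaryCondition) (u₀ : ℝ → ℝ) : Prop :=
  (∃ u : ℝ → ℝ → ℝ, IsSmoothSolution bc u₀ (Ici 0) u) ∧
  ∀ (T : ℝ) (u : ℝ → ℝ → ℝ), 0 < T → IsSmoothSolution bc u₀ (Ico 0 T) u →
    (∀ n : ℕ, 1 ≤ n → ∃ C : ℝ, ∀ t ∈ Ico 0 T, ∀ x ∈ bc.domain,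
      |iteratedDerivWithin n (fun y => u y t) bc.domain x| ≤ C) ∧
    ((bc = .periodic → ∃ m : ℝ → ℝ, ContDiffOn ℝ ∞ m (Ici 0) ∧
        ∀ t ∈ Ico 0 T, ∫ x in (0 : ℝ)..1, u x t = m t) →
      ∃ v : ℝ → ℝ → ℝ, IsSmoothSolution bc u₀ (Ici 0) v ∧
        ∀ t ∈ Ico 0 T, ∀ x ∈ bc.domain, v x t = u x t)

/-- `f`, on the domain `S`, has a zero of order `k` at `x₀` (used for `k ≥ 1`). -/
def HasZeroOfOrder (S : Set ℝ) (f : ℝ → ℝ) (k : ℕ) (x₀ : ℝ) : Prop :=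
  (∀ j < k, iteratedDerivWithin j f S x₀ = 0) ∧ iteratedDerivWithin k f S x₀ ≠ 0

/-- `γ` is the flow of the global velocity field `u`: `∂ₜ γ(α, t) = u(γ(α, t), t)` and
`γ(α, 0) = α`, for `α ∈ [0,1]` and `t ≥ 0`. -/
structure IsFlow (bc : BoundaryCondition) (u γ : ℝ → ℝ → ℝ) : Prop where
  initial : ∀ α ∈ Icc (0 : ℝ) 1, γ α 0 = α
  mem_domain : ∀ α ∈ Icc (0 : ℝ) 1, ∀ t ∈ Ici (0 : ℝ), γ α t ∈ bc.domain
  ode : ∀ α ∈ Icc (0 : ℝ) 1, ∀ t ∈ Ici (0 : ℝ),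
    HasDerivWithinAt (γ α) (u (γ α t) t) (Ici 0) t

open Classical in
/-- The limit value `(2π)⁻² (∑ wₐ |u₀'''(a)| ^ (-1/2)) ^ (-2)`, the sum being over the set `A` of
maximum points in `[0,1]`, with weight `wₐ = 1` for `a ∈ (0,1)` and `wₐ = 1/2` for the end points.
For one interior maximum point `a` this is `|u₀'''(a)| / (2π) ^ 2`. -/
noncomputable def limitValue (bc : BoundaryCondition) (u₀ : ℝ → ℝ) (A : Finset ℝ) : ℝ :=
  1 / ((2 * Real.pi) ^ 2 *
    (∑ a ∈ A, (if a = 0 ∨ a = 1 then (1 / 2 : ℝ) else 1) /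
      Real.sqrt |iteratedDerivWithin 3 u₀ bc.domain a|) ^ 2)

end StagnationEuler

/-! ### Intervals of time and space -/

namespace StagnationEuler

/-! The equation is solved explicitly in Lagrangian variables. Along particle paths the strain `σ =
u_x` satisfies the Riccati equation `σ' = σ² + I(t)`, with `I` the same for all particles. The
Jacobian `J` of the flow has `J' = Jσ`, so `1/J` solves the linear equation `y'' = -I y` for every
label. Hence `1/J = φ(t)(1 - η(t) u₀'(α))`, and the condition `∫₀¹ J = 1` forces `φ = K0(η)` and `η'
= K0(η)⁻²`. The nonlocal term need not be known in advance: integrating the equation over `[0,1]`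
shows that any label-independent right-hand side equals `-2∫u_x²` (`nonlocal_term_eq`).

The construction is global exactly when `η` takes infinite time to reach `1/M`, that is, when `∫
K0²` diverges there. If `u₀''` vanishes at some maximum point, then `M - u₀'` is at most quadratic
near it, so `K0(η)² ≥ c/(1 - ηM)`, and the integral diverges logarithmically
(`Profile.integral_K0_sq_unbounded`). Inverting the flow then gives a global smooth solution
(`FlowInverse.isSmoothSolution`).

Every other solution is compared with this one. An energy estimate for the difference of the
derivatives gives uniqueness among solutions that agree somewhere at each time. Dirichlet conditions
supply the end point. In the periodic case a change of frame matches the means, which makes the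
difference vanish somewhere. So every solution is `V(x - c(t), t) + g(t)` with `c' = g`
(`IsSmoothSolution.representation`), and boundedness, continuation and asymptotics are read off `V`.

For the limits put `s² = 1/η - M`. The strain becomes `(1/(s² + M - u₀') - P₂/P₁)/P₁²`, where `P_m =
∫(s² + M - u₀')⁻ᵐ`. At nondegenerate maxima Laplace asymptotics (`tendsto_laplace`) give `s P₁ → πW`
and `s³ P₂ → πW/2`. The first term, multiplied by `s²`, is `1` at a maximum and tends to `0`
elsewhere, whence `±1/(2(πW)²)`. At a degenerate maximum `K0` grows fast enough to force the strain
to zero uniformly (`TimeChange.strain_tendsto_zero`). -/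

/-- A time interval `[0, T)`, with `0 < T ≤ ∞`. -/
structure TimeInterval (D : Set ℝ) : Prop where
  zero_mem : (0 : ℝ) ∈ D
  nonneg : ∀ t ∈ D, 0 ≤ t
  exists_gt : ∀ t ∈ D, ∃ b, t < b ∧ Icc 0 b ⊆ D

/-- An interval containing `[0, 1]`. -/
structure SpaceInterval (S : Set ℝ) : Prop where
  ordConnected : S.OrdConnected
  Icc_subset : Icc (0 : ℝ) 1 ⊆ S

theorem timeInterval_Ici : TimeInterval (Ici 0) :=
  ⟨mem_Ici.2 le_rfl, fun _ h => h, fun t _ => ⟨t + 1, by linarith, fun _ h => h.1⟩⟩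

theorem timeInterval_Ico {T : ℝ} (hT : 0 < T) : TimeInterval (Ico 0 T) :=
  ⟨⟨le_rfl, hT⟩, fun _ h => h.1, fun t h => ⟨(t + T) / 2, by linarith [h.2],
    fun s hs => ⟨hs.1, by linarith [h.2, hs.2]⟩⟩⟩

theorem BoundaryCondition.spaceInterval (bc : BoundaryCondition) : SpaceInterval bc.domain := by
  cases bc
  · exact ⟨ordConnected_univ, subset_univ _⟩
  · exact ⟨ordConnected_Icc, subset_rfl⟩
  · exact ⟨ordConnected_univ, subset_univ _⟩

namespace TimeInterval

variable {D : Set ℝ}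

theorem ordConnected (hD : TimeInterval D) : D.OrdConnected := by
  refine ⟨fun x hx y hy z hz => ?_⟩
  obtain ⟨b, hb, h⟩ := hD.exists_gt y hy
  exact h ⟨(hD.nonneg x hx).trans hz.1, hz.2.trans hb.le⟩

theorem uniqueDiffOn (hD : TimeInterval D) : UniqueDiffOn ℝ D := by
  obtain ⟨b, hb, h⟩ := hD.exists_gt 0 hD.zero_mem
  refine uniqueDiffOn_convex hD.ordConnected.convex ⟨b / 2, ?_⟩
  exact interior_mono h (by rw [interior_Icc]; constructor <;> linarith)

theorem mem_nhds (hD : TimeInterval D) {t : ℝ} (ht : t ∈ D) (h0 : 0 < t) : D ∈ 𝓝 t := by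
  obtain ⟨b, hb, h⟩ := hD.exists_gt t ht
  exact mem_of_superset (Icc_mem_nhds h0 hb) h

theorem Icc_mem_nhdsWithin (hD : TimeInterval D) {t b : ℝ} (hb : t < b) :
    Icc 0 b ∈ 𝓝[D] t := by
  filter_upwards [self_mem_nhdsWithin, mem_nhdsWithin_of_mem_nhds (Iic_mem_nhds hb)] with s h1 h2
  exact ⟨hD.nonneg s h1, h2⟩

theorem Icc_subset (hD : TimeInterval D) {t : ℝ} (ht : t ∈ D) : Icc 0 t ⊆ D := by
  obtain ⟨b, hb, h⟩ := hD.exists_gt t ht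
  exact (Icc_subset_Icc_right hb.le).trans h

theorem subset_Ici (hD : TimeInterval D) : D ⊆ Ici 0 := hD.nonneg

end TimeInterval

namespace SpaceInterval

variable {S : Set ℝ}

theorem zero_mem (hS : SpaceInterval S) : (0 : ℝ) ∈ S := hS.Icc_subset ⟨le_rfl, zero_le_one⟩

theorem one_mem (hS : SpaceInterval S) : (1 : ℝ) ∈ S := hS.Icc_subset ⟨zero_le_one, le_rfl⟩

theorem uniqueDiffOn (hS : SpaceInterval S) : UniqueDiffOn ℝ S := by
  refine uniqueDiffOn_convex hS.ordConnected.convex ⟨1 / 2, ?_⟩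
  exact interior_mono hS.Icc_subset (by rw [interior_Icc]; constructor <;> norm_num)

theorem uIcc_subset (hS : SpaceInterval S) {x : ℝ} (hx : x ∈ S) : uIcc 0 x ⊆ S :=
  hS.ordConnected.uIcc_subset hS.zero_mem hx

end SpaceInterval

/-! ### Joint smoothness in space and time from partial derivatives -/

/-- Joint smoothness of `f (x, t)` on `S × D`. -/
abbrev Smooth2 (S D : Set ℝ) (f : ℝ → ℝ → ℝ) : Prop :=
  ContDiffOn ℝ ∞ (fun p : ℝ × ℝ => f p.1 p.2) (S ×ˢ D)

/-- The derivative `f_t (x, t)` on the time interval `D`. -/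
noncomputable def ut (D : Set ℝ) (f : ℝ → ℝ → ℝ) (x t : ℝ) : ℝ :=
  derivWithin (fun s => f x s) D t

/-- The linear form `(x, t) ↦ a x + b t`. -/
noncomputable def lin (a b : ℝ) : ℝ × ℝ →L[ℝ] ℝ :=
  a • ContinuousLinearMap.fst ℝ ℝ ℝ + b • ContinuousLinearMap.snd ℝ ℝ ℝ

@[simp] theorem lin_apply (a b : ℝ) (v : ℝ × ℝ) : lin a b v = a * v.1 + b * v.2 := by
  simp [lin]

theorem contDiffOn_lin {n : WithTop ℕ∞} {s : Set (ℝ × ℝ)} {a b : ℝ × ℝ → ℝ}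
    (ha : ContDiffOn ℝ n a s) (hb : ContDiffOn ℝ n b s) :
    ContDiffOn ℝ n (fun p => lin (a p) (b p)) s := by
  unfold lin
  exact (ha.smul contDiffOn_const).add (hb.smul contDiffOn_const)

/-- The increment is split at `(x₀, t)`: the mean value inequality in `x` handles one piece, the
derivative at `t₀` the other. Only the `x`-partial has to be continuous, which allows a first
regularity step when nothing is yet known about `t`-partials away from the point. -/
theorem hasFDerivWithinAt_of_partials {S D : Set ℝ} (hS : S.OrdConnected) {f f1 : ℝ → ℝ → ℝ}
    {b x₀ t₀ : ℝ} (hx₀ : x₀ ∈ S)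
    (h1 : ∀ x ∈ S, ∀ t ∈ D, HasDerivWithinAt (fun y => f y t) (f1 x t) S x)
    (hc : ContinuousWithinAt (fun p : ℝ × ℝ => f1 p.1 p.2) (S ×ˢ D) (x₀, t₀))
    (h2 : HasDerivWithinAt (fun s => f x₀ s) b D t₀) :
    HasFDerivWithinAt (fun p : ℝ × ℝ => f p.1 p.2) (lin (f1 x₀ t₀) b) (S ×ˢ D) (x₀, t₀) := by
  rw [hasFDerivWithinAt_iff_isLittleO, Asymptotics.isLittleO_iff]
  intro ε hε
  obtain ⟨δ, hδ, hcδ⟩ := Metric.continuousWithinAt_iff.1 hc (ε / 2) (by positivity)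
  have h2' := Asymptotics.isLittleO_iff.1 (hasDerivWithinAt_iff_isLittleO.1 h2)
    (show 0 < ε / 2 by positivity)
  obtain ⟨δ', hδ', h2'⟩ := Metric.mem_nhdsWithin_iff.1 h2'
  refine Metric.mem_nhdsWithin_iff.2 ⟨min δ δ', lt_min hδ hδ', ?_⟩
  rintro ⟨x, t⟩ ⟨hp, hxS, htD⟩
  simp only at hxS htD
  rw [Metric.mem_ball, Prod.dist_eq, max_lt_iff] at hp
  obtain ⟨hpx, hpt⟩ := hp
  simp only at hpx hpt
  have e2 := h2' ⟨Metric.mem_ball.2 (hpt.trans_le (min_le_right _ _)), htD⟩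
  simp only [mem_ofPred_eq, smul_eq_mul] at e2
  have hconv : Convex ℝ (S ∩ Metric.ball x₀ δ) :=
    hS.convex.inter (convex_ball _ _)
  have e1 := hconv.norm_image_sub_le_of_norm_hasDerivWithin_le
    (f := fun y => f y t - f1 x₀ t₀ * y) (f' := fun y => f1 y t - f1 x₀ t₀) (C := ε / 2)
    (x := x₀) (y := x)
    (fun y hy => by
      have := ((h1 y hy.1 t htD).mono inter_subset_left).sub
        (((hasDerivWithinAt_id y (S ∩ Metric.ball x₀ δ)).const_mul (f1 x₀ t₀)))
      rw [mul_one] at this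
      exact this)
    (fun y hy => by
      have := @hcδ (y, t) ⟨hy.1, htD⟩ (by
        rw [Prod.dist_eq, max_lt_iff]
        exact ⟨hy.2, hpt.trans_le (min_le_left _ _)⟩)
      rw [Real.dist_eq] at this
      exact this.le)
    ⟨hx₀, Metric.mem_ball_self hδ⟩ ⟨hxS, hpx.trans_le (min_le_left _ _)⟩
  simp only [mem_ofPred_eq, lin_apply, Prod.fst_sub, Prod.snd_sub, Real.norm_eq_abs] at e1 e2 ⊢
  have n1 : |x - x₀| ≤ ‖((x, t) : ℝ × ℝ) - (x₀, t₀)‖ := by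
    rw [Prod.norm_def]; exact le_max_left _ _
  have n2 : |t - t₀| ≤ ‖((x, t) : ℝ × ℝ) - (x₀, t₀)‖ := by
    rw [Prod.norm_def]; exact le_max_right _ _
  have key : f x t - f x₀ t₀ - (f1 x₀ t₀ * (x - x₀) + b * (t - t₀))
      = (f x t - f1 x₀ t₀ * x - (f x₀ t - f1 x₀ t₀ * x₀))
        + (f x₀ t - f x₀ t₀ - (t - t₀) * b) := by ring
  rw [key]
  refine (abs_add_le _ _).trans ?_
  nlinarith

section Slices

variable {S D : Set ℝ} {f f1 f2 : ℝ → ℝ → ℝ}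

theorem hasDerivWithinAt_fst_of_hasFDerivWithinAt {L : ℝ × ℝ →L[ℝ] ℝ} {x t : ℝ} (ht : t ∈ D)
    (h : HasFDerivWithinAt (fun p : ℝ × ℝ => f p.1 p.2) L (S ×ˢ D) (x, t)) :
    HasDerivWithinAt (fun y => f y t) (L (1, 0)) S x :=
  h.comp_hasDerivWithinAt (f := fun y => (y, t)) x
    ((hasDerivWithinAt_id x S).prodMk (hasDerivWithinAt_const x S t)) (fun _ hy => ⟨hy, ht⟩)

theorem hasDerivWithinAt_snd_of_hasFDerivWithinAt {L : ℝ × ℝ →L[ℝ] ℝ} {x t : ℝ} (hx : x ∈ S)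
    (h : HasFDerivWithinAt (fun p : ℝ × ℝ => f p.1 p.2) L (S ×ˢ D) (x, t)) :
    HasDerivWithinAt (fun s => f x s) (L (0, 1)) D t :=
  h.comp_hasDerivWithinAt (f := fun s => (x, s)) t
    ((hasDerivWithinAt_const t D x).prodMk (hasDerivWithinAt_id t D)) (fun _ hy => ⟨hx, hy⟩)

theorem Smooth2.hasFDerivWithinAt (hf : Smooth2 S D f) {x t : ℝ} (hx : x ∈ S) (ht : t ∈ D) :
    HasFDerivWithinAt (fun p : ℝ × ℝ => f p.1 p.2)
      (fderivWithin ℝ (fun p : ℝ × ℝ => f p.1 p.2) (S ×ˢ D) (x, t)) (S ×ˢ D) (x, t) :=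
  (hf.differentiableOn (by simp) (x, t) ⟨hx, ht⟩).hasFDerivWithinAt

theorem Smooth2.hasDerivWithinAt_ux (hf : Smooth2 S D f) {x t : ℝ} (hx : x ∈ S) (ht : t ∈ D) :
    HasDerivWithinAt (fun y => f y t) (ux S f x t) S x :=
  (hasDerivWithinAt_fst_of_hasFDerivWithinAt ht
    (hf.hasFDerivWithinAt hx ht)).differentiableWithinAt.hasDerivWithinAt

theorem Smooth2.hasDerivWithinAt_ut (hf : Smooth2 S D f) {x t : ℝ} (hx : x ∈ S) (ht : t ∈ D) :
    HasDerivWithinAt (fun s => f x s) (ut D f x t) D t :=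
  (hasDerivWithinAt_snd_of_hasFDerivWithinAt hx
    (hf.hasFDerivWithinAt hx ht)).differentiableWithinAt.hasDerivWithinAt

theorem Smooth2.ux (hf : Smooth2 S D f) (hS : UniqueDiffOn ℝ S) (hD : UniqueDiffOn ℝ D) :
    Smooth2 S D (ux S f) := by
  have h := ((contDiffOn_infty_iff_fderivWithin (hS.prod hD)).1 hf).2.clm_apply
    (contDiffOn_const (c := ((1, 0) : ℝ × ℝ)))
  refine h.congr fun p hp => ?_
  exact (hasDerivWithinAt_fst_of_hasFDerivWithinAt hp.2
    (hf.hasFDerivWithinAt hp.1 hp.2)).derivWithin (hS _ hp.1)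

theorem Smooth2.ut (hf : Smooth2 S D f) (hS : UniqueDiffOn ℝ S) (hD : UniqueDiffOn ℝ D) :
    Smooth2 S D (ut D f) := by
  have h := ((contDiffOn_infty_iff_fderivWithin (hS.prod hD)).1 hf).2.clm_apply
    (contDiffOn_const (c := ((0, 1) : ℝ × ℝ)))
  refine h.congr fun p hp => ?_
  exact (hasDerivWithinAt_snd_of_hasFDerivWithinAt hp.1
    (hf.hasFDerivWithinAt hp.1 hp.2)).derivWithin (hD _ hp.2)

theorem Smooth2.slice_fst (hf : Smooth2 S D f) {t : ℝ} (ht : t ∈ D) :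
    ContDiffOn ℝ ∞ (fun x => f x t) S :=
  hf.comp (f := fun x : ℝ => (x, t)) (contDiffOn_id.prodMk contDiffOn_const) fun _ hx => ⟨hx, ht⟩

theorem Smooth2.slice_snd (hf : Smooth2 S D f) {x : ℝ} (hx : x ∈ S) :
    ContDiffOn ℝ ∞ (fun t => f x t) D :=
  hf.comp (f := fun t : ℝ => (x, t)) (contDiffOn_const.prodMk contDiffOn_id) fun _ ht => ⟨hx, ht⟩

theorem smooth2_fst {g : ℝ → ℝ} (hg : ContDiffOn ℝ ∞ g S) : Smooth2 S D (fun x _ => g x) :=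
  hg.comp contDiffOn_fst fun _ h => h.1

theorem smooth2_snd {g : ℝ → ℝ} (hg : ContDiffOn ℝ ∞ g D) : Smooth2 S D (fun _ t => g t) :=
  hg.comp contDiffOn_snd fun _ h => h.2

/-- Chain rule along a curve. -/
theorem Smooth2.hasFDerivWithinAt_lin (hf : Smooth2 S D f) (hS : S.OrdConnected)
    (hS' : UniqueDiffOn ℝ S) (hD : UniqueDiffOn ℝ D)
    {x t : ℝ} (hx : x ∈ S) (ht : t ∈ D) :
    HasFDerivWithinAt (fun p : ℝ × ℝ => f p.1 p.2)
      (lin (StagnationEuler.ux S f x t) (StagnationEuler.ut D f x t)) (S ×ˢ D) (x, t) :=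
  hasFDerivWithinAt_of_partials hS hx (fun _ hx _ ht => hf.hasDerivWithinAt_ux hx ht)
    ((hf.ux hS' hD).continuousOn _ ⟨hx, ht⟩) (hf.hasDerivWithinAt_ut hx ht)

theorem Smooth2.mono (hf : Smooth2 S D f) {D' : Set ℝ} (h : D' ⊆ D) : Smooth2 S D' f :=
  ContDiffOn.mono hf (prod_mono subset_rfl h)

theorem ux_congr {t : ℝ} {g : ℝ → ℝ → ℝ} (h : ∀ x ∈ S, f x t = g x t) {x : ℝ} (hx : x ∈ S) :
    ux S f x t = ux S g x t :=
  derivWithin_congr (fun y hy => h y hy) (h x hx)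

theorem contDiffOn_succ_of_partials (hS : S.OrdConnected) (hS' : UniqueDiffOn ℝ S)
    (hD : UniqueDiffOn ℝ D) {n : ℕ}
    (h1 : ∀ x ∈ S, ∀ t ∈ D, HasDerivWithinAt (fun y => f y t) (f1 x t) S x)
    (h2 : ∀ x ∈ S, ∀ t ∈ D, HasDerivWithinAt (fun s => f x s) (f2 x t) D t)
    (c1 : ContDiffOn ℝ n (fun p : ℝ × ℝ => f1 p.1 p.2) (S ×ˢ D))
    (c2 : ContDiffOn ℝ n (fun p : ℝ × ℝ => f2 p.1 p.2) (S ×ˢ D)) :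
    ContDiffOn ℝ (n + 1) (fun p : ℝ × ℝ => f p.1 p.2) (S ×ˢ D) := by
  rw [contDiffOn_succ_iff_hasFDerivWithinAt_of_uniqueDiffOn (hS'.prod hD)]
  refine ⟨by simp, fun p => lin (f1 p.1 p.2) (f2 p.1 p.2), contDiffOn_lin c1 c2, ?_⟩
  rintro ⟨x, t⟩ ⟨hx, ht⟩
  exact hasFDerivWithinAt_of_partials hS hx h1 (c1.continuousOn _ ⟨hx, ht⟩) (h2 x hx t ht)

end Slices

/-! ### Primitives and differentiation under the integral sign -/

section Primitive

variable {S D : Set ℝ}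

theorem hasDerivWithinAt_primitive (hS : S.OrdConnected) (h0 : 0 ∈ S) {g : ℝ → ℝ} (hg : ContinuousOn g S)
    {x : ℝ} (hx : x ∈ S) : HasDerivWithinAt (fun y => ∫ a in (0 : ℝ)..y, g a) (g x) S x := by
  have hint : ∀ y ∈ S, ∀ z ∈ S, IntervalIntegrable g MeasureTheory.volume y z :=
    fun y hy z hz => (hg.mono (hS.uIcc_subset hy hz)).intervalIntegrable
  rw [hasDerivWithinAt_iff_isLittleO, Asymptotics.isLittleO_iff]
  intro ε hε
  obtain ⟨δ, hδ, h⟩ := Metric.continuousWithinAt_iff.1 (hg x hx) ε hε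
  refine Metric.mem_nhdsWithin_iff.2 ⟨δ, hδ, ?_⟩
  rintro y ⟨hy, hyS⟩
  have e : (∫ a in (0 : ℝ)..y, g a) - (∫ a in (0 : ℝ)..x, g a) - (y - x) • g x
      = ∫ a in x..y, (g a - g x) := by
    rw [intervalIntegral.integral_interval_sub_left (hint _ h0 _ hyS)
      (hint _ h0 _ hx), intervalIntegral.integral_sub (hint _ hx _ hyS) (by simp),
      intervalIntegral.integral_const]
  rw [mem_ofPred_eq, e, Real.norm_eq_abs (y - x)]
  refine intervalIntegral.norm_integral_le_of_norm_le_const fun a ha => ?_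
  have ha' : a ∈ uIcc x y := uIoc_subset_uIcc ha
  have := h (hS.uIcc_subset hx hyS ha') (by
    rw [Metric.mem_ball, dist_comm] at hy
    rw [dist_comm]
    exact (Real.dist_left_le_of_mem_uIcc ha').trans_lt hy)
  rw [Real.dist_eq] at this
  exact this.le

theorem hasDerivWithinAt_parametric (hS : SpaceInterval S) (hD : TimeInterval D)
    {f f2 : ℝ → ℝ → ℝ}
    (hf : ContinuousOn (fun p : ℝ × ℝ => f p.1 p.2) (S ×ˢ D))
    (h2 : ∀ x ∈ S, ∀ t ∈ D, HasDerivWithinAt (fun s => f x s) (f2 x t) D t)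
    (hf2 : ContinuousOn (fun p : ℝ × ℝ => f2 p.1 p.2) (S ×ˢ D))
    {x t : ℝ} (hx : x ∈ S) (ht : t ∈ D) :
    HasDerivWithinAt (fun s => ∫ a in (0 : ℝ)..x, f a s) (∫ a in (0 : ℝ)..x, f2 a t) D t := by
  obtain ⟨b, hb, hbD⟩ := hD.exists_gt t ht
  have h0x := hS.uIcc_subset hx
  have hint : ∀ g : ℝ → ℝ → ℝ, ContinuousOn (fun p : ℝ × ℝ => g p.1 p.2) (S ×ˢ D) → ∀ s ∈ D,
      IntervalIntegrable (fun a => g a s) MeasureTheory.volume 0 x := fun g hg s hs =>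
    (hg.comp (f := fun a : ℝ => (a, s)) (by fun_prop) fun a ha =>
      ⟨h0x ha, hs⟩).intervalIntegrable
  have huc := (isCompact_uIcc.prod isCompact_Icc).uniformContinuousOn_of_continuous
    (hf2.mono (prod_mono h0x hbD))
  rw [hasDerivWithinAt_iff_isLittleO, Asymptotics.isLittleO_iff]
  intro ε hε
  -- The pointwise error `ε'` gets multiplied by the length of the interval of integration.
  obtain ⟨ε', hε', hεx⟩ : ∃ ε' : ℝ, 0 < ε' ∧ ε' * |x - 0| ≤ ε := by
    refine ⟨ε / (|x - 0| + 1), by positivity, ?_⟩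
    rw [div_mul_eq_mul_div, div_le_iff₀ (by positivity)]
    nlinarith [abs_nonneg (x - 0)]
  obtain ⟨δ, hδ, h⟩ := Metric.uniformContinuousOn_iff.1 huc ε' hε'
  filter_upwards [hD.Icc_mem_nhdsWithin hb, mem_nhdsWithin_of_mem_nhds (Metric.ball_mem_nhds t hδ)]
    with s hs hst
  have hsD := hbD hs
  have htb : t ∈ Icc 0 b := ⟨hD.nonneg t ht, hb.le⟩
  have e : (∫ a in (0 : ℝ)..x, f a s) - (∫ a in (0 : ℝ)..x, f a t)
      - (s - t) • (∫ a in (0 : ℝ)..x, f2 a t)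
      = ∫ a in (0 : ℝ)..x, (f a s - f a t - (s - t) * f2 a t) := by
    rw [intervalIntegral.integral_sub ((hint f hf s hsD).sub (hint f hf t ht))
      ((hint f2 hf2 t ht).const_mul _), intervalIntegral.integral_sub (hint f hf s hsD)
      (hint f hf t ht), intervalIntegral.integral_const_mul, smul_eq_mul]
  rw [e]
  refine (intervalIntegral.norm_integral_le_of_norm_le_const (C := ε' * ‖s - t‖)
    fun a ha => ?_).trans ?_
  · have ha' : a ∈ uIcc 0 x := uIoc_subset_uIcc ha
    have hconv : Convex ℝ (Icc 0 b ∩ Metric.ball t δ) := (convex_Icc 0 b).inter (convex_ball _ _)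
    have := hconv.norm_image_sub_le_of_norm_hasDerivWithin_le
      (f := fun r => f a r - f2 a t * r) (f' := fun r => f2 a r - f2 a t) (C := ε')
      (x := t) (y := s)
      (fun r hr => by
        have := ((h2 a (h0x ha') r (hbD hr.1)).mono (inter_subset_left.trans hbD)).sub
          (((hasDerivWithinAt_id r (Icc 0 b ∩ Metric.ball t δ)).const_mul (f2 a t)))
        rw [mul_one] at this
        exact this)
      (fun r hr => by
        have := h (a, r) ⟨ha', hr.1⟩ (a, t) ⟨ha', htb⟩ (by
          rw [Prod.dist_eq, max_lt_iff]
          exact ⟨by simpa using hδ, hr.2⟩)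
        rw [Real.dist_eq] at this
        exact this.le)
      ⟨htb, Metric.mem_ball_self hδ⟩ ⟨hs, hst⟩
    refine le_trans (le_of_eq ?_) this
    congr 1; ring
  · calc ε' * ‖s - t‖ * |x - 0| = (ε' * |x - 0|) * ‖s - t‖ := by ring
      _ ≤ ε * ‖s - t‖ := by gcongr

/-- The `x`-derivative of the primitive is `f` itself and the `t`-derivative is the primitive of
`f_t`; the induction therefore has to run over all `f` at once. -/
theorem Smooth2.primitive_aux (hS : SpaceInterval S) (hD : TimeInterval D) (n : ℕ) :
    ∀ f : ℝ → ℝ → ℝ, Smooth2 S D f →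
      ContDiffOn ℝ n (fun p : ℝ × ℝ => ∫ a in (0 : ℝ)..p.1, f a p.2) (S ×ˢ D) := by
  have h1 : ∀ f : ℝ → ℝ → ℝ, Smooth2 S D f → ∀ x ∈ S, ∀ t ∈ D,
      HasDerivWithinAt (fun y => ∫ a in (0 : ℝ)..y, f a t) (f x t) S x := fun f hf x hx t ht =>
    hasDerivWithinAt_primitive hS.ordConnected hS.zero_mem (hf.slice_fst ht).continuousOn hx
  have h2 : ∀ f : ℝ → ℝ → ℝ, Smooth2 S D f → ∀ x ∈ S, ∀ t ∈ D,
      HasDerivWithinAt (fun s => ∫ a in (0 : ℝ)..x, f a s)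
        (∫ a in (0 : ℝ)..x, StagnationEuler.ut D f a t) D t := fun f hf x hx t ht =>
    hasDerivWithinAt_parametric hS hD hf.continuousOn
      (fun _ hx _ ht => hf.hasDerivWithinAt_ut hx ht)
      (hf.ut hS.uniqueDiffOn hD.uniqueDiffOn).continuousOn hx ht
  induction n with
  | zero =>
    intro f hf
    rw [Nat.cast_zero, contDiffOn_zero]
    rintro ⟨x, t⟩ ⟨hx, ht⟩
    exact (hasFDerivWithinAt_of_partials (f := fun x t => ∫ a in (0 : ℝ)..x, f a t)
      hS.ordConnected hx (h1 f hf) (hf.continuousOn _ ⟨hx, ht⟩)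
      (h2 f hf x hx t ht)).continuousWithinAt
  | succ n ih =>
    intro f hf
    exact contDiffOn_succ_of_partials hS.ordConnected hS.uniqueDiffOn hD.uniqueDiffOn
      (h1 f hf) (h2 f hf) (hf.of_le (mod_cast le_top))
      (ih _ (hf.ut hS.uniqueDiffOn hD.uniqueDiffOn))

theorem Smooth2.primitive (hS : SpaceInterval S) (hD : TimeInterval D) {f : ℝ → ℝ → ℝ}
    (hf : Smooth2 S D f) : Smooth2 S D (fun x t => ∫ a in (0 : ℝ)..x, f a t) :=
  contDiffOn_infty.2 fun n => Smooth2.primitive_aux hS hD n f hf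

theorem Smooth2.hasDerivWithinAt_primitive_ut (hS : SpaceInterval S) (hD : TimeInterval D)
    {f : ℝ → ℝ → ℝ} (hf : Smooth2 S D f) {x t : ℝ} (hx : x ∈ S) (ht : t ∈ D) :
    HasDerivWithinAt (fun s => ∫ a in (0 : ℝ)..x, f a s)
      (∫ a in (0 : ℝ)..x, StagnationEuler.ut D f a t) D t :=
  hasDerivWithinAt_parametric hS hD hf.continuousOn
    (fun _ hx _ ht => hf.hasDerivWithinAt_ut hx ht)
    (hf.ut hS.uniqueDiffOn hD.uniqueDiffOn).continuousOn hx ht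

end Primitive

/-! ### The integrals `K0`, `K1` and the time change -/

/-- `∫₀¹ (1 - η u₁)⁻¹`. -/
noncomputable def K0 (u₁ : ℝ → ℝ) (η : ℝ) : ℝ := ∫ a in (0 : ℝ)..1, (1 - η * u₁ a)⁻¹

/-- The derivative of `K0` in `η`. -/
noncomputable def K1 (u₁ : ℝ → ℝ) (η : ℝ) : ℝ := ∫ a in (0 : ℝ)..1, u₁ a / (1 - η * u₁ a) ^ 2

/-- The derivative of `u₀` on `S`, subject to what the explicit solution needs. -/
structure Profile (S : Set ℝ) (u₁ : ℝ → ℝ) (M : ℝ) : Prop where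
  space : SpaceInterval S
  smooth : ContDiffOn ℝ ∞ u₁ S
  pos : 0 < M
  le : ∀ x ∈ S, u₁ x ≤ M
  bdd : ∃ C, ∀ x ∈ S, |u₁ x| ≤ C
  mean : ∫ a in (0 : ℝ)..1, u₁ a = 0

namespace Profile

variable {S : Set ℝ} {u₁ : ℝ → ℝ} {M : ℝ}

theorem timeInterval (h : Profile S u₁ M) : TimeInterval (Ico 0 (1 / M)) :=
  timeInterval_Ico (one_div_pos.2 h.pos)

theorem denom_pos (h : Profile S u₁ M) {x η : ℝ} (hx : x ∈ S) (hη : η ∈ Ico 0 (1 / M)) :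
    0 < 1 - η * u₁ x := by
  have h1 : η * u₁ x ≤ η * M := mul_le_mul_of_nonneg_left (h.le x hx) hη.1
  have h2 : η * M < 1 := (lt_div_iff₀ h.pos).1 hη.2
  linarith

theorem smooth2_denom (h : Profile S u₁ M) {D : Set ℝ} {η : ℝ → ℝ} (hη : ContDiffOn ℝ ∞ η D) :
    Smooth2 S D (fun a t => 1 - η t * u₁ a) :=
  contDiffOn_const.sub ((smooth2_snd hη).mul (smooth2_fst h.smooth))

theorem smooth2_inv (h : Profile S u₁ M) :
    Smooth2 S (Ico 0 (1 / M)) (fun a η => (1 - η * u₁ a)⁻¹) :=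
  (h.smooth2_denom contDiffOn_id).inv fun _ hp => (h.denom_pos hp.1 hp.2).ne'

theorem hasDerivWithinAt_inv (h : Profile S u₁ M) {a η : ℝ} (ha : a ∈ S)
    (hη : η ∈ Ico 0 (1 / M)) :
    HasDerivWithinAt (fun s => (1 - s * u₁ a)⁻¹) (u₁ a / (1 - η * u₁ a) ^ 2)
      (Ico 0 (1 / M)) η := by
  have := (((hasDerivWithinAt_id η (Ico 0 (1 / M))).mul_const (u₁ a)).const_sub 1).fun_inv
    (h.denom_pos ha hη).ne'
  simpa using this

theorem hasDerivWithinAt_K0 (h : Profile S u₁ M) {η : ℝ} (hη : η ∈ Ico 0 (1 / M)) :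
    HasDerivWithinAt (K0 u₁) (K1 u₁ η) (Ico 0 (1 / M)) η :=
  hasDerivWithinAt_parametric h.space h.timeInterval h.smooth2_inv.continuousOn
    (f2 := fun a η => u₁ a / (1 - η * u₁ a) ^ 2)
    (fun _ hx _ ht => h.hasDerivWithinAt_inv hx ht)
    (((smooth2_fst h.smooth).div ((h.smooth2_denom contDiffOn_id).pow 2)
      fun _ hp => (pow_pos (h.denom_pos hp.1 hp.2) 2).ne').continuousOn)
    h.space.one_mem hη

theorem contDiffOn_K0 (h : Profile S u₁ M) : ContDiffOn ℝ ∞ (K0 u₁) (Ico 0 (1 / M)) :=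
  (h.smooth2_inv.primitive h.space h.timeInterval).slice_snd h.space.one_mem

theorem contDiffOn_K1 (h : Profile S u₁ M) : ContDiffOn ℝ ∞ (K1 u₁) (Ico 0 (1 / M)) := by
  have hs : Smooth2 S (Ico 0 (1 / M)) (fun a η => u₁ a / (1 - η * u₁ a) ^ 2) :=
    (smooth2_fst h.smooth).div ((h.smooth2_denom contDiffOn_id).pow 2)
      fun _ hp => (pow_pos (h.denom_pos hp.1 hp.2) 2).ne'
  exact (hs.primitive h.space h.timeInterval).slice_snd h.space.one_mem

theorem hasDerivWithinAt_K1 (h : Profile S u₁ M) {η : ℝ} (hη : η ∈ Ico 0 (1 / M)) :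
    HasDerivWithinAt (K1 u₁) (derivWithin (K1 u₁) (Ico 0 (1 / M)) η) (Ico 0 (1 / M)) η :=
  (h.contDiffOn_K1.differentiableOn (by simp) η hη).hasDerivWithinAt

theorem continuousOn_Icc (h : Profile S u₁ M) : ContinuousOn u₁ (uIcc 0 1) :=
  h.smooth.continuousOn.mono (h.space.uIcc_subset h.space.one_mem)

theorem continuousOn_inv (h : Profile S u₁ M) {η : ℝ} (hη : η ∈ Ico 0 (1 / M)) :
    ContinuousOn (fun a => (1 - η * u₁ a)⁻¹) S :=
  (h.smooth2_inv.slice_fst hη).continuousOn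

/-- Integrate `1/(1 - y) ≥ 1 + y` with `y = η u₁`, which has mean zero. -/
theorem one_le_K0 (h : Profile S u₁ M) {η : ℝ} (hη : η ∈ Ico 0 (1 / M)) : 1 ≤ K0 u₁ η := by
  have hi : IntervalIntegrable u₁ MeasureTheory.volume 0 1 := h.continuousOn_Icc.intervalIntegrable
  have e : ∫ a in (0 : ℝ)..1, (1 + η * u₁ a) = 1 := by
    rw [intervalIntegral.integral_add (by simp) (hi.const_mul _),
      intervalIntegral.integral_const_mul, h.mean]
    simp
  rw [← e]
  refine intervalIntegral.integral_mono_on zero_le_one ((by simp : IntervalIntegrable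
    (fun _ => (1 : ℝ)) MeasureTheory.volume 0 1).add (hi.const_mul _))
    ((h.continuousOn_inv hη).mono (h.space.uIcc_subset h.space.one_mem)).intervalIntegrable
    fun a ha => ?_
  have hp := h.denom_pos (h.space.Icc_subset ha) hη
  rw [← one_div, le_div_iff₀ hp]
  nlinarith [sq_nonneg (η * u₁ a)]

theorem K0_pos (h : Profile S u₁ M) {η : ℝ} (hη : η ∈ Ico 0 (1 / M)) : 0 < K0 u₁ η :=
  zero_lt_one.trans_le (h.one_le_K0 hη)

theorem hasDerivWithinAt_integral_K0_sq (h : Profile S u₁ M) {η : ℝ} (hη : η ∈ Ico 0 (1 / M)) :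
    HasDerivWithinAt (fun s => ∫ r in (0 : ℝ)..s, K0 u₁ r ^ 2) (K0 u₁ η ^ 2)
      (Ico 0 (1 / M)) η :=
  hasDerivWithinAt_primitive h.timeInterval.ordConnected h.timeInterval.zero_mem
    (h.contDiffOn_K0.pow 2).continuousOn hη

end Profile

/-- The time change: `η' = K0(η)⁻²`, `η(0) = 0`. -/
structure TimeChange (u₁ : ℝ → ℝ) (M : ℝ) (η : ℝ → ℝ) : Prop where
  mem : ∀ t ∈ Ici (0 : ℝ), η t ∈ Ico 0 (1 / M)
  zero : η 0 = 0
  ode : ∀ t ∈ Ici (0 : ℝ), HasDerivWithinAt η (1 / K0 u₁ (η t) ^ 2) (Ici 0) t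
  tendsto : Tendsto η atTop (𝓝[<] (1 / M))

/-- The ODE separates: `η` is the inverse of `T(s) = ∫₀ˢ K0²`. The divergence hypothesis makes `T`
onto `[0, ∞)`, so `η` lives for all time. -/
theorem Profile.exists_timeChange {S : Set ℝ} {u₁ : ℝ → ℝ} {M : ℝ} (h : Profile S u₁ M)
    (hdiv : ∀ B, ∃ s ∈ Ico 0 (1 / M), B ≤ ∫ r in (0 : ℝ)..s, K0 u₁ r ^ 2) :
    ∃ η, TimeChange u₁ M η := by
  set D := Ico 0 (1 / M) with hD
  set T : ℝ → ℝ := fun s => ∫ r in (0 : ℝ)..s, K0 u₁ r ^ 2 with hT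
  have hder : ∀ s ∈ D, HasDerivWithinAt T (K0 u₁ s ^ 2) D s :=
    fun s hs => h.hasDerivWithinAt_integral_K0_sq hs
  have hT0 : T 0 = 0 := by simp [hT]
  have hcont : ContinuousOn T D := fun s hs => (hder s hs).continuousWithinAt
  -- `T - id` is nondecreasing because `K0 ≥ 1`; the inverse is thus 1-Lipschitz, which provides the
  -- continuity needed to differentiate it.
  have hexp : ∀ s ∈ D, ∀ r ∈ D, s ≤ r → r - s ≤ T r - T s := by
    intro s hs r hr hsr
    have hmono : MonotoneOn (fun x => T x - x) D := by
      refine monotoneOn_of_hasDerivWithinAt_nonneg (f' := fun x => K0 u₁ x ^ 2 - 1)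
        h.timeInterval.ordConnected.convex (hcont.sub continuousOn_id) (fun x hx => ?_)
        fun x hx => ?_
      · exact ((hder x (interior_subset hx)).sub (hasDerivWithinAt_id x D)).mono interior_subset
      · have := h.one_le_K0 (interior_subset hx)
        nlinarith
    have := hmono hs hr hsr
    simp only at this
    linarith
  have hex : ∀ t ∈ Ici (0 : ℝ), ∃ s ∈ D, T s = t := by
    intro t ht
    obtain ⟨s, hs, hst⟩ := hdiv t
    have := intermediate_value_Icc hs.1 (hcont.mono (h.timeInterval.Icc_subset hs))
    obtain ⟨r, hr, hrt⟩ := this ⟨hT0.le.trans ht, hst⟩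
    exact ⟨r, h.timeInterval.Icc_subset hs hr, hrt⟩
  choose! η hηD hηT using hex
  have hinv : ∀ t ∈ Ici (0 : ℝ), ∀ s ∈ Ici (0 : ℝ), |η t - η s| ≤ |t - s| := by
    intro t ht s hs
    rcases le_total (η s) (η t) with hle | hle
    · have := hexp _ (hηD s hs) _ (hηD t ht) hle
      rw [hηT t ht, hηT s hs] at this
      rw [abs_of_nonneg (by linarith)]
      exact this.trans (le_abs_self _)
    · have := hexp _ (hηD t ht) _ (hηD s hs) hle
      rw [hηT t ht, hηT s hs] at this
      rw [abs_sub_comm, abs_of_nonneg (by linarith), abs_sub_comm]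
      exact this.trans (le_abs_self _)
  refine ⟨η, hηD, ?_, fun t ht => ?_, ?_⟩
  · have h1 := hηT 0 (mem_Ici.2 le_rfl)
    have h2 := hηD 0 (mem_Ici.2 le_rfl)
    have := hexp 0 h.timeInterval.zero_mem _ h2 h2.1
    rw [h1, hT0] at this
    linarith [h2.1]
  · have hc : Tendsto η (𝓝[Ici 0] t) (𝓝[D] (η t)) := by
      refine tendsto_nhdsWithin_iff.2 ⟨?_, eventually_mem_nhdsWithin.mono hηD⟩
      rw [tendsto_iff_dist_tendsto_zero]
      have hz : Tendsto (fun s => |s - t|) (𝓝[Ici 0] t) (𝓝 0) := by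
        have : Tendsto (fun s => |s - t|) (𝓝 t) (𝓝 |t - t|) :=
          (by fun_prop : Continuous fun s => |s - t|).tendsto t
        simpa using this.mono_left nhdsWithin_le_nhds
      refine squeeze_zero' (Eventually.of_forall fun _ => dist_nonneg) ?_ hz
      filter_upwards [self_mem_nhdsWithin] with s hs
      exact hinv s hs t ht
    have hne : K0 u₁ (η t) ^ 2 ≠ 0 := (pow_pos (h.K0_pos (hηD t ht)) 2).ne'
    have h1 : HasFDerivWithinAt T (ContinuousLinearMap.toSpanSingleton ℝ (K0 u₁ (η t) ^ 2)) D (η t) :=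
      (hder _ (hηD t ht)).hasFDerivWithinAt
    have := h1.of_comp_of_leftInverse (h := id) (h' := ContinuousLinearMap.id ℝ ℝ)
      (f'symm := ContinuousLinearMap.toSpanSingleton ℝ (1 / K0 u₁ (η t) ^ 2)) hc
      (hasFDerivWithinAt_id _ _)
      (eventually_mem_nhdsWithin.mono fun s hs => hηT s hs)
      (fun x => by simp [hne]) ht
    simpa using this.hasDerivWithinAt
  · refine tendsto_nhdsWithin_iff.2 ⟨?_, ?_⟩
    · refine tendsto_order.2 ⟨fun a ha => ?_, fun a ha => ?_⟩
      -- Once `t` exceeds `T s`, expansion forces `η t > s ≥ a`.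
      · set s := max a 0 with hs
        have hsD : s ∈ D := ⟨le_max_right _ _, max_lt ha (one_div_pos.2 h.pos)⟩
        filter_upwards [eventually_gt_atTop (T s), eventually_ge_atTop 0] with t ht ht0
        refine (le_max_left a 0).trans_lt (lt_of_not_ge fun hle => ?_)
        have := hexp _ (hηD t ht0) _ hsD hle
        rw [hηT t ht0] at this
        linarith
      · filter_upwards [eventually_ge_atTop 0] with t ht0
        exact (hηD t ht0).2.trans ha
    · filter_upwards [eventually_ge_atTop 0] with t ht0
      exact (hηD t ht0).2

/-- Bootstrap: the right-hand side of the ODE is a smooth function of `η`, so each order of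
smoothness gives the next. -/
theorem TimeChange.contDiffOn {S : Set ℝ} {u₁ η : ℝ → ℝ} {M : ℝ} (hη : TimeChange u₁ M η)
    (h : Profile S u₁ M) : ContDiffOn ℝ ∞ η (Ici 0) := by
  refine contDiffOn_infty.2 fun n => ?_
  induction n with
  | zero =>
    rw [Nat.cast_zero, contDiffOn_zero]
    exact fun t ht => (hη.ode t ht).continuousWithinAt
  | succ n ih =>
    have hu := timeInterval_Ici.uniqueDiffOn
    push_cast
    rw [contDiffOn_succ_iff_derivWithin hu]
    refine ⟨fun t ht => (hη.ode t ht).differentiableWithinAt, by simp, ?_⟩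
    have hK : ContDiffOn ℝ n (fun t => K0 u₁ (η t)) (Ici 0) :=
      (h.contDiffOn_K0.of_le (mod_cast le_top)).comp ih fun t ht => hη.mem t ht
    refine (contDiffOn_const (c := (1 : ℝ)).div (hK.pow 2) fun t ht =>
      (pow_pos (h.K0_pos (hη.mem t ht)) 2).ne').congr fun t ht => ?_
    exact (hη.ode t ht).derivWithin (hu t ht)

/-! ### The explicit flow in Lagrangian variables -/

section Definitions

variable (u₁ : ℝ → ℝ) (M : ℝ) (η : ℝ → ℝ) (b : ℝ)

/-- The Jacobian `γ_α` of the explicit flow. -/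
noncomputable def jac (a t : ℝ) : ℝ := (K0 u₁ (η t) * (1 - η t * u₁ a))⁻¹

/-- The value of `u_x` along the explicit flow. -/
noncomputable def strain (a t : ℝ) : ℝ :=
  (u₁ a / (1 - η t * u₁ a) - K1 u₁ (η t) / K0 u₁ (η t)) / K0 u₁ (η t) ^ 2

/-- The nonlocal term, in terms of the time change. -/
noncomputable def nonlocal (t : ℝ) : ℝ :=
  (2 * K1 u₁ (η t) ^ 2 / K0 u₁ (η t) ^ 2
    - derivWithin (K1 u₁) (Ico 0 (1 / M)) (η t) / K0 u₁ (η t)) / K0 u₁ (η t) ^ 4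

/-- The explicit flow. -/
noncomputable def flowMap (a t : ℝ) : ℝ := t * b + ∫ y in (0 : ℝ)..a, jac u₁ η y t

/-- The velocity along the explicit flow. -/
noncomputable def flowVel (a t : ℝ) : ℝ := b + ∫ y in (0 : ℝ)..a, jac u₁ η y t * strain u₁ η y t

end Definitions

section ExplicitFlow

variable {S : Set ℝ} {u₁ η : ℝ → ℝ} {M b : ℝ}

namespace TimeChange

section Basic

variable (hη : TimeChange u₁ M η) (h : Profile S u₁ M)
include hη h

theorem K0_pos {t : ℝ} (ht : t ∈ Ici (0 : ℝ)) : 0 < K0 u₁ (η t) := h.K0_pos (hη.mem t ht)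

theorem denom_pos {a t : ℝ} (ha : a ∈ S) (ht : t ∈ Ici (0 : ℝ)) : 0 < 1 - η t * u₁ a :=
  h.denom_pos ha (hη.mem t ht)

theorem jac_pos {a t : ℝ} (ha : a ∈ S) (ht : t ∈ Ici (0 : ℝ)) : 0 < jac u₁ η a t :=
  inv_pos.2 (mul_pos (hη.K0_pos h ht) (hη.denom_pos h ha ht))

theorem contDiffOn_K0 : ContDiffOn ℝ ∞ (fun t => K0 u₁ (η t)) (Ici 0) :=
  h.contDiffOn_K0.comp (hη.contDiffOn h) fun t ht => hη.mem t ht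

theorem contDiffOn_K1 : ContDiffOn ℝ ∞ (fun t => K1 u₁ (η t)) (Ici 0) :=
  h.contDiffOn_K1.comp (hη.contDiffOn h) fun t ht => hη.mem t ht

theorem smooth2_jac : Smooth2 S (Ici 0) (jac u₁ η) :=
  ((smooth2_snd (hη.contDiffOn_K0 h)).mul (h.smooth2_denom (hη.contDiffOn h))).inv fun _ hp =>
    (mul_pos (hη.K0_pos h hp.2) (hη.denom_pos h hp.1 hp.2)).ne'

theorem smooth2_strain : Smooth2 S (Ici 0) (strain u₁ η) := by
  refine ContDiffOn.div ?_ ((smooth2_snd (hη.contDiffOn_K0 h)).pow 2) fun p hp =>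
    (pow_pos (hη.K0_pos h hp.2) 2).ne'
  refine ContDiffOn.sub ?_ ?_
  · exact (smooth2_fst h.smooth).div (h.smooth2_denom (hη.contDiffOn h)) fun p hp =>
      (hη.denom_pos h hp.1 hp.2).ne'
  · exact (smooth2_snd (hη.contDiffOn_K1 h)).div (smooth2_snd (hη.contDiffOn_K0 h)) fun p hp =>
      (hη.K0_pos h hp.2).ne'

theorem hasDerivWithinAt_K0 {t : ℝ} (ht : t ∈ Ici (0 : ℝ)) :
    HasDerivWithinAt (fun s => K0 u₁ (η s)) (K1 u₁ (η t) * (1 / K0 u₁ (η t) ^ 2)) (Ici 0) t :=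
  (h.hasDerivWithinAt_K0 (hη.mem t ht)).comp t (hη.ode t ht) hη.mem

theorem hasDerivWithinAt_K1 {t : ℝ} (ht : t ∈ Ici (0 : ℝ)) :
    HasDerivWithinAt (fun s => K1 u₁ (η s))
      (derivWithin (K1 u₁) (Ico 0 (1 / M)) (η t) * (1 / K0 u₁ (η t) ^ 2)) (Ici 0) t :=
  (h.hasDerivWithinAt_K1 (hη.mem t ht)).comp t (hη.ode t ht) hη.mem

omit h in
theorem hasDerivWithinAt_denom {t : ℝ} (ht : t ∈ Ici (0 : ℝ)) (a : ℝ) :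
    HasDerivWithinAt (fun s => 1 - η s * u₁ a) (-(1 / K0 u₁ (η t) ^ 2 * u₁ a)) (Ici 0) t :=
  ((hη.ode t ht).mul_const _).const_sub _

theorem hasDerivWithinAt_jac {a t : ℝ} (ha : a ∈ S) (ht : t ∈ Ici (0 : ℝ)) :
    HasDerivWithinAt (jac u₁ η a) (jac u₁ η a t * strain u₁ η a t) (Ici 0) t := by
  have hK := (hη.K0_pos h ht).ne'
  have hd := (hη.denom_pos h ha ht).ne'
  have := ((hη.hasDerivWithinAt_K0 h ht).fun_mul (hη.hasDerivWithinAt_denom ht a)).fun_inv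
    (mul_ne_zero hK hd)
  refine this.congr_deriv ?_
  unfold jac strain
  field_simp
  ring

/-- The Riccati equation. With `q = u₁/(1 - ηu₁)` one has `q' = q²η'`, so the terms in `q²` and `q`
are precisely those of the squared strain; what remains does not depend on the label. -/
theorem hasDerivWithinAt_strain {a t : ℝ} (ha : a ∈ S) (ht : t ∈ Ici (0 : ℝ)) :
    HasDerivWithinAt (strain u₁ η a) (strain u₁ η a t ^ 2 + nonlocal u₁ M η t) (Ici 0) t := by
  have hK := (hη.K0_pos h ht).ne'
  have hd := (hη.denom_pos h ha ht).ne'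
  have := (((hasDerivWithinAt_const t (Ici 0) (u₁ a)).fun_div
    (hη.hasDerivWithinAt_denom ht a) hd).fun_sub ((hη.hasDerivWithinAt_K1 h ht).fun_div
      (hη.hasDerivWithinAt_K0 h ht) hK)).fun_div ((hη.hasDerivWithinAt_K0 h ht).fun_pow 2)
      (pow_ne_zero 2 hK)
  refine this.congr_deriv ?_
  unfold strain nonlocal
  field_simp
  ring

theorem ut_jac {a t : ℝ} (ha : a ∈ S) (ht : t ∈ Ici (0 : ℝ)) :
    ut (Ici 0) (jac u₁ η) a t = jac u₁ η a t * strain u₁ η a t :=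
  (hη.hasDerivWithinAt_jac h ha ht).derivWithin (timeInterval_Ici.uniqueDiffOn t ht)

theorem smooth2_flowMap : Smooth2 S (Ici 0) (flowMap u₁ η b) :=
  ((smooth2_snd contDiffOn_id).mul contDiffOn_const).add
    ((hη.smooth2_jac h).primitive h.space timeInterval_Ici)

theorem smooth2_flowVel : Smooth2 S (Ici 0) (flowVel u₁ η b) :=
  contDiffOn_const.add
    (Smooth2.primitive (f := fun a t => jac u₁ η a t * strain u₁ η a t) h.space timeInterval_Ici
      ((hη.smooth2_jac h).mul (hη.smooth2_strain h)))

theorem hasDerivWithinAt_flowMap_fst {a t : ℝ} (ha : a ∈ S) (ht : t ∈ Ici (0 : ℝ)) :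
    HasDerivWithinAt (fun y => flowMap u₁ η b y t) (jac u₁ η a t) S a :=
  (hasDerivWithinAt_primitive h.space.ordConnected h.space.zero_mem
    ((hη.smooth2_jac h).slice_fst ht).continuousOn ha).const_add _

theorem hasDerivWithinAt_flowVel_fst {a t : ℝ} (ha : a ∈ S) (ht : t ∈ Ici (0 : ℝ)) :
    HasDerivWithinAt (fun y => flowVel u₁ η b y t) (jac u₁ η a t * strain u₁ η a t) S a :=
  (hasDerivWithinAt_primitive h.space.ordConnected h.space.zero_mem
    (g := fun y => jac u₁ η y t * strain u₁ η y t)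
    (((hη.smooth2_jac h).slice_fst ht).mul ((hη.smooth2_strain h).slice_fst ht)).continuousOn
    ha).const_add _

theorem hasDerivWithinAt_flowMap_snd {a t : ℝ} (ha : a ∈ S) (ht : t ∈ Ici (0 : ℝ)) :
    HasDerivWithinAt (flowMap u₁ η b a) (flowVel u₁ η b a t) (Ici 0) t := by
  have h1 := (hη.smooth2_jac h).hasDerivWithinAt_primitive_ut h.space timeInterval_Ici ha ht
  have h2 : ∫ y in (0 : ℝ)..a, ut (Ici 0) (jac u₁ η) y t
      = ∫ y in (0 : ℝ)..a, jac u₁ η y t * strain u₁ η y t :=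
    intervalIntegral.integral_congr fun y hy => hη.ut_jac h (h.space.uIcc_subset ha hy) ht
  rw [h2] at h1
  have h3 := ((hasDerivWithinAt_id t (Ici 0)).mul_const b).fun_add h1
  rw [one_mul] at h3
  exact h3

/-- This is what the factor `K0` in the Jacobian is for: the flow preserves the length of the unit
interval. -/
theorem integral_jac {t : ℝ} (ht : t ∈ Ici (0 : ℝ)) : ∫ y in (0 : ℝ)..1, jac u₁ η y t = 1 := by
  have : ∀ y, jac u₁ η y t = (K0 u₁ (η t))⁻¹ * (1 - η t * u₁ y)⁻¹ := fun y => mul_inv _ _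
  simp_rw [this]
  rw [intervalIntegral.integral_const_mul]
  exact inv_mul_cancel₀ (hη.K0_pos h ht).ne'

theorem flowMap_strictMonoOn {t : ℝ} (ht : t ∈ Ici (0 : ℝ)) :
    StrictMonoOn (fun a => flowMap u₁ η b a t) S := by
  refine strictMonoOn_of_hasDerivWithinAt_pos (f' := fun a => jac u₁ η a t)
    h.space.ordConnected.convex
    (fun a ha => (hη.hasDerivWithinAt_flowMap_fst h ha ht).continuousWithinAt) (fun a ha =>
      (hη.hasDerivWithinAt_flowMap_fst h (interior_subset ha) ht).mono interior_subset)
    fun a ha => hη.jac_pos h (interior_subset ha) ht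

omit h in
theorem jac_at_zero {a : ℝ} : jac u₁ η a 0 = 1 := by
  have : K0 u₁ 0 = 1 := by simp [K0]
  simp [jac, hη.zero, this]

omit h in
theorem flowMap_zero (a : ℝ) : flowMap u₁ η b a 0 = a := by
  simp [flowMap, hη.jac_at_zero]

theorem strain_zero {a : ℝ} : strain u₁ η a 0 = u₁ a := by
  have h0 : K0 u₁ 0 = 1 := by simp [K0]
  have h1 : K1 u₁ 0 = 0 := by simp [K1, h.mean]
  simp [strain, hη.zero, h0, h1]

/-- Uniformity in the label, on a possibly unbounded `S` and for nearby times, is what makes the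
inverse flow jointly continuous. -/
theorem exists_jac_lower {t : ℝ} (ht : t ∈ Ici (0 : ℝ)) :
    ∃ j > 0, ∀ᶠ s in 𝓝[Ici 0] t, ∀ a ∈ S, j ≤ jac u₁ η a s := by
  obtain ⟨C, hC⟩ := h.bdd
  have hc0 : 0 ≤ C := (abs_nonneg _).trans (hC 0 h.space.zero_mem)
  refine ⟨((K0 u₁ (η t) + 1) * (1 + 1 / M * C))⁻¹, ?_, ?_⟩
  · have := hη.K0_pos h ht
    have := h.pos
    positivity
  · have hev : ∀ᶠ s in 𝓝[Ici 0] t, K0 u₁ (η s) < K0 u₁ (η t) + 1 :=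
      ((hη.hasDerivWithinAt_K0 h ht).continuousWithinAt.tendsto).eventually
        (eventually_lt_nhds (by simp))
    filter_upwards [hev, self_mem_nhdsWithin] with s hs hs0 a ha
    have h1 := hη.K0_pos h hs0
    have h2 := hη.denom_pos h ha hs0
    have h3 : 1 - η s * u₁ a ≤ 1 + 1 / M * C := by
      have e1 := hη.mem s hs0
      have e2 : η s * (-u₁ a) ≤ η s * C :=
        mul_le_mul_of_nonneg_left ((neg_le_abs _).trans (hC a ha)) e1.1
      have e3 : η s * C ≤ 1 / M * C := mul_le_mul_of_nonneg_right e1.2.le hc0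
      linarith
    exact inv_anti₀ (mul_pos h1 h2) (mul_le_mul hs.le h3 h2.le (by linarith))

end Basic

end TimeChange

/-! ### Inverting the flow; the Eulerian velocity -/

/-- The explicit flow with its inverse. -/
structure FlowInverse (S : Set ℝ) (u₁ η : ℝ → ℝ) (b : ℝ) (β : ℝ → ℝ → ℝ) : Prop where
  maps : ∀ t ∈ Ici (0 : ℝ), ∀ a ∈ S, flowMap u₁ η b a t ∈ S
  mem : ∀ t ∈ Ici (0 : ℝ), ∀ x ∈ S, β x t ∈ S
  right_inv : ∀ t ∈ Ici (0 : ℝ), ∀ x ∈ S, flowMap u₁ η b (β x t) t = x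

namespace FlowInverse

variable {β : ℝ → ℝ → ℝ} (hβ : FlowInverse S u₁ η b β) (hη : TimeChange u₁ M η)
  (h : Profile S u₁ M)
include hβ hη h

theorem left_inv {a t : ℝ} (ha : a ∈ S) (ht : t ∈ Ici (0 : ℝ)) : β (flowMap u₁ η b a t) t = a :=
  (hη.flowMap_strictMonoOn h ht).injOn (hβ.mem t ht _ (hβ.maps t ht a ha)) ha
    (hβ.right_inv t ht _ (hβ.maps t ht a ha))

theorem continuousWithinAt {x t : ℝ} (hx : x ∈ S) (ht : t ∈ Ici (0 : ℝ)) :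
    ContinuousWithinAt (fun p : ℝ × ℝ => β p.1 p.2) (S ×ˢ Ici 0) (x, t) := by
  obtain ⟨j, hj, hjev⟩ := hη.exists_jac_lower h ht
  set a := β x t with ha_def
  have ha : a ∈ S := hβ.mem t ht x hx
  -- The flow expands distances by at least `j`, so `|β(y,s) - a| ≤ |y - flowMap(a,s)|/j`, and the
  -- right side tends to zero.
  have hlow : ∀ s ∈ Ici (0 : ℝ), (∀ a ∈ S, j ≤ jac u₁ η a s) → ∀ y ∈ S, ∀ z ∈ S,
      j * |y - z| ≤ |flowMap u₁ η b y s - flowMap u₁ η b z s| := by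
    intro s hs hjs
    have hmono : MonotoneOn (fun y => flowMap u₁ η b y s - j * y) S := by
      refine monotoneOn_of_hasDerivWithinAt_nonneg (f' := fun y => jac u₁ η y s - j)
        h.space.ordConnected.convex (fun y hy => ?_) (fun y hy => ?_) fun y hy => ?_
      · exact ((hη.hasDerivWithinAt_flowMap_fst h hy hs).continuousWithinAt).sub (by fun_prop)
      · have := ((hη.hasDerivWithinAt_flowMap_fst (b := b) h (interior_subset hy) hs).fun_sub
          ((hasDerivWithinAt_id y S).const_mul j)).mono interior_subset
        rw [mul_one] at this
        exact this
      · exact sub_nonneg.2 (hjs y (interior_subset hy))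
    intro y hy z hz
    rcases le_total y z with hyz | hyz
    · have := hmono hy hz hyz
      simp only at this
      rw [abs_sub_comm, abs_of_nonneg (sub_nonneg.2 hyz), abs_sub_comm]
      refine le_trans ?_ (le_abs_self _)
      linarith
    · have := hmono hz hy hyz
      simp only at this
      rw [abs_of_nonneg (sub_nonneg.2 hyz)]
      refine le_trans ?_ (le_abs_self _)
      linarith
  have hz : Tendsto (fun p : ℝ × ℝ => |p.1 - flowMap u₁ η b a p.2| / j) (𝓝[S ×ˢ Ici 0] (x, t))
      (𝓝 0) := by
    have hc : ContinuousWithinAt (fun p : ℝ × ℝ => |p.1 - flowMap u₁ η b a p.2| / j)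
        (S ×ˢ Ici 0) (x, t) := by
      refine ((continuousWithinAt_fst.sub ?_).abs).div_const j
      exact ContinuousWithinAt.comp (x := (x, t)) (t := Ici 0)
        (hη.hasDerivWithinAt_flowMap_snd h ha ht).continuousWithinAt
        (f := fun p : ℝ × ℝ => p.2) continuousWithinAt_snd fun p hp => hp.2
    have := hc.tendsto
    simpa [ha_def, hβ.right_inv t ht x hx] using this
  rw [ContinuousWithinAt, tendsto_iff_dist_tendsto_zero]
  refine squeeze_zero' (Eventually.of_forall fun _ => dist_nonneg) ?_ hz
  have hsnd : Tendsto (fun p : ℝ × ℝ => p.2) (𝓝[S ×ˢ Ici 0] (x, t)) (𝓝[Ici 0] t) :=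
    tendsto_nhdsWithin_iff.2 ⟨continuousWithinAt_snd.tendsto,
      eventually_mem_nhdsWithin.mono fun p hp => hp.2⟩
  filter_upwards [hsnd.eventually hjev, self_mem_nhdsWithin] with p hp hpm
  have := hlow p.2 hpm.2 hp _ (hβ.mem p.2 hpm.2 p.1 hpm.1) _ ha
  rw [hβ.right_inv p.2 hpm.2 p.1 hpm.1] at this
  rw [Real.dist_eq, le_div_iff₀ hj, mul_comm]
  exact this

/-- The map `(a,t) ↦ (flowMap a t, t)` has a triangular derivative with diagonal `J, 1`; given
continuity of the inverse, its derivative is the inverse matrix, of first row `1/J, -v/J`. -/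
theorem hasFDerivWithinAt {x t : ℝ} (hx : x ∈ S) (ht : t ∈ Ici (0 : ℝ)) :
    HasFDerivWithinAt (fun p : ℝ × ℝ => β p.1 p.2)
      (lin (jac u₁ η (β x t) t)⁻¹ (-(flowVel u₁ η b (β x t) t / jac u₁ η (β x t) t)))
      (S ×ˢ Ici 0) (x, t) := by
  set a := β x t with ha_def
  have ha : a ∈ S := hβ.mem t ht x hx
  have hj := (hη.jac_pos h ha ht).ne'
  have hf : HasFDerivWithinAt (fun p : ℝ × ℝ => (flowMap u₁ η b p.1 p.2, p.2))
      ((lin (jac u₁ η a t) (flowVel u₁ η b a t)).prod (ContinuousLinearMap.snd ℝ ℝ ℝ))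
      (S ×ˢ Ici 0) (a, t) :=
    (hasFDerivWithinAt_of_partials h.space.ordConnected ha
      (fun _ hx _ ht => hη.hasDerivWithinAt_flowMap_fst h hx ht)
      ((hη.smooth2_jac h).continuousOn _ ⟨ha, ht⟩)
      (hη.hasDerivWithinAt_flowMap_snd h ha ht)).prodMk hasFDerivWithinAt_snd
  have hg : Tendsto (fun p : ℝ × ℝ => (β p.1 p.2, p.2)) (𝓝[S ×ˢ Ici 0] (x, t))
      (𝓝[S ×ˢ Ici 0] (a, t)) :=
    tendsto_nhdsWithin_iff.2
      ⟨((hβ.continuousWithinAt hη h hx ht).prodMk continuousWithinAt_snd).tendsto,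
        eventually_mem_nhdsWithin.mono fun p hp => ⟨hβ.mem p.2 hp.2 p.1 hp.1, hp.2⟩⟩
  have := hf.of_comp_of_leftInverse (h := id) (h' := ContinuousLinearMap.id ℝ (ℝ × ℝ))
    (f'symm := (lin (jac u₁ η a t)⁻¹ (-(flowVel u₁ η b a t / jac u₁ η a t))).prod
      (ContinuousLinearMap.snd ℝ ℝ ℝ)) hg (hasFDerivWithinAt_id _ _)
    (eventually_mem_nhdsWithin.mono fun p hp => by
      simp [hβ.right_inv p.2 hp.2 p.1 hp.1])
    (fun v => by
      refine Prod.ext ?_ rfl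
      simp
      field_simp
      ring) ⟨hx, ht⟩
  exact this.fst

/-- Bootstrap again: the derivative of `β` is a smooth function evaluated at `β`. -/
theorem smooth2 : Smooth2 S (Ici 0) β := by
  refine contDiffOn_infty.2 fun n => ?_
  induction n with
  | zero =>
    rw [Nat.cast_zero, contDiffOn_zero]
    exact fun p hp => hβ.continuousWithinAt hη h hp.1 hp.2
  | succ n ih =>
    push_cast
    rw [contDiffOn_succ_iff_hasFDerivWithinAt_of_uniqueDiffOn
      (h.space.uniqueDiffOn.prod timeInterval_Ici.uniqueDiffOn)]
    have hmap : MapsTo (fun p : ℝ × ℝ => (β p.1 p.2, p.2)) (S ×ˢ Ici 0) (S ×ˢ Ici 0) :=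
      fun p hp => ⟨hβ.mem p.2 hp.2 p.1 hp.1, hp.2⟩
    have hj : ContDiffOn ℝ n (fun p : ℝ × ℝ => jac u₁ η (β p.1 p.2) p.2) (S ×ˢ Ici 0) :=
      ((hη.smooth2_jac h).of_le (mod_cast le_top)).comp (ih.prodMk contDiffOn_snd) hmap
    have hv : ContDiffOn ℝ n (fun p : ℝ × ℝ => flowVel u₁ η b (β p.1 p.2) p.2) (S ×ˢ Ici 0) :=
      ((hη.smooth2_flowVel h).of_le (mod_cast le_top)).comp (ih.prodMk contDiffOn_snd) hmap
    have hne : ∀ p ∈ S ×ˢ Ici (0 : ℝ), jac u₁ η (β p.1 p.2) p.2 ≠ 0 := fun p hp =>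
      (hη.jac_pos h (hβ.mem p.2 hp.2 p.1 hp.1) hp.2).ne'
    exact ⟨by simp, _, contDiffOn_lin (hj.inv hne) (hv.div hj hne).neg,
      fun p hp => hβ.hasFDerivWithinAt hη h hp.1 hp.2⟩

/-- Derivatives of a function transported by the explicit flow. -/
theorem hasDerivWithinAt_comp_fst {f : ℝ → ℝ → ℝ} {f1 x t : ℝ} (hx : x ∈ S)
    (ht : t ∈ Ici (0 : ℝ)) (hf : HasDerivWithinAt (fun a => f a t) f1 S (β x t)) :
    HasDerivWithinAt (fun y => f (β y t) t) (f1 * (jac u₁ η (β x t) t)⁻¹) S x := by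
  have := hasDerivWithinAt_fst_of_hasFDerivWithinAt ht (hβ.hasFDerivWithinAt hη h hx ht)
  simp only [lin_apply, mul_one, mul_zero, add_zero] at this
  exact hf.comp x this fun y hy => hβ.mem t ht y hy

theorem hasDerivWithinAt_comp_snd {f : ℝ → ℝ → ℝ} (hf : Smooth2 S (Ici 0) f) {x t : ℝ}
    (hx : x ∈ S) (ht : t ∈ Ici (0 : ℝ)) :
    HasDerivWithinAt (fun s => f (β x s) s)
      (ut (Ici 0) f (β x t) t
        - ux S f (β x t) t * (flowVel u₁ η b (β x t) t / jac u₁ η (β x t) t)) (Ici 0) t := by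
  have h1 := hasDerivWithinAt_snd_of_hasFDerivWithinAt hx (hβ.hasFDerivWithinAt hη h hx ht)
  have h2 := (hf.hasFDerivWithinAt_lin h.space.ordConnected h.space.uniqueDiffOn
    timeInterval_Ici.uniqueDiffOn (hβ.mem t ht x hx) ht).comp_hasDerivWithinAt
    (f := fun s => (β x s, s)) t (h1.prodMk (hasDerivWithinAt_id t (Ici 0)))
    (fun s hs => ⟨hβ.mem s hs x hx, hs⟩)
  refine h2.congr_deriv ?_
  simp
  ring

theorem smooth2_comp {f : ℝ → ℝ → ℝ} (hf : Smooth2 S (Ici 0) f) :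
    Smooth2 S (Ici 0) (fun x t => f (β x t) t) :=
  hf.comp (f := fun p : ℝ × ℝ => (β p.1 p.2, p.2)) ((hβ.smooth2 hη h).prodMk contDiffOn_snd)
    fun p hp => ⟨hβ.mem p.2 hp.2 p.1 hp.1, hp.2⟩

theorem ux_vel {x t : ℝ} (hx : x ∈ S) (ht : t ∈ Ici (0 : ℝ)) :
    ux S (fun x t => flowVel u₁ η b (β x t) t) x t = strain u₁ η (β x t) t := by
  have ha := hβ.mem t ht x hx
  have := hβ.hasDerivWithinAt_comp_fst hη h hx ht (f := flowVel u₁ η b)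
    (hη.hasDerivWithinAt_flowVel_fst h ha ht)
  rw [ux, this.derivWithin (h.space.uniqueDiffOn x hx)]
  field_simp [(hη.jac_pos h ha ht).ne']

theorem uxx_vel {x t : ℝ} (hx : x ∈ S) (ht : t ∈ Ici (0 : ℝ)) :
    uxx S (fun x t => flowVel u₁ η b (β x t) t) x t
      = ux S (strain u₁ η) (β x t) t / jac u₁ η (β x t) t := by
  have ha := hβ.mem t ht x hx
  have := hβ.hasDerivWithinAt_comp_fst hη h hx ht (f := strain u₁ η)
    ((hη.smooth2_strain h).hasDerivWithinAt_ux ha ht)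
  rw [uxx, derivWithin_congr (fun y hy => hβ.ux_vel hη h hy ht) (hβ.ux_vel hη h hx ht),
    this.derivWithin (h.space.uniqueDiffOn x hx), div_eq_mul_inv]

/-- The time derivative at fixed `x` contains `-v σ_a / J`, which the transport term `u u_xx = v σ_a
/ J` cancels. The Riccati equation for the strain `σ` is left. -/
theorem equation_nonlocal {x t : ℝ} (hx : x ∈ S) (ht : t ∈ Ici (0 : ℝ)) :
    ut (Ici 0) (ux S fun x t => flowVel u₁ η b (β x t) t) x t
        + flowVel u₁ η b (β x t) t * uxx S (fun x t => flowVel u₁ η b (β x t) t) x t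
        - ux S (fun x t => flowVel u₁ η b (β x t) t) x t ^ 2 = nonlocal u₁ M η t := by
  have ha := hβ.mem t ht x hx
  have h1 : ut (Ici 0) (ux S fun x t => flowVel u₁ η b (β x t) t) x t
      = ut (Ici 0) (fun x t => strain u₁ η (β x t) t) x t :=
    derivWithin_congr (fun s hs => hβ.ux_vel hη h hx hs) (hβ.ux_vel hη h hx ht)
  have h2 : ut (Ici 0) (strain u₁ η) (β x t) t = _ :=
    (hη.hasDerivWithinAt_strain h ha ht).derivWithin (timeInterval_Ici.uniqueDiffOn t ht)
  rw [h1, ut, (hβ.hasDerivWithinAt_comp_snd hη h (hη.smooth2_strain h) hx ht).derivWithin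
    (timeInterval_Ici.uniqueDiffOn t ht), h2, hβ.ux_vel hη h hx ht, hβ.uxx_vel hη h hx ht]
  ring

end FlowInverse

end ExplicitFlow

/-! ### Boundary conditions, periodicity and the nonlocal term -/

theorem integral_eq_sub_of_hasDerivWithinAt {S : Set ℝ} (hS : S.OrdConnected) {f f' : ℝ → ℝ}
    (h : ∀ x ∈ S, HasDerivWithinAt f (f' x) S x) (hf' : ContinuousOn f' S) {x y : ℝ} (hx : x ∈ S)
    (hy : y ∈ S) : ∫ a in x..y, f' a = f y - f x := by
  have hsub := hS.uIcc_subset hx hy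
  refine intervalIntegral.integral_eq_sub_of_hasDeriv_right
    (fun a ha => (h a (hsub ha)).continuousWithinAt.mono hsub) (fun a ha => ?_)
    (hf'.mono hsub).intervalIntegrable
  have ha' : a ∈ uIcc x y := Ioo_subset_Icc_self ha
  exact ((h a (hsub ha')).hasDerivAt
    (mem_of_superset (Icc_mem_nhds ha.1 ha.2) hsub)).hasDerivWithinAt

theorem periodic_deriv {f : ℝ → ℝ} (hf : Function.Periodic f 1) :
    Function.Periodic (deriv f) 1 := by
  intro x
  rw [← deriv_comp_add_const, hf.funext]

theorem periodic_ux {f : ℝ → ℝ → ℝ} {t : ℝ} (hf : Function.Periodic (fun x => f x t) 1) :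
    Function.Periodic (fun x => ux univ f x t) 1 := by
  simp only [ux, derivWithin_univ]
  exact periodic_deriv hf

theorem periodic_iteratedDeriv {f : ℝ → ℝ} (hf : Function.Periodic f 1) (n : ℕ) :
    Function.Periodic (iteratedDeriv n f) 1 := by
  intro x
  have := congrFun (iteratedDeriv_comp_add_const n f 1) x
  rw [hf.funext] at this
  exact this.symm

namespace BoundaryCondition

theorem domain_cases (bc : BoundaryCondition) :
    (bc.domain = univ ∧ ∀ v, bc.Holds v → Function.Periodic v 1) ∨
      (bc.domain = Icc 0 1 ∧ bc = .dirichlet) := by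
  cases bc
  · exact Or.inl ⟨rfl, fun _ h => h⟩
  · exact Or.inr ⟨rfl, rfl⟩
  · exact Or.inl ⟨rfl, fun _ h => h.1⟩

theorem periodic_or_dirichlet (bc : BoundaryCondition) :
    bc = .periodic ∨ (bc ≠ .periodic ∧ ∀ v, bc.Holds v → v 0 = 0 ∧ v 1 = 0) := by
  cases bc
  · exact Or.inl rfl
  · exact Or.inr ⟨by simp, fun _ h => h⟩
  · exact Or.inr ⟨by simp, fun _ h => h.2⟩

theorem Holds.zero_eq_one {bc : BoundaryCondition} {v : ℝ → ℝ} (h : bc.Holds v) : v 1 = v 0 := by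
  rcases bc.domain_cases with ⟨-, hp⟩ | ⟨-, rfl⟩
  · simpa using hp v h 0
  · exact h.2.trans h.1.symm

/-- The boundary terms of an integration by parts vanish. -/
theorem Holds.boundary_term {bc : BoundaryCondition} {u : ℝ → ℝ → ℝ} {t : ℝ}
    (h : bc.Holds (fun x => u x t)) :
    (u 0 t = 0 ∧ u 1 t = 0) ∨
      (u 1 t = u 0 t ∧ Function.Periodic (fun x => u x t) 1 ∧ bc.domain = univ) := by
  rcases bc.domain_cases with ⟨hd, hp⟩ | ⟨-, rfl⟩
  · exact Or.inr ⟨h.zero_eq_one, hp _ h, hd⟩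
  · exact Or.inl h

end BoundaryCondition

theorem contDiffOn_derivWithin {S : Set ℝ} (hS : SpaceInterval S) {u₀ : ℝ → ℝ}
    (hu : ContDiffOn ℝ ∞ u₀ S) : ContDiffOn ℝ ∞ (derivWithin u₀ S) S :=
  ((contDiffOn_infty_iff_derivWithin hS.uniqueDiffOn).1 hu).2

theorem hasDerivWithinAt_of_contDiffOn {S : Set ℝ} {u₀ : ℝ → ℝ}
    (hu : ContDiffOn ℝ ∞ u₀ S) {x : ℝ} (hx : x ∈ S) :
    HasDerivWithinAt u₀ (derivWithin u₀ S x) S x :=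
  (hu.differentiableOn (by simp) x hx).hasDerivWithinAt

/-- Every value on the spatial domain is taken on `[0, 1]`. -/
theorem exists_mem_Icc_eq {bc : BoundaryCondition} {f : ℝ → ℝ}
    (hf : bc.domain = univ → Function.Periodic f 1) {x : ℝ} (hx : x ∈ bc.domain) :
    ∃ y ∈ Icc (0 : ℝ) 1, f x = f y := by
  rcases bc.domain_cases with ⟨hd, -⟩ | ⟨hd, -⟩
  · obtain ⟨y, hy, h⟩ := (hf hd).exists_mem_Ico₀ one_pos x
    exact ⟨y, ⟨hy.1, hy.2.le⟩, h⟩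
  · exact ⟨x, hd ▸ hx, rfl⟩

theorem periodic_derivWithin_domain {bc : BoundaryCondition} {u₀ : ℝ → ℝ} (hbc : bc.Holds u₀)
    (hd : bc.domain = univ) : Function.Periodic (derivWithin u₀ bc.domain) 1 := by
  rcases bc.domain_cases with ⟨-, hp⟩ | ⟨hd', -⟩
  · rw [hd, derivWithin_univ]
    exact periodic_deriv (hp _ hbc)
  · exact absurd (show (2 : ℝ) ∈ Icc (0 : ℝ) 1 by rw [← hd', hd]; trivial) (by norm_num)

/-- Bounds on `[0,1]` pass to the line by periodicity, and the mean of `u₀'` vanishes because `u₀`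
agrees at the two end points. -/
theorem profile_of_isGreatest {bc : BoundaryCondition} {u₀ : ℝ → ℝ}
    (hu₀ : ContDiffOn ℝ ∞ u₀ bc.domain) (hbc : bc.Holds u₀) {M₀ : ℝ} (hM₀ : 0 < M₀)
    (hmax : IsGreatest ((fun α => derivWithin u₀ bc.domain α) '' Icc (0 : ℝ) 1) M₀) :
    Profile bc.domain (derivWithin u₀ bc.domain) M₀ := by
  have hS := bc.spaceInterval
  have hsm := contDiffOn_derivWithin hS hu₀
  have hper := periodic_derivWithin_domain hbc
  refine ⟨hS, hsm, hM₀, fun x hx => ?_, ?_, ?_⟩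
  · obtain ⟨y, hy, h⟩ := exists_mem_Icc_eq hper hx
    rw [h]
    exact hmax.2 ⟨y, hy, rfl⟩
  · obtain ⟨C, hC⟩ := isCompact_Icc.exists_bound_of_continuousOn
      (hsm.continuousOn.mono hS.Icc_subset)
    refine ⟨C, fun x hx => ?_⟩
    obtain ⟨y, hy, h⟩ := exists_mem_Icc_eq hper hx
    rw [h]
    exact hC y hy
  · rw [integral_eq_sub_of_hasDerivWithinAt hS.ordConnected
      (fun x hx => hasDerivWithinAt_of_contDiffOn hu₀ hx) hsm.continuousOn hS.zero_mem hS.one_mem,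
      hbc.zero_eq_one, sub_self]

/-- Integrating the equation over a period identifies the nonlocal term. -/
theorem nonlocal_term_eq {bc : BoundaryCondition} {D : Set ℝ} (hD : TimeInterval D)
    {u : ℝ → ℝ → ℝ} (hu : Smooth2 bc.domain D u) (hb : ∀ t ∈ D, bc.Holds (fun x => u x t))
    {t I : ℝ} (ht : t ∈ D)
    (heq : ∀ x ∈ bc.domain, ut D (ux bc.domain u) x t + u x t * uxx bc.domain u x t
        - (ux bc.domain u x t) ^ 2 = I) :
    I = -2 * ∫ y in (0 : ℝ)..1, (ux bc.domain u y t) ^ 2 := by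
  have hS := bc.spaceInterval
  set S := bc.domain with hSdef
  have hux : Smooth2 S D (ux S u) := hu.ux hS.uniqueDiffOn hD.uniqueDiffOn
  have huxx : Smooth2 S D (uxx S u) := hux.ux hS.uniqueDiffOn hD.uniqueDiffOn
  have hutx : Smooth2 S D (ut D (ux S u)) := hux.ut hS.uniqueDiffOn hD.uniqueDiffOn
  have hsub : uIcc (0 : ℝ) 1 ⊆ S := hS.uIcc_subset hS.one_mem
  have hint : ∀ f : ℝ → ℝ → ℝ, Smooth2 S D f →
      IntervalIntegrable (fun x => f x t) MeasureTheory.volume 0 1 := fun f hf =>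
    ((hf.slice_fst ht).continuousOn.mono hsub).intervalIntegrable
  have h0 : ∀ s ∈ D, ∫ x in (0 : ℝ)..1, ux S u x s = 0 := fun s hs => by
    rw [integral_eq_sub_of_hasDerivWithinAt hS.ordConnected
      (fun x hx => hu.hasDerivWithinAt_ux hx hs) (hux.slice_fst hs).continuousOn hS.zero_mem
      hS.one_mem, (hb s hs).zero_eq_one, sub_self]
  -- The integral of `u_x` is zero at all times, hence so is its time derivative.
  have h1 : ∫ x in (0 : ℝ)..1, ut D (ux S u) x t = 0 := by
    have e := hux.hasDerivWithinAt_primitive_ut hS hD hS.one_mem ht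
    have e' : HasDerivWithinAt (fun s => ∫ x in (0 : ℝ)..1, ux S u x s) 0 D t :=
      (hasDerivWithinAt_const t D (0 : ℝ)).congr h0 (h0 t ht)
    exact (hD.uniqueDiffOn t ht).eq_deriv _ e e'
  have hbd : u 1 t * ux S u 1 t = u 0 t * ux S u 0 t := by
    rcases (hb t ht).boundary_term with ⟨e0, e1⟩ | ⟨e, hp, hd⟩
    · rw [e0, e1]; ring
    · have e' : ux bc.domain u 1 t = ux bc.domain u 0 t := by
        rw [hd]
        simpa using periodic_ux hp 0
      rw [e, hSdef, e']
  -- By parts, without boundary terms; together with `-u_x²` this accounts for the factor `-2`.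
  have h2 : ∫ x in (0 : ℝ)..1, u x t * uxx S u x t = - ∫ x in (0 : ℝ)..1, ux S u x t ^ 2 := by
    rw [intervalIntegral.integral_mul_deriv_eq_deriv_mul_of_hasDerivWithinAt
      (u' := fun x => ux S u x t) (v := fun x => ux S u x t)
      (v' := fun x => uxx S u x t)
      (fun x hx => (hu.hasDerivWithinAt_ux (hsub hx) ht).mono hsub)
      (fun x hx => (hux.hasDerivWithinAt_ux (hsub hx) ht).mono hsub) (hint _ hux) (hint _ huxx),
      hbd, sub_self, zero_sub]
    simp_rw [pow_two]
  have h3 : ∫ x in (0 : ℝ)..1, (ut D (ux S u) x t + u x t * uxx S u x t - ux S u x t ^ 2)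
      = ∫ x in (0 : ℝ)..1, I :=
    intervalIntegral.integral_congr fun x hx => heq x (hsub hx)
  have i2 : IntervalIntegrable (fun x => u x t * uxx S u x t) MeasureTheory.volume 0 1 :=
    hint (fun x t => u x t * uxx S u x t) (hu.mul huxx)
  have i3 : IntervalIntegrable (fun x => ux S u x t ^ 2) MeasureTheory.volume 0 1 :=
    hint (fun x t => ux S u x t ^ 2) (hux.pow 2)
  rw [intervalIntegral.integral_sub ((hint _ hutx).add i2) i3,
    intervalIntegral.integral_add (hint _ hutx) i2, h1, h2] at h3
  simp only [intervalIntegral.integral_const, sub_zero, one_smul] at h3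
  linarith

/-- A two-sided time derivative at interior times. -/
theorem Smooth2.deriv_eq_ut {S D : Set ℝ} (hD : TimeInterval D) {f : ℝ → ℝ → ℝ}
    (hf : Smooth2 S D f) {x t : ℝ} (hx : x ∈ S) (ht : t ∈ D) (h0 : 0 < t) :
    deriv (fun s => f x s) t = StagnationEuler.ut D f x t :=
  ((hf.hasDerivWithinAt_ut hx ht).hasDerivAt (hD.mem_nhds ht h0)).deriv

/-! ### The explicit velocity solves the problem -/

section Explicit

variable {bc : BoundaryCondition} {u₀ : ℝ → ℝ} {M : ℝ} {η : ℝ → ℝ}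

/-- Since `∫₀¹ J = 1`, label `1` moves along `tb + 1`, and its velocity is read off by
differentiating. -/
theorem TimeChange.flowVel_one {S : Set ℝ} {u₁ : ℝ → ℝ} {b : ℝ} (hη : TimeChange u₁ M η)
    (h : Profile S u₁ M) {t : ℝ}
    (ht : t ∈ Ici (0 : ℝ)) : flowVel u₁ η b 1 t = b := by
  have e := hη.hasDerivWithinAt_flowMap_snd (b := b) h h.space.one_mem ht
  have e' : HasDerivWithinAt (flowMap u₁ η b 1) (1 * b) (Ici 0) t := by
    refine (((hasDerivWithinAt_id t (Ici 0)).mul_const b).add_const 1).congr (fun s hs => ?_) ?_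
    · rw [flowMap, hη.integral_jac h hs]; rfl
    · rw [flowMap, hη.integral_jac h ht]; rfl
  rw [(timeInterval_Ici.uniqueDiffOn t ht).eq_deriv _ e e', one_mul]

theorem periodic_jac {u₁ : ℝ → ℝ} (hp : Function.Periodic u₁ 1) (t : ℝ) :
    Function.Periodic (fun a => jac u₁ η a t) 1 := fun a => by simp only [jac, hp a]

theorem integral_add_one_of_periodic {f : ℝ → ℝ} (hf : Function.Periodic f 1)
    (hc : Continuous f) (a : ℝ) :
    ∫ y in (0 : ℝ)..(a + 1), f y = (∫ y in (0 : ℝ)..a, f y) + ∫ y in (0 : ℝ)..1, f y := by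
  rw [← intervalIntegral.integral_add_adjacent_intervals (hc.intervalIntegrable 0 a)
    (hc.intervalIntegrable a (a + 1)), hf.intervalIntegral_add_eq a 0, zero_add]

theorem TimeChange.flowMap_add_one {u₁ : ℝ → ℝ} {b : ℝ} (hη : TimeChange u₁ M η)
    (h : Profile univ u₁ M) (hp : Function.Periodic u₁ 1) {t : ℝ} (ht : t ∈ Ici (0 : ℝ)) (a : ℝ) :
    flowMap u₁ η b (a + 1) t = flowMap u₁ η b a t + 1 := by
  have hc : Continuous fun a => jac u₁ η a t :=
    continuousOn_univ.1 ((hη.smooth2_jac h).slice_fst ht).continuousOn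
  rw [flowMap, flowMap, integral_add_one_of_periodic (periodic_jac hp t) hc,
    hη.integral_jac h ht, add_assoc]

theorem TimeChange.flowVel_add_one {u₁ : ℝ → ℝ} {b : ℝ} (hη : TimeChange u₁ M η)
    (h : Profile univ u₁ M) (hp : Function.Periodic u₁ 1) {t : ℝ} (ht : t ∈ Ici (0 : ℝ)) (a : ℝ) :
    flowVel u₁ η b (a + 1) t = flowVel u₁ η b a t := by
  have hc : Continuous fun a => jac u₁ η a t * strain u₁ η a t :=
    (continuousOn_univ.1 ((hη.smooth2_jac h).slice_fst ht).continuousOn).mul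
      (continuousOn_univ.1 ((hη.smooth2_strain h).slice_fst ht).continuousOn)
  have h1 := hη.flowVel_one (b := b) h ht
  rw [flowVel] at h1
  rw [flowVel, flowVel, integral_add_one_of_periodic
    (fun a => by simp only [jac, strain, hp a]) hc]
  linarith

theorem exists_flowInverse (hη : TimeChange (derivWithin u₀ bc.domain) M η)
    (h : Profile bc.domain (derivWithin u₀ bc.domain) M) (hbc : bc.Holds u₀) :
    ∃ β, FlowInverse bc.domain (derivWithin u₀ bc.domain) η (u₀ 0) β := by
  set u₁ := derivWithin u₀ bc.domain with hu₁
  set b := u₀ 0 with hb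
  have hper := periodic_derivWithin_domain hbc
  rw [← hu₁] at hper
  suffices H : ∀ t ∈ Ici (0 : ℝ), (∀ a ∈ bc.domain, flowMap u₁ η b a t ∈ bc.domain) ∧
      ∀ x ∈ bc.domain, ∃ a ∈ bc.domain, flowMap u₁ η b a t = x by
    have : ∀ x t, ∃ a, t ∈ Ici (0 : ℝ) → x ∈ bc.domain → a ∈ bc.domain ∧ flowMap u₁ η b a t = x := by
      intro x t
      by_cases hxt : t ∈ Ici (0 : ℝ) ∧ x ∈ bc.domain
      · obtain ⟨a, ha⟩ := (H t hxt.1).2 x hxt.2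
        exact ⟨a, fun _ _ => ha⟩
      · exact ⟨0, fun h1 h2 => absurd ⟨h1, h2⟩ hxt⟩
    choose β hβ using this
    exact ⟨β, fun t ht => (H t ht).1, fun t ht x hx => (hβ x t ht hx).1,
      fun t ht x hx => (hβ x t ht hx).2⟩
  intro t ht
  have hcont : ContinuousOn (fun a => flowMap u₁ η b a t) bc.domain :=
    ((hη.smooth2_flowMap h).slice_fst ht).continuousOn
  rcases bc.domain_cases with ⟨hd, hp⟩ | ⟨hd, hbd⟩
  · rw [hd] at h hcont ⊢
    refine ⟨fun _ _ => mem_univ _, fun x _ => ?_⟩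
    -- Integer labels `n` land at `tb + n`, so the images of two consecutive ones enclose any `x`,
    -- and the intermediate value theorem applies.
    have hφ : Function.Periodic (fun a => flowMap u₁ η b a t - a) 1 := fun a => by
      simp only [hη.flowMap_add_one h (hper hd) ht]; ring
    have hn : ∀ n : ℤ, flowMap u₁ η b n t = t * b + n := fun n => by
      have := hφ.int_mul_eq n
      simp only [mul_one, sub_zero] at this
      rw [sub_eq_iff_eq_add.1 this]
      simp [flowMap]
    have hfl := Int.floor_le (x - t * b)
    have hlt := (Int.lt_floor_add_one (x - t * b)).le
    have := intermediate_value_Icc (a := ((⌊x - t * b⌋ : ℤ) : ℝ))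
      (b := ((⌊x - t * b⌋ + 1 : ℤ) : ℝ)) (by push_cast; linarith)
      (hcont.mono (subset_univ _))
    obtain ⟨a, -, ha⟩ := this (show x ∈ _ by
      rw [hn, hn]; push_cast; constructor <;> linarith)
    exact ⟨a, mem_univ a, ha⟩
  · subst hbd
    -- With `b = 0` both end points are fixed, so `[0,1]` is mapped monotonically onto itself.
    have hb0 : b = 0 := hbc.1
    have e0 : flowMap u₁ η b 0 t = 0 := by simp [flowMap, hb0]
    have e1 : flowMap u₁ η b 1 t = 1 := by
      rw [flowMap, hη.integral_jac h ht, hb0]; ring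
    have hmono := (hη.flowMap_strictMonoOn (b := b) h ht).monotoneOn
    rw [hd] at hmono hcont ⊢
    refine ⟨fun a ha => ?_, fun x hx => ?_⟩
    · have h0 := hmono ⟨le_rfl, zero_le_one⟩ ha ha.1
      have h1 := hmono ha ⟨zero_le_one, le_rfl⟩ ha.2
      simp only [e0, e1] at h0 h1
      exact ⟨h0, h1⟩
    · have := intermediate_value_Icc zero_le_one hcont
      rw [e0, e1] at this
      obtain ⟨a, ha, hax⟩ := this hx
      exact ⟨a, ha, hax⟩

theorem FlowInverse.isSmoothSolution {β : ℝ → ℝ → ℝ}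
    (hβ : FlowInverse bc.domain (derivWithin u₀ bc.domain) η (u₀ 0) β)
    (hη : TimeChange (derivWithin u₀ bc.domain) M η)
    (h : Profile bc.domain (derivWithin u₀ bc.domain) M) (hbc : bc.Holds u₀)
    (hu₀ : ContDiffOn ℝ ∞ u₀ bc.domain) :
    IsSmoothSolution bc u₀ (Ici 0)
      (fun x t => flowVel (derivWithin u₀ bc.domain) η (u₀ 0) (β x t) t) := by
  have hS := bc.spaceInterval
  have hper := periodic_derivWithin_domain hbc
  set u₁ := derivWithin u₀ bc.domain with hu₁
  set b := u₀ 0 with hb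
  have hsm : Smooth2 bc.domain (Ici 0) (fun x t => flowVel u₁ η b (β x t) t) :=
    hβ.smooth2_comp hη h (hη.smooth2_flowVel h)
  have hend : b = 0 → ∀ t ∈ Ici (0 : ℝ), flowVel u₁ η b (β 0 t) t = 0 ∧
      flowVel u₁ η b (β 1 t) t = 0 := by
    intro hb0 t ht
    have e0 : flowMap u₁ η b 0 t = 0 := by simp [flowMap, hb0]
    have e1 : flowMap u₁ η b 1 t = 1 := by
      rw [flowMap, hη.integral_jac h ht, hb0]; ring
    have f0 : β 0 t = 0 := by simpa [e0] using hβ.left_inv hη h hS.zero_mem ht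
    have f1 : β 1 t = 1 := by simpa [e1] using hβ.left_inv hη h hS.one_mem ht
    rw [f0, f1, hη.flowVel_one h ht]
    exact ⟨by simp [flowVel, hb0], hb0⟩
  have hpv : bc.domain = univ → ∀ t ∈ Ici (0 : ℝ),
      Function.Periodic (fun x => flowVel u₁ η b (β x t) t) 1 := by
    intro hd t ht x
    have hu : ∀ y, y ∈ bc.domain := fun y => hd ▸ mem_univ y
    have e : β (x + 1) t = β x t + 1 := by
      have h' : Profile univ u₁ M := hd ▸ h
      have := hη.flowMap_add_one (b := b) h' (hper hd) ht (β x t)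
      rw [hβ.right_inv t ht x (hu x)] at this
      rw [← this, hβ.left_inv hη h (hu _) ht]
    have h' : Profile univ u₁ M := hd ▸ h
    simp only [e, hη.flowVel_add_one h' (hper hd) ht]
  have hbdry : ∀ t ∈ Ici (0 : ℝ), bc.Holds (fun x => flowVel u₁ η b (β x t) t) := by
    cases bc
    · exact fun t ht => hpv rfl t ht
    · exact fun t ht => hend hbc.1 t ht
    · exact fun t ht => ⟨hpv rfl t ht, hend hbc.2.1 t ht⟩
  refine ⟨hsm, hbdry, fun x hx => ?_, fun t ht h0 x hx => ?_⟩
  · have e := hβ.left_inv hη h hx (mem_Ici.2 le_rfl)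
    rw [hη.flowMap_zero] at e
    simp only [e, flowVel, hη.jac_at_zero, hη.strain_zero h, one_mul]
    rw [integral_eq_sub_of_hasDerivWithinAt hS.ordConnected
      (fun x hx => hasDerivWithinAt_of_contDiffOn hu₀ hx) h.smooth.continuousOn hS.zero_mem hx]
    ring
  · have hux := hsm.ux hS.uniqueDiffOn timeInterval_Ici.uniqueDiffOn
    rw [← nonlocal_term_eq timeInterval_Ici hsm hbdry ht
      (fun x hx => hβ.equation_nonlocal hη h hx ht), hux.deriv_eq_ut timeInterval_Ici hx ht h0]
    exact hβ.equation_nonlocal hη h hx ht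

end Explicit

/-! ### Uniqueness by an energy estimate -/

/-- The variance of `|f|` is nonnegative. -/
theorem sq_integral_abs_le {f : ℝ → ℝ} (hf : ContinuousOn f (uIcc 0 1)) :
    (∫ x in (0 : ℝ)..1, |f x|) ^ 2 ≤ ∫ x in (0 : ℝ)..1, f x ^ 2 := by
  set m := ∫ x in (0 : ℝ)..1, |f x| with hm
  have h1 : IntervalIntegrable (fun x => |f x|) MeasureTheory.volume 0 1 :=
    hf.abs.intervalIntegrable
  have h2 : IntervalIntegrable (fun x => f x ^ 2) MeasureTheory.volume 0 1 :=
    (hf.pow 2).intervalIntegrable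
  have h0 : 0 ≤ ∫ x in (0 : ℝ)..1, (|f x| - m) ^ 2 :=
    intervalIntegral.integral_nonneg zero_le_one fun x _ => sq_nonneg _
  have e : ∀ x, (|f x| - m) ^ 2 = f x ^ 2 - 2 * m * |f x| + m ^ 2 := fun x => by
    rw [← sq_abs (f x)]; ring
  simp_rw [e] at h0
  rw [intervalIntegral.integral_add (h2.sub (h1.const_mul _)) (by simp),
    intervalIntegral.integral_sub h2 (h1.const_mul _), intervalIntegral.integral_const_mul,
    ← hm] at h0
  simp only [intervalIntegral.integral_const, sub_zero, one_smul] at h0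
  nlinarith

/-- A function with a zero on `[0, 1]` is controlled by the `L²` norm of its derivative. -/
theorem sq_le_integral_sq_deriv {S : Set ℝ} (hS : SpaceInterval S) {z w : ℝ → ℝ}
    (hz : ∀ x ∈ S, HasDerivWithinAt z (w x) S x) (hw : ContinuousOn w S) {ξ : ℝ}
    (hξ : ξ ∈ Icc (0 : ℝ) 1) (hzξ : z ξ = 0) {x : ℝ} (hx : x ∈ Icc (0 : ℝ) 1) :
    z x ^ 2 ≤ ∫ y in (0 : ℝ)..1, w y ^ 2 := by
  have hsub : uIcc (0 : ℝ) 1 ⊆ S := hS.uIcc_subset hS.one_mem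
  refine le_trans ?_ (sq_integral_abs_le (hw.mono hsub))
  have e := integral_eq_sub_of_hasDerivWithinAt hS.ordConnected hz hw (hS.Icc_subset hξ)
    (hS.Icc_subset hx)
  rw [hzξ, sub_zero] at e
  rw [← e, ← sq_abs]
  have h1 : |∫ a in ξ..x, w a| ≤ |(∫ a in ξ..x, |w a|)| :=
    intervalIntegral.norm_integral_le_abs_integral_norm (f := w)
  have h2 : |(∫ a in ξ..x, |w a|)| ≤ |(∫ a in (0 : ℝ)..1, |w a|)| := by
    refine intervalIntegral.abs_integral_mono_interval ?_
      (Eventually.of_forall fun a => abs_nonneg _) (hw.mono hsub).abs.intervalIntegrable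
    exact uIoc_subset_uIoc_of_uIcc_subset_uIcc
      (by rw [uIcc_of_le (zero_le_one (α := ℝ))]; exact ordConnected_Icc.uIcc_subset hξ hx)
  have h3 : |(∫ a in (0 : ℝ)..1, |w a|)| = ∫ a in (0 : ℝ)..1, |w a| :=
    abs_of_nonneg (intervalIntegral.integral_nonneg zero_le_one fun a _ => abs_nonneg _)
  rw [h3] at h2
  exact pow_le_pow_left₀ (abs_nonneg _) (h1.trans h2) 2

namespace IsSmoothSolution

variable {bc : BoundaryCondition} {D : Set ℝ} {u₀ : ℝ → ℝ} {u v : ℝ → ℝ → ℝ}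

theorem smooth2 (hu : IsSmoothSolution bc u₀ D u) : Smooth2 bc.domain D u := hu.smooth

theorem smooth2_ux (hu : IsSmoothSolution bc u₀ D u) (hD : TimeInterval D) :
    Smooth2 bc.domain D (ux bc.domain u) :=
  hu.smooth2.ux bc.spaceInterval.uniqueDiffOn hD.uniqueDiffOn

theorem smooth2_uxx (hu : IsSmoothSolution bc u₀ D u) (hD : TimeInterval D) :
    Smooth2 bc.domain D (uxx bc.domain u) :=
  (hu.smooth2_ux hD).ux bc.spaceInterval.uniqueDiffOn hD.uniqueDiffOn

theorem equation_ut (hu : IsSmoothSolution bc u₀ D u) (hD : TimeInterval D) {t : ℝ} (ht : t ∈ D)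
    (h0 : 0 < t) {x : ℝ} (hx : x ∈ bc.domain) :
    ut D (ux bc.domain u) x t + u x t * uxx bc.domain u x t - (ux bc.domain u x t) ^ 2
      = -2 * ∫ y in (0 : ℝ)..1, (ux bc.domain u y t) ^ 2 := by
  rw [← hu.equation t ht h0 x hx, (hu.smooth2_ux hD).deriv_eq_ut hD hx ht h0]

theorem integral_ux (hu : IsSmoothSolution bc u₀ D u) (hD : TimeInterval D) {t : ℝ} (ht : t ∈ D) :
    ∫ x in (0 : ℝ)..1, ux bc.domain u x t = 0 := by
  have hS := bc.spaceInterval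
  rw [integral_eq_sub_of_hasDerivWithinAt hS.ordConnected
    (fun x hx => hu.smooth2.hasDerivWithinAt_ux hx ht)
    ((hu.smooth2_ux hD).slice_fst ht).continuousOn hS.zero_mem hS.one_mem,
    (hu.boundary t ht).zero_eq_one, sub_self]

/-- The energy inequality for the difference of two solutions. -/
theorem energy_deriv_le (hu : IsSmoothSolution bc u₀ D u) (hv : IsSmoothSolution bc u₀ D v)
    (hD : TimeInterval D) {t C : ℝ} (ht : t ∈ D) (h0 : 0 < t)
    (hξ : ∃ ξ ∈ Icc (0 : ℝ) 1, u ξ t = v ξ t)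
    (hp : ∀ x ∈ Icc (0 : ℝ) 1, |ux bc.domain u x t| ≤ C)
    (hq : ∀ x ∈ Icc (0 : ℝ) 1, |ux bc.domain v x t| ≤ C)
    (hqx : ∀ x ∈ Icc (0 : ℝ) 1, |uxx bc.domain v x t| ≤ C) :
    ∫ x in (0 : ℝ)..1, ut D (fun x t => (ux bc.domain u x t - ux bc.domain v x t) ^ 2) x t
      ≤ 7 * C * ∫ x in (0 : ℝ)..1, (ux bc.domain u x t - ux bc.domain v x t) ^ 2 := by
  have hS := bc.spaceInterval
  set S := bc.domain with hSdef
  have hsub : uIcc (0 : ℝ) 1 ⊆ S := hS.uIcc_subset hS.one_mem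
  have hC : 0 ≤ C := (abs_nonneg _).trans (hp 0 ⟨le_rfl, zero_le_one⟩)
  have sp := hu.smooth2_ux hD
  have sq := hv.smooth2_ux hD
  have sw : Smooth2 S D (fun x t => ux S u x t - ux S v x t) := sp.sub sq
  have swx : Smooth2 S D (fun x t => uxx S u x t - uxx S v x t) :=
    (hu.smooth2_uxx hD).sub (hv.smooth2_uxx hD)
  have hint : ∀ f : ℝ → ℝ → ℝ, Smooth2 S D f →
      IntervalIntegrable (fun x => f x t) MeasureTheory.volume 0 1 := fun f hf =>
    ((hf.slice_fst ht).continuousOn.mono hsub).intervalIntegrable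
  set w : ℝ → ℝ := fun x => ux S u x t - ux S v x t with hw
  set wx : ℝ → ℝ := fun x => uxx S u x t - uxx S v x t with hwx
  set R : ℝ := (-2 * ∫ y in (0 : ℝ)..1, (ux S u y t) ^ 2)
    - (-2 * ∫ y in (0 : ℝ)..1, (ux S v y t) ^ 2) with hR
  have dz : ∀ x ∈ S, HasDerivWithinAt (fun x => u x t - v x t) (w x) S x := fun x hx =>
    (hu.smooth2.hasDerivWithinAt_ux hx ht).sub (hv.smooth2.hasDerivWithinAt_ux hx ht)
  have dw : ∀ x ∈ S, HasDerivWithinAt w (wx x) S x := fun x hx =>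
    (sp.hasDerivWithinAt_ux hx ht).sub (sq.hasDerivWithinAt_ux hx ht)
  -- Subtract the two equations, splitting `u u_xx - v v_xx = u w_x + (u - v) v_xx`, and multiply by
  -- `2w`. The difference `R` of the nonlocal terms is constant in `x`, so `∫ w = 0` removes it
  -- below.
  have e1 : ∀ x ∈ S, ut D (fun x t => (ux S u x t - ux S v x t) ^ 2) x t
      = -(u x t * (2 * w x * wx x)) + (2 * (ux S u x t + ux S v x t) * w x ^ 2
        - 2 * (u x t - v x t) * uxx S v x t * w x) + 2 * R * w x := by
    intro x hx
    have d := (((sp.hasDerivWithinAt_ut hx ht).fun_sub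
      (sq.hasDerivWithinAt_ut hx ht)).fun_pow 2).derivWithin (hD.uniqueDiffOn t ht)
    have E1 := hu.equation_ut hD ht h0 hx
    have E2 := hv.equation_ut hD ht h0 hx
    have E1' : ut D (ux S u) x t = -2 * (∫ y in (0 : ℝ)..1, (ux S u y t) ^ 2)
      - u x t * uxx S u x t + (ux S u x t) ^ 2 := by rw [← E1]; ring
    have E2' : ut D (ux S v) x t = -2 * (∫ y in (0 : ℝ)..1, (ux S v y t) ^ 2)
      - v x t * uxx S v x t + (ux S v x t) ^ 2 := by rw [← E2]; ring
    rw [ut, d, E1', E2']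
    simp only [hw, hwx, hR]
    push_cast
    ring
  have hbd : u 1 t * w 1 ^ 2 = u 0 t * w 0 ^ 2 := by
    rcases (hu.boundary t ht).boundary_term with ⟨e0, e1⟩ | ⟨e, hpu, hd⟩
    · rw [e0, e1]; ring
    · have hpv : Function.Periodic (fun x => v x t) 1 := by
        rcases bc.domain_cases with ⟨-, hp'⟩ | ⟨hd', -⟩
        · exact hp' _ (hv.boundary t ht)
        · exact absurd (show (2 : ℝ) ∈ Icc (0 : ℝ) 1 by rw [← hd', hd]; trivial) (by norm_num)
      have e' : w 1 = w 0 := by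
        simp only [hw, hSdef, hd]
        have a1 := periodic_ux hpu 0
        have a2 := periodic_ux hpv 0
        simp only [zero_add] at a1 a2
        rw [a1, a2]
      rw [e, e']
  have i1 : IntervalIntegrable (fun x => u x t * (2 * w x * wx x)) MeasureTheory.volume 0 1 :=
    hint (fun x t => u x t * (2 * (ux S u x t - ux S v x t) * (uxx S u x t - uxx S v x t)))
      (hu.smooth2.mul ((contDiffOn_const.mul sw).mul swx))
  have i1' : IntervalIntegrable (fun x => 2 * w x * wx x) MeasureTheory.volume 0 1 :=
    hint (fun x t => 2 * (ux S u x t - ux S v x t) * (uxx S u x t - uxx S v x t))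
      ((contDiffOn_const.mul sw).mul swx)
  have i2 : IntervalIntegrable (fun x => 2 * (ux S u x t + ux S v x t) * w x ^ 2
      - 2 * (u x t - v x t) * uxx S v x t * w x) MeasureTheory.volume 0 1 :=
    hint (fun x t => 2 * (ux S u x t + ux S v x t) * (ux S u x t - ux S v x t) ^ 2
      - 2 * (u x t - v x t) * uxx S v x t * (ux S u x t - ux S v x t))
      (((contDiffOn_const.mul (sp.add sq)).mul (sw.pow 2)).sub
        (((contDiffOn_const.mul (hu.smooth2.sub hv.smooth2)).mul (hv.smooth2_uxx hD)).mul sw))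
  have i3 : IntervalIntegrable w MeasureTheory.volume 0 1 :=
    hint (fun x t => ux S u x t - ux S v x t) sw
  have i4 : IntervalIntegrable (fun x => ux S u x t * w x ^ 2) MeasureTheory.volume 0 1 :=
    hint (fun x t => ux S u x t * (ux S u x t - ux S v x t) ^ 2) (sp.mul (sw.pow 2))
  have i5 : IntervalIntegrable (fun x => w x ^ 2) MeasureTheory.volume 0 1 :=
    hint (fun x t => (ux S u x t - ux S v x t) ^ 2) (sw.pow 2)
  have parts : ∫ x in (0 : ℝ)..1, u x t * (2 * w x * wx x)
      = - ∫ x in (0 : ℝ)..1, ux S u x t * w x ^ 2 := by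
    rw [intervalIntegral.integral_mul_deriv_eq_deriv_mul_of_hasDerivWithinAt
      (u' := fun x => ux S u x t) (v := fun x => w x ^ 2) (v' := fun x => 2 * w x * wx x)
      (fun x hx => (hu.smooth2.hasDerivWithinAt_ux (hsub hx) ht).mono hsub)
      (fun x hx => by
        have := ((dw x (hsub hx)).mono hsub).fun_pow 2
        simpa using this) (hint _ sp) i1', hbd]
    ring
  have w0 : ∫ x in (0 : ℝ)..1, w x = 0 := by
    rw [intervalIntegral.integral_sub (hint _ sp) (hint _ sq), hu.integral_ux hD ht,
      hv.integral_ux hD ht, sub_zero]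
  have i1n : IntervalIntegrable (fun x => -(u x t * (2 * w x * wx x))) MeasureTheory.volume 0 1 :=
    i1.neg
  rw [intervalIntegral.integral_congr fun x hx => e1 x (hsub hx),
    intervalIntegral.integral_add (i1n.add i2) (i3.const_mul _),
    intervalIntegral.integral_add i1n i2, intervalIntegral.integral_neg, parts,
    intervalIntegral.integral_const_mul, w0, neg_neg, mul_zero, add_zero,
    ← intervalIntegral.integral_add i4 i2]
  obtain ⟨ξ, hξm, hξe⟩ := hξ
  set E := ∫ x in (0 : ℝ)..1, w x ^ 2 with hE
  -- The only use of the common point: it controls `u - v` itself by the energy of its derivative.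
  have hz : ∀ x ∈ Icc (0 : ℝ) 1, (u x t - v x t) ^ 2 ≤ E := fun x hx =>
    sq_le_integral_sq_deriv hS (z := fun x => u x t - v x t) dz
      (sw.slice_fst ht).continuousOn hξm (sub_eq_zero.2 hξe) hx
  -- The coefficient of `w²` is `C` from the integration by parts, `4C` from `u_x + v_x` and `C`
  -- from the product `(u - v)w`; the remaining `C E` completes `7C`.
  have bound : ∀ x ∈ Icc (0 : ℝ) 1, ux S u x t * w x ^ 2
      + (2 * (ux S u x t + ux S v x t) * w x ^ 2 - 2 * (u x t - v x t) * uxx S v x t * w x)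
      ≤ 6 * C * w x ^ 2 + C * E := by
    intro x hx
    have b1 := (abs_le.1 (hp x hx)).2
    have b2 := (abs_le.1 (hq x hx)).2
    have b3 : -(2 * (u x t - v x t) * uxx S v x t * w x)
        ≤ C * ((u x t - v x t) ^ 2 + w x ^ 2) := by
      have c1 : -(2 * (u x t - v x t) * uxx S v x t * w x)
          ≤ |uxx S v x t| * |2 * (u x t - v x t) * w x| := by
        rw [← abs_mul]
        refine le_trans (le_of_eq ?_) (neg_le_abs _)
        ring
      have c2 : |2 * (u x t - v x t) * w x| ≤ (u x t - v x t) ^ 2 + w x ^ 2 := by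
        rw [abs_le]
        constructor <;> nlinarith [sq_nonneg (u x t - v x t + w x),
          sq_nonneg (u x t - v x t - w x)]
      exact c1.trans (mul_le_mul (hqx x hx) c2 (abs_nonneg _) hC)
    have b4 := mul_le_mul_of_nonneg_left (hz x hx) hC
    nlinarith [mul_le_mul_of_nonneg_right b1 (sq_nonneg (w x)),
      mul_le_mul_of_nonneg_right b2 (sq_nonneg (w x))]
  refine (intervalIntegral.integral_mono_on zero_le_one (i4.add i2)
    ((i5.const_mul (6 * C)).add (by simp)) bound).trans ?_
  rw [intervalIntegral.integral_add (i5.const_mul _) (by simp),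
    intervalIntegral.integral_const_mul, ← hE]
  simp only [intervalIntegral.integral_const, sub_zero, one_smul]
  linarith

theorem exists_bound {S : Set ℝ} (hS : SpaceInterval S) (hD : TimeInterval D) {f : ℝ → ℝ → ℝ}
    (hf : Smooth2 S D f) {t₁ : ℝ} (ht : t₁ ∈ D) :
    ∃ C, ∀ t ∈ Icc 0 t₁, ∀ x ∈ Icc (0 : ℝ) 1, |f x t| ≤ C := by
  obtain ⟨C, hC⟩ := (isCompact_Icc.prod isCompact_Icc).exists_bound_of_continuousOn
    (hf.continuousOn.mono (prod_mono hS.Icc_subset (hD.Icc_subset ht)))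
  exact ⟨C, fun t ht x hx => hC (x, t) ⟨hx, ht⟩⟩

/-- Two solutions which agree somewhere at every time are equal. -/
theorem eq_of_exists_eq (hu : IsSmoothSolution bc u₀ D u) (hv : IsSmoothSolution bc u₀ D v)
    (hD : TimeInterval D) (hξ : ∀ t ∈ D, ∃ ξ ∈ Icc (0 : ℝ) 1, u ξ t = v ξ t) :
    ∀ t ∈ D, ∀ x ∈ bc.domain, u x t = v x t := by
  intro t₁ ht₁ x hx
  have hS := bc.spaceInterval
  obtain ⟨C1, h1⟩ := exists_bound hS hD (hu.smooth2_ux hD) ht₁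
  obtain ⟨C2, h2⟩ := exists_bound hS hD (hv.smooth2_ux hD) ht₁
  obtain ⟨C3, h3⟩ := exists_bound hS hD (hv.smooth2_uxx hD) ht₁
  set C := max C1 (max C2 C3) with hCdef
  have sw : Smooth2 bc.domain D (fun x t => (ux bc.domain u x t - ux bc.domain v x t) ^ 2) :=
    ((hu.smooth2_ux hD).sub (hv.smooth2_ux hD)).pow 2
  set E : ℝ → ℝ := fun t => ∫ x in (0 : ℝ)..1, (ux bc.domain u x t - ux bc.domain v x t) ^ 2
    with hE
  have dE : ∀ t ∈ D, HasDerivWithinAt E (∫ x in (0 : ℝ)..1,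
      ut D (fun x t => (ux bc.domain u x t - ux bc.domain v x t) ^ 2) x t) D t := fun t ht =>
    sw.hasDerivWithinAt_primitive_ut hS hD hS.one_mem ht
  have hsubD := hD.Icc_subset ht₁
  have h0t : 0 ≤ t₁ := hD.nonneg t₁ ht₁
  -- Gronwall's argument with an integrating factor.
  have dF : ∀ t ∈ D, HasDerivWithinAt (fun s => E s * Real.exp (-(7 * C) * s))
      ((∫ x in (0 : ℝ)..1, ut D (fun x t => (ux bc.domain u x t - ux bc.domain v x t) ^ 2) x t)
        * Real.exp (-(7 * C) * t) + E t * (Real.exp (-(7 * C) * t) * (-(7 * C) * 1))) D t :=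
    fun t ht => (dE t ht).fun_mul (((hasDerivWithinAt_id t D).const_mul (-(7 * C))).exp)
  have hanti : AntitoneOn (fun s => E s * Real.exp (-(7 * C) * s)) (Icc 0 t₁) := by
    refine antitoneOn_of_hasDerivWithinAt_nonpos (convex_Icc 0 t₁)
      (fun t ht => (dF t (hsubD ht)).continuousWithinAt.mono hsubD)
      (fun t ht => (dF t (hsubD (interior_subset ht))).mono (interior_subset.trans hsubD))
      fun t ht => ?_
    have htI := interior_subset ht
    rw [interior_Icc] at ht
    have := hu.energy_deriv_le hv hD (C := C) (hsubD htI) ht.1 (hξ t (hsubD htI))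
      (fun x hx => (h1 t htI x hx).trans (le_max_left _ _))
      (fun x hx => (h2 t htI x hx).trans ((le_max_left _ _).trans (le_max_right _ _)))
      (fun x hx => (h3 t htI x hx).trans ((le_max_right _ _).trans (le_max_right _ _)))
    have hexp := Real.exp_pos (-(7 * C) * t)
    nlinarith
  have hE0 : E 0 = 0 := by
    have : ∀ x ∈ uIcc (0 : ℝ) 1, (ux bc.domain u x 0 - ux bc.domain v x 0) ^ 2 = 0 := by
      intro x hx
      rw [ux_congr (g := v) (fun x hx => (hu.initial x hx).trans (hv.initial x hx).symm)
        (hS.uIcc_subset hS.one_mem hx)]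
      ring
    rw [hE]
    simp only
    rw [intervalIntegral.integral_congr this]
    simp
  have hE1 : E t₁ ≤ 0 := by
    have := hanti (left_mem_Icc.2 h0t) (right_mem_Icc.2 h0t) h0t
    simp only [hE0, zero_mul] at this
    exact nonpos_of_mul_nonpos_left this (Real.exp_pos _)
  have hunit : ∀ y ∈ Icc (0 : ℝ) 1, u y t₁ - v y t₁ = 0 := by
    intro y hy
    obtain ⟨ξ, hξm, hξe⟩ := hξ t₁ ht₁
    have := sq_le_integral_sq_deriv hS (z := fun x => u x t₁ - v x t₁)
      (fun x hx => (hu.smooth2.hasDerivWithinAt_ux hx ht₁).sub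
        (hv.smooth2.hasDerivWithinAt_ux hx ht₁))
      (((hu.smooth2_ux hD).slice_fst ht₁).continuousOn.sub
        ((hv.smooth2_ux hD).slice_fst ht₁).continuousOn) hξm (sub_eq_zero.2 hξe) hy
    exact pow_eq_zero_iff two_ne_zero |>.1 (le_antisymm (this.trans hE1) (sq_nonneg _))
  obtain ⟨y, hy, hxy⟩ := exists_mem_Icc_eq (bc := bc) (f := fun x => u x t₁ - v x t₁)
    (fun hd => by
      rcases bc.domain_cases with ⟨-, hp⟩ | ⟨hd', -⟩
      · exact (hp _ (hu.boundary t₁ ht₁)).sub (hp _ (hv.boundary t₁ ht₁))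
      · exact absurd (show (2 : ℝ) ∈ Icc (0 : ℝ) 1 by rw [← hd', hd]; trivial) (by norm_num)) hx
  simp only [hunit y hy] at hxy
  linarith

end IsSmoothSolution

/-! ### Change of frame and the representation of all solutions -/

theorem contDiffOn_primitive {D : Set ℝ} (hD : TimeInterval D) {g : ℝ → ℝ}
    (hg : ContDiffOn ℝ ∞ g D) : ContDiffOn ℝ ∞ (fun t => ∫ s in (0 : ℝ)..t, g s) D := by
  have hd : ∀ t ∈ D, HasDerivWithinAt (fun t => ∫ s in (0 : ℝ)..t, g s) (g t) D t := fun t ht =>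
    hasDerivWithinAt_primitive hD.ordConnected hD.zero_mem hg.continuousOn ht
  rw [contDiffOn_infty_iff_derivWithin hD.uniqueDiffOn]
  exact ⟨fun t ht => (hd t ht).differentiableWithinAt,
    hg.congr fun t ht => (hd t ht).derivWithin (hD.uniqueDiffOn t ht)⟩

/-- The spatial mean of `u`. -/
noncomputable def mean (u : ℝ → ℝ → ℝ) (t : ℝ) : ℝ := ∫ x in (0 : ℝ)..1, u x t

theorem Smooth2.mean {S D : Set ℝ} (hS : SpaceInterval S) (hD : TimeInterval D)
    {u : ℝ → ℝ → ℝ} (hu : Smooth2 S D u) : ContDiffOn ℝ ∞ (mean u) D :=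
  (hu.primitive hS hD).slice_snd hS.one_mem

namespace IsSmoothSolution

variable {D : Set ℝ} {u₀ : ℝ → ℝ} {V : ℝ → ℝ → ℝ} {c g : ℝ → ℝ}

theorem ux_shift (t : ℝ) (x : ℝ) :
    ux univ (fun x t => V (x - c t) t + g t) x t = ux univ V (x - c t) t := by
  simp only [ux, derivWithin_univ, deriv_add_const]
  exact deriv_comp_sub_const (f := fun y => V y t) (c t) x

theorem uxx_shift (t : ℝ) (x : ℝ) :
    uxx univ (fun x t => V (x - c t) t + g t) x t = uxx univ V (x - c t) t := by
  simp only [uxx, ux_shift, derivWithin_univ]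
  exact deriv_comp_sub_const (f := fun y => ux univ V y t) (c t) x

/-- The change of frame `u(x - c(t), t) + c'(t)` preserves the periodic problem. -/
theorem shift (hV : IsSmoothSolution .periodic u₀ (Ici 0) V) (hD : TimeInterval D)
    (hg : ContDiffOn ℝ ∞ g D) (hc : ContDiffOn ℝ ∞ c D)
    (hcg : ∀ t ∈ D, HasDerivWithinAt c (g t) D t) (hc0 : c 0 = 0) (hg0 : g 0 = 0) :
    IsSmoothSolution .periodic u₀ D (fun x t => V (x - c t) t + g t) := by
  have hsV : Smooth2 univ (Ici 0) V := hV.smooth2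
  have hsVx : Smooth2 univ (Ici 0) (ux univ V) := hV.smooth2_ux timeInterval_Ici
  have hmap : ∀ f : ℝ → ℝ → ℝ, Smooth2 univ (Ici 0) f →
      Smooth2 univ D (fun x t => f (x - c t) t) := fun f hf =>
    hf.comp (f := fun p : ℝ × ℝ => (p.1 - c p.2, p.2))
      ((contDiffOn_fst.sub (smooth2_snd hc)).prodMk contDiffOn_snd)
      fun p hp => ⟨mem_univ _, hD.nonneg _ hp.2⟩
  have hbdry : ∀ t ∈ D, BoundaryCondition.periodic.Holds (fun x => V (x - c t) t + g t) := by
    intro t ht x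
    have : V (x - c t + 1) t = V (x - c t) t := hV.boundary t (hD.nonneg t ht) (x - c t)
    simp only [← this]
    ring_nf
  refine ⟨(hmap V hsV).add (smooth2_snd hg), hbdry, fun x _ => ?_, fun t ht h0 x hx => ?_⟩
  · simp only [hc0, hg0, sub_zero, add_zero]
    exact hV.initial x (mem_univ x)
  · change deriv (fun s => ux univ (fun x t => V (x - c t) t + g t) x s) t
        + (V (x - c t) t + g t) * uxx univ (fun x t => V (x - c t) t + g t) x t
        - ux univ (fun x t => V (x - c t) t + g t) x t ^ 2
      = -2 * ∫ y in (0 : ℝ)..1, ux univ (fun x t => V (x - c t) t + g t) y t ^ 2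
    have ht' : t ∈ Ici (0 : ℝ) := hD.nonneg t ht
    simp only [ux_shift, uxx_shift]
    -- The moving frame contributes `-g V_xx`, cancelling the `g V_xx` that comes from the velocity
    -- added in the transport term.
    have hd : deriv (fun s => ux univ V (x - c s) s) t
        = uxx univ V (x - c t) t * (-(g t)) + ut (Ici 0) (ux univ V) (x - c t) t := by
      have e := (hsVx.hasFDerivWithinAt_lin ordConnected_univ uniqueDiffOn_univ
        timeInterval_Ici.uniqueDiffOn (mem_univ (x - c t)) ht').comp_hasDerivWithinAt
        (f := fun s => (x - c s, s)) t
        (((hcg t ht).const_sub x).prodMk (hasDerivWithinAt_id t D))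
        (fun s hs => ⟨mem_univ _, hD.nonneg s hs⟩)
      refine (e.hasDerivAt (hD.mem_nhds ht h0)).deriv.trans ?_
      simp only [lin_apply, mul_one, uxx]
      rfl
    have hp : Function.Periodic (fun y => ux univ V y t ^ 2) 1 := fun y => by
      have := periodic_ux (f := V) (hV.boundary t ht') y
      simp only at this
      simp only [this]
    have hI : ∫ y in (0 : ℝ)..1, ux univ V (y - c t) t ^ 2
        = ∫ y in (0 : ℝ)..1, ux univ V y t ^ 2 := by
      rw [intervalIntegral.integral_comp_sub_right (fun y => ux univ V y t ^ 2)]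
      have := hp.intervalIntegral_add_eq (0 - c t) 0
      rw [zero_add] at this
      rw [← this]
      congr 1
      ring
    have := hV.equation_ut timeInterval_Ici ht' h0 (mem_univ (x - c t))
    change ut (Ici 0) (ux univ V) (x - c t) t + V (x - c t) t * uxx univ V (x - c t) t
      - ux univ V (x - c t) t ^ 2 = -2 * ∫ y in (0 : ℝ)..1, ux univ V y t ^ 2 at this
    rw [hd, hI, ← this]
    ring

/-- The mean value theorem for integrals; it turns equality of spatial means into the common point
that uniqueness requires. -/
theorem exists_zero_of_integral_eq_zero {f : ℝ → ℝ} (hf : ContinuousOn f (uIcc 0 1))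
    (h : ∫ x in (0 : ℝ)..1, f x = 0) : ∃ ξ ∈ Icc (0 : ℝ) 1, f ξ = 0 := by
  obtain ⟨ξ, hξ, e⟩ := exists_eq_const_mul_intervalIntegral_of_nonneg (f := f) (g := fun _ => 1)
    (μ := MeasureTheory.volume) hf (by simp) (fun _ _ => zero_le_one)
  rw [uIcc_of_le zero_le_one] at hξ
  refine ⟨ξ, hξ, ?_⟩
  simpa [h] using e.symm

/-- A periodic solution is a change of frame of any global solution with the same data. -/
theorem eq_shift {u : ℝ → ℝ → ℝ} (hu : IsSmoothSolution .periodic u₀ D u)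
    (hV : IsSmoothSolution .periodic u₀ (Ici 0) V) (hD : TimeInterval D)
    (hg : ∀ t ∈ D, g t = mean u t - mean V t)
    (hcg : ∀ t ∈ D, HasDerivWithinAt c (g t) D t) (hc0 : c 0 = 0) :
    ∀ t ∈ D, ∀ x, u x t = V (x - c t) t + g t := by
  have hS := BoundaryCondition.periodic.spaceInterval
  have hgs : ContDiffOn ℝ ∞ g D :=
    ((hu.smooth2.mean hS hD).sub ((hV.smooth2.mean hS timeInterval_Ici).mono
      hD.subset_Ici)).congr hg
  have hcs : ContDiffOn ℝ ∞ c D := by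
    rw [contDiffOn_infty_iff_derivWithin hD.uniqueDiffOn]
    exact ⟨fun t ht => (hcg t ht).differentiableWithinAt,
      hgs.congr fun t ht => (hcg t ht).derivWithin (hD.uniqueDiffOn t ht)⟩
  have hg0 : g 0 = 0 := by
    rw [hg 0 hD.zero_mem, mean, mean, sub_eq_zero]
    refine intervalIntegral.integral_congr fun x _ => ?_
    exact (hu.initial x (mem_univ x)).trans (hV.initial x (mem_univ x)).symm
  have hW := hV.shift hD hgs hcs hcg hc0 hg0
  have key := hu.eq_of_exists_eq hW hD fun t ht => ?_
  · exact fun t ht x => key t ht x (mem_univ x)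
  · have hcu : Continuous (fun x => u x t) :=
      continuousOn_univ.1 (hu.smooth2.slice_fst ht).continuousOn
    have hcV : Continuous (fun x => V x t) :=
      continuousOn_univ.1 (hV.smooth2.slice_fst (hD.nonneg t ht)).continuousOn
    have hcVs : Continuous (fun x => V (x - c t) t) := hcV.comp (by fun_prop)
    have hcs' : Continuous (fun x => V (x - c t) t + g t) := hcVs.add continuous_const
    have hmean : ∫ x in (0 : ℝ)..1, (u x t - (V (x - c t) t + g t)) = 0 := by
      have hp : Function.Periodic (fun y => V y t) 1 := hV.boundary t (hD.nonneg t ht)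
      have hI : ∫ y in (0 : ℝ)..1, V (y - c t) t = mean V t := by
        rw [intervalIntegral.integral_comp_sub_right (fun y => V y t)]
        have := hp.intervalIntegral_add_eq (0 - c t) 0
        rw [zero_add] at this
        rw [mean, ← this]
        congr 1
        ring
      rw [intervalIntegral.integral_sub (hcu.intervalIntegrable _ _)
        (hcs'.intervalIntegrable _ _),
        intervalIntegral.integral_add (hcVs.intervalIntegrable _ _) (by simp), hI, hg t ht]
      simp [mean]
    obtain ⟨ξ, hξ, e⟩ := exists_zero_of_integral_eq_zero
      (hcu.sub hcs').continuousOn hmean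
    exact ⟨ξ, hξ, sub_eq_zero.1 e⟩

theorem eq_of_dirichlet {bc : BoundaryCondition} (hbc : bc ≠ .periodic) {u : ℝ → ℝ → ℝ}
    (hu : IsSmoothSolution bc u₀ D u) (hV : IsSmoothSolution bc u₀ D V) (hD : TimeInterval D) :
    ∀ t ∈ D, ∀ x ∈ bc.domain, u x t = V x t := by
  refine hu.eq_of_exists_eq hV hD fun t ht => ⟨0, ⟨le_rfl, zero_le_one⟩, ?_⟩
  rcases bc.periodic_or_dirichlet with h | ⟨-, h⟩
  · exact absurd h hbc
  · exact (h _ (hu.boundary t ht)).1.trans (h _ (hV.boundary t ht)).1.symm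

theorem restrict {bc : BoundaryCondition} (hV : IsSmoothSolution bc u₀ (Ici 0) V)
    (hD : TimeInterval D) : IsSmoothSolution bc u₀ D V :=
  ⟨hV.smooth2.mono hD.subset_Ici, fun t ht => hV.boundary t (hD.nonneg t ht), hV.initial,
    fun t ht => hV.equation t (hD.nonneg t ht)⟩

/-- Every solution is a change of frame of a given global one. -/
theorem representation {bc : BoundaryCondition} (hV : IsSmoothSolution bc u₀ (Ici 0) V)
    {u : ℝ → ℝ → ℝ} (hu : IsSmoothSolution bc u₀ D u) (hD : TimeInterval D) :
    ∃ c g : ℝ → ℝ, c 0 = 0 ∧ (∀ t ∈ D, HasDerivWithinAt c (g t) D t) ∧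
      (bc.domain = univ ∨ (∀ t, c t = 0)) ∧
      ∀ t ∈ D, ∀ x ∈ bc.domain, u x t = V (x - c t) t + g t := by
  by_cases hbc : bc = .periodic
  · subst hbc
    have hS := BoundaryCondition.periodic.spaceInterval
    have hgs : ContDiffOn ℝ ∞ (fun t => mean u t - mean V t) D :=
      (hu.smooth2.mean hS hD).sub ((hV.smooth2.mean hS timeInterval_Ici).mono hD.subset_Ici)
    have hcg : ∀ t ∈ D, HasDerivWithinAt (fun t => ∫ s in (0 : ℝ)..t, (mean u s - mean V s))
        (mean u t - mean V t) D t := fun t ht =>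
      hasDerivWithinAt_primitive hD.ordConnected hD.zero_mem hgs.continuousOn ht
    exact ⟨fun t => ∫ s in (0 : ℝ)..t, (mean u s - mean V s), fun t => mean u t - mean V t,
      by simp, hcg, Or.inl rfl,
      fun t ht x _ => hu.eq_shift hV hD (fun _ _ => rfl) hcg (by simp) t ht x⟩
  · refine ⟨fun _ => 0, fun _ => 0, rfl, fun t _ => hasDerivWithinAt_const t D 0,
      Or.inr fun _ => rfl, fun t ht x hx => ?_⟩
    simp only [sub_zero, add_zero]
    exact hu.eq_of_dirichlet hbc (hV.restrict hD) hD t ht x hx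

end IsSmoothSolution

theorem Smooth2.iteratedDerivWithin {S D : Set ℝ} (hS : UniqueDiffOn ℝ S) (hD : UniqueDiffOn ℝ D)
    {f : ℝ → ℝ → ℝ} (hf : Smooth2 S D f) (n : ℕ) :
    Smooth2 S D (fun x t => iteratedDerivWithin n (fun y => f y t) S x) := by
  induction n with
  | zero => simpa using hf
  | succ n ih =>
    have := ih.ux hS hD
    refine this.congr fun p _ => ?_
    simp only [iteratedDerivWithin_succ]
    rfl

theorem IsSmoothSolution.exists_bound_iteratedDeriv {bc : BoundaryCondition} {u₀ : ℝ → ℝ}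
    {V : ℝ → ℝ → ℝ} (hV : IsSmoothSolution bc u₀ (Ici 0) V) (n : ℕ) {T : ℝ} (hT : 0 ≤ T) :
    ∃ C : ℝ, ∀ t ∈ Icc 0 T, ∀ x ∈ bc.domain,
      |_root_.iteratedDerivWithin n (fun y => V y t) bc.domain x| ≤ C := by
  have hS := bc.spaceInterval
  obtain ⟨C, hC⟩ := exists_bound hS timeInterval_Ici
    (hV.smooth2.iteratedDerivWithin hS.uniqueDiffOn timeInterval_Ici.uniqueDiffOn n)
    (mem_Ici.2 hT)
  refine ⟨C, fun t ht x hx => ?_⟩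
  obtain ⟨y, hy, e⟩ := exists_mem_Icc_eq (bc := bc)
    (f := _root_.iteratedDerivWithin n (fun y => V y t) bc.domain)
    (fun hd => by
      rcases bc.domain_cases with ⟨-, hp⟩ | ⟨hd', -⟩
      · rw [hd, iteratedDerivWithin_univ]
        exact periodic_iteratedDeriv (hp _ (hV.boundary t ht.1)) n
      · exact absurd (show (2 : ℝ) ∈ Icc (0 : ℝ) 1 by rw [← hd', hd]; trivial) (by norm_num)) hx
  rw [e]
  exact hC t ht y hy

/-- Any solution is a shift of `V` plus a function of time. Spatial derivatives of order at least
one do not see the added function, and their bounds over the domain survive the shift. Continuation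
is the same change of frame with the mean prescribed by `m`. -/
theorem solutionsStaySmooth_of_global {bc : BoundaryCondition} {u₀ : ℝ → ℝ} {V : ℝ → ℝ → ℝ}
    (hV : IsSmoothSolution bc u₀ (Ici 0) V) : SolutionsStaySmooth bc u₀ := by
  refine ⟨⟨V, hV⟩, fun T u hT hu => ⟨fun n hn => ?_, fun hm => ?_⟩⟩
  · obtain ⟨C, hC⟩ := hV.exists_bound_iteratedDeriv n hT.le
    refine ⟨C, fun t ht x hx => ?_⟩
    obtain ⟨c, g, -, -, hcd, heq⟩ := hV.representation hu (timeInterval_Ico hT)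
    have e : iteratedDerivWithin n (fun y => u y t) bc.domain x
        = iteratedDerivWithin n (fun y => V y t) bc.domain (x - c t) := by
      rw [iteratedDerivWithin_congr (g := fun y => g t + V (y - c t) t)
        (fun y hy => by rw [heq t ht y hy, add_comm]) hx, iteratedDerivWithin_const_add hn]
      rcases hcd with hd | hc
      · simp only [hd, iteratedDerivWithin_univ]
        exact congrFun (iteratedDeriv_comp_sub_const n (fun y => V y t) (c t)) x
      · simp [hc]
    rw [e]
    refine hC t ⟨ht.1, ht.2.le⟩ _ ?_
    rcases hcd with hd | hc
    · rw [hd]; trivial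
    · rwa [hc, sub_zero]
  · by_cases hbc : bc = .periodic
    · obtain ⟨m, hms, hmu⟩ := hm hbc
      subst hbc
      have hS := BoundaryCondition.periodic.spaceInterval
      have hD := timeInterval_Ico hT
      have hgs : ContDiffOn ℝ ∞ (fun t => m t - mean V t) (Ici 0) :=
        hms.sub (hV.smooth2.mean hS timeInterval_Ici)
      have hcg : ∀ t ∈ Ici (0 : ℝ), HasDerivWithinAt (fun t => ∫ s in (0 : ℝ)..t, (m s - mean V s))
          (m t - mean V t) (Ici 0) t := fun t ht =>
        hasDerivWithinAt_primitive ordConnected_Ici (mem_Ici.2 le_rfl) hgs.continuousOn ht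
      have hg0 : m 0 - mean V 0 = 0 := by
        rw [← hmu 0 hD.zero_mem, mean, sub_eq_zero]
        refine intervalIntegral.integral_congr fun x _ => ?_
        exact (hu.initial x (mem_univ x)).trans (hV.initial x (mem_univ x)).symm
      refine ⟨_, hV.shift timeInterval_Ici hgs (contDiffOn_primitive timeInterval_Ici hgs) hcg
        (by simp) hg0, fun t ht x _ => ?_⟩
      exact (hu.eq_shift hV hD (g := fun t => m t - mean V t)
        (fun t ht => by rw [← hmu t ht]; rfl)
        (fun t ht => (hcg t ht.1).mono hD.subset_Ici) (by simp) t ht x).symm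
    · exact ⟨V, hV, fun t ht x hx =>
        ((hu.eq_of_dirichlet hbc (hV.restrict (timeInterval_Ico hT)) (timeInterval_Ico hT))
          t ht x hx).symm⟩

/-! ### Particle paths of an arbitrary solution -/

section Flow

variable {bc : BoundaryCondition} {u₁ η : ℝ → ℝ} {M b : ℝ} {β u : ℝ → ℝ → ℝ} {c g : ℝ → ℝ}

theorem FlowInverse.ux_eq_strain (hβ : FlowInverse bc.domain u₁ η b β)
    (hη : TimeChange u₁ M η) (h : Profile bc.domain u₁ M)
    (hcd : bc.domain = univ ∨ (∀ t, c t = 0))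
    (hu : ∀ t ∈ Ici (0 : ℝ), ∀ x ∈ bc.domain, u x t = flowVel u₁ η b (β (x - c t) t) t + g t)
    {x t : ℝ} (hx : x ∈ bc.domain) (ht : t ∈ Ici (0 : ℝ)) :
    ux bc.domain u x t = strain u₁ η (β (x - c t) t) t := by
  rw [ux_congr (g := fun y t => flowVel u₁ η b (β (y - c t) t) t + g t)
    (fun y hy => hu t ht y hy) hx]
  rcases hcd with hd | hc
  · rw [hd, IsSmoothSolution.ux_shift (V := fun x t => flowVel u₁ η b (β x t) t), ← hd]
    exact hβ.ux_vel hη h (hd ▸ mem_univ _) ht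
  · simp only [hc, sub_zero]
    rw [← hβ.ux_vel hη h hx ht]
    exact derivWithin_add_const (f := fun y => flowVel u₁ η b (β y t) t) (g t)

theorem sub_mem_domain (hcd : bc.domain = univ ∨ (∀ t, c t = 0)) {x : ℝ} (hx : x ∈ bc.domain)
    (t : ℝ) : x - c t ∈ bc.domain := by
  rcases hcd with hd | hc
  · rw [hd]; trivial
  · rwa [hc, sub_zero]

theorem FlowInverse.exists_isFlow (hβ : FlowInverse bc.domain u₁ η b β)
    (hη : TimeChange u₁ M η) (h : Profile bc.domain u₁ M)
    (hcd : bc.domain = univ ∨ (∀ t, c t = 0)) (hc0 : c 0 = 0)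
    (hcg : ∀ t ∈ Ici (0 : ℝ), HasDerivWithinAt c (g t) (Ici 0) t)
    (hu : ∀ t ∈ Ici (0 : ℝ), ∀ x ∈ bc.domain, u x t = flowVel u₁ η b (β (x - c t) t) t + g t) :
    ∃ γ, IsFlow bc u γ := by
  have hS := bc.spaceInterval
  have hmem : ∀ α ∈ Icc (0 : ℝ) 1, ∀ t ∈ Ici (0 : ℝ), flowMap u₁ η b α t + c t ∈ bc.domain := by
    intro α hα t ht
    rcases hcd with hd | hc
    · rw [hd]; trivial
    · rw [hc, add_zero]
      exact hβ.maps t ht α (hS.Icc_subset hα)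
  refine ⟨fun α t => flowMap u₁ η b α t + c t, fun α _ => ?_, hmem, fun α hα t ht => ?_⟩
  · simp only [hη.flowMap_zero, hc0, add_zero]
  · rw [hu t ht _ (hmem α hα t ht), add_sub_cancel_right,
      hβ.left_inv hη h (hS.Icc_subset hα) ht]
    exact (hη.hasDerivWithinAt_flowMap_snd h (hS.Icc_subset hα) ht).add (hcg t ht)

/-- The label of the particle is constant along any flow. -/
theorem FlowInverse.label_eq (hβ : FlowInverse bc.domain u₁ η b β)
    (hη : TimeChange u₁ M η) (h : Profile bc.domain u₁ M)
    (hcd : bc.domain = univ ∨ (∀ t, c t = 0)) (hc0 : c 0 = 0)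
    (hcg : ∀ t ∈ Ici (0 : ℝ), HasDerivWithinAt c (g t) (Ici 0) t)
    (hu : ∀ t ∈ Ici (0 : ℝ), ∀ x ∈ bc.domain, u x t = flowVel u₁ η b (β (x - c t) t) t + g t)
    {γ : ℝ → ℝ → ℝ} (hγ : IsFlow bc u γ) {α t : ℝ} (hα : α ∈ Icc (0 : ℝ) 1)
    (ht : t ∈ Ici (0 : ℝ)) : β (γ α t - c t) t = α := by
  have hS := bc.spaceInterval
  have hmem : ∀ s ∈ Ici (0 : ℝ), γ α s - c s ∈ bc.domain := fun s hs =>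
    sub_mem_domain hcd (hγ.mem_domain α hα s hs) s
  -- The relative velocity `u - g` equals `v`, so the derivative is `v/J - v/J = 0`. This pins down
  -- every flow without a separate ODE uniqueness theorem.
  have hd : ∀ s ∈ Ici (0 : ℝ), HasDerivWithinAt (fun s => β (γ α s - c s) s) 0 (Ici 0) s := by
    intro s hs
    have e := (hβ.hasFDerivWithinAt hη h (hmem s hs) hs).comp_hasDerivWithinAt
      (f := fun s => (γ α s - c s, s)) s
      (((hγ.ode α hα s hs).sub (hcg s hs)).prodMk (hasDerivWithinAt_id s (Ici 0)))
      (fun r hr => ⟨hmem r hr, hr⟩)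
    refine e.congr_deriv ?_
    rw [hu s hs _ (hγ.mem_domain α hα s hs), lin_apply]
    simp only
    ring
  have hconst := (convex_Ici (0 : ℝ)).norm_image_sub_le_of_norm_hasDerivWithin_le (C := 0)
    hd (fun s _ => by simp) (mem_Ici.2 le_rfl) ht
  rw [zero_mul, norm_le_zero_iff, sub_eq_zero] at hconst
  rw [hconst, hγ.initial α hα, hc0, sub_zero]
  have := hβ.left_inv hη h (hS.Icc_subset hα) (mem_Ici.2 le_rfl)
  rwa [hη.flowMap_zero] at this

end Flow

/-! ### Taylor bounds at a maximum point -/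

/-- The mean value inequality between `a` and `x`. The factor `1/(n+1)` is given up, as only the
exponent matters. -/
theorem abs_le_pow_succ_of_deriv {S : Set ℝ} (hS : SpaceInterval S) {f f' : ℝ → ℝ} {a C : ℝ}
    {n : ℕ} (ha : a ∈ Icc (0 : ℝ) 1) (hC : 0 ≤ C)
    (hf : ∀ x ∈ S, HasDerivWithinAt f (f' x) S x)
    (hb : ∀ x ∈ Icc (0 : ℝ) 1, |f' x| ≤ C * |x - a| ^ n) (h0 : f a = 0) :
    ∀ x ∈ Icc (0 : ℝ) 1, |f x| ≤ C * |x - a| ^ (n + 1) := by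
  intro x hx
  have hsub : uIcc a x ⊆ Icc 0 1 := ordConnected_Icc.uIcc_subset ha hx
  have := (convex_uIcc a x).norm_image_sub_le_of_norm_hasDerivWithin_le
    (C := C * |x - a| ^ n) (f := f) (f' := f')
    (fun y hy => (hf y (hS.Icc_subset (hsub hy))).mono (hsub.trans hS.Icc_subset))
    (fun y hy => (hb y (hsub hy)).trans
      (mul_le_mul_of_nonneg_left (pow_le_pow_left₀ (abs_nonneg _)
        (abs_sub_left_of_mem_uIcc hy) n) hC))
    left_mem_uIcc right_mem_uIcc
  rw [h0, sub_zero, Real.norm_eq_abs, Real.norm_eq_abs] at this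
  rw [pow_succ, ← mul_assoc]
  exact this

theorem exists_abs_le_Icc {S : Set ℝ} (hS : SpaceInterval S) {f : ℝ → ℝ}
    (hf : ContDiffOn ℝ ∞ f S) : ∃ C, 0 ≤ C ∧ ∀ x ∈ Icc (0 : ℝ) 1, |f x| ≤ C := by
  obtain ⟨C, hC⟩ := isCompact_Icc.exists_bound_of_continuousOn
    (hf.continuousOn.mono hS.Icc_subset)
  exact ⟨C, (norm_nonneg _).trans (hC 0 ⟨le_rfl, zero_le_one⟩), hC⟩

/-- A function with a smooth derivative that vanishes at `a` grows at most linearly there. -/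
theorem exists_abs_le_of_zero {S : Set ℝ} (hS : SpaceInterval S) {f : ℝ → ℝ} {a : ℝ}
    (ha : a ∈ Icc (0 : ℝ) 1) (hf : ContDiffOn ℝ ∞ f S) (h0 : f a = 0) :
    ∃ C, 0 ≤ C ∧ ∀ x ∈ Icc (0 : ℝ) 1, |f x| ≤ C * |x - a| ^ 1 := by
  obtain ⟨C, hC0, hC⟩ := exists_abs_le_Icc hS (contDiffOn_derivWithin hS hf)
  exact ⟨C, hC0, abs_le_pow_succ_of_deriv (n := 0) hS ha hC0
    (fun x hx => hasDerivWithinAt_of_contDiffOn hf hx) (by simpa using hC) h0⟩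

section Growth

variable {S : Set ℝ} {u₁ : ℝ → ℝ} {M a : ℝ}

theorem hasDerivWithinAt_const_sub_of_contDiffOn (hu : ContDiffOn ℝ ∞ u₁ S) {x : ℝ}
    (hx : x ∈ S) : HasDerivWithinAt (fun x => M - u₁ x) (-derivWithin u₁ S x) S x :=
  (hasDerivWithinAt_of_contDiffOn hu hx).const_sub M

/-- The vanishing derivative is a genuine assumption: a maximum at an end point of `[0,1]` does not
imply it. -/
theorem growth_two (hS : SpaceInterval S) (hu : ContDiffOn ℝ ∞ u₁ S) (ha : a ∈ Icc (0 : ℝ) 1)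
    (h0 : u₁ a = M) (h1 : derivWithin u₁ S a = 0) :
    ∃ C, 0 ≤ C ∧ ∀ x ∈ Icc (0 : ℝ) 1, M - u₁ x ≤ C * |x - a| ^ 2 := by
  obtain ⟨C, hC0, hC⟩ := exists_abs_le_of_zero hS ha (contDiffOn_derivWithin hS hu) h1
  refine ⟨C, hC0, fun x hx => (le_abs_self _).trans ?_⟩
  exact abs_le_pow_succ_of_deriv (n := 1) hS ha hC0
    (fun x hx => hasDerivWithinAt_const_sub_of_contDiffOn (M := M) hu hx)
    (by simpa using hC) (by rw [h0, sub_self]) x hx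

theorem growth_three (hS : SpaceInterval S) (hu : ContDiffOn ℝ ∞ u₁ S) (ha : a ∈ Icc (0 : ℝ) 1)
    (h0 : u₁ a = M) (h1 : derivWithin u₁ S a = 0) :
    ∃ C, 0 ≤ C ∧ ∀ x ∈ Icc (0 : ℝ) 1,
      |M - u₁ x - (-derivWithin (derivWithin u₁ S) S a / 2) * (x - a) ^ 2| ≤ C * |x - a| ^ 3 := by
  have s1 := contDiffOn_derivWithin hS hu
  have s2 := contDiffOn_derivWithin hS s1
  set κ := -derivWithin (derivWithin u₁ S) S a / 2 with hκ
  have hd2 : ContDiffOn ℝ ∞ (fun x => -derivWithin (derivWithin u₁ S) S x - 2 * κ) S :=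
    s2.neg.sub contDiffOn_const
  obtain ⟨C, hC0, hC⟩ := exists_abs_le_of_zero hS ha hd2 (by rw [hκ]; ring)
  refine ⟨C, hC0, ?_⟩
  refine abs_le_pow_succ_of_deriv (n := 2) hS ha hC0
    (f' := fun x => -derivWithin u₁ S x - κ * (2 * (x - a))) (fun x hx => ?_) ?_
    (by rw [h0]; ring)
  · refine (hasDerivWithinAt_const_sub_of_contDiffOn hu hx).fun_sub ?_
    have := (((hasDerivWithinAt_id x S).sub_const a).fun_pow 2).const_mul κ
    simpa using this
  · refine abs_le_pow_succ_of_deriv (n := 1) hS ha hC0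
      (f' := fun x => -derivWithin (derivWithin u₁ S) S x - 2 * κ) (fun x hx => ?_) hC
      (by rw [h1]; ring)
    refine (hasDerivWithinAt_of_contDiffOn s1 hx).fun_neg.fun_sub ?_
    have := (((hasDerivWithinAt_id x S).sub_const a).const_mul 2).const_mul κ
    refine this.congr_deriv ?_
    ring

end Growth

/-! ### Growth of `K0` and bounds on the strain -/

namespace Profile

variable {S : Set ℝ} {u₁ : ℝ → ℝ} {M a C : ℝ}

/-- On a window of length `r/2` beside `a`, the denominator `1 - ηu₁` is at most `(1 + C/M)(1 -
ηM)`. The exponent is `q = 2` for global existence and `q = 3` for decay. -/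
theorem K0_lower (h : Profile S u₁ M) (ha : a ∈ Icc (0 : ℝ) 1) (hC : 0 ≤ C) {q : ℕ}
    (hg : ∀ x ∈ Icc (0 : ℝ) 1, M - u₁ x ≤ C * |x - a| ^ q) {η r : ℝ} (hη : η ∈ Ico 0 (1 / M))
    (hr : 0 < r) (hr1 : r ≤ 1) (hrq : r ^ q ≤ 1 - η * M) :
    r / (2 * (1 + C / M) * (1 - η * M)) ≤ K0 u₁ η := by
  have hM := h.pos
  set δ := 1 - η * M with hδ
  have hδ0 : 0 < δ := (pow_pos hr q).trans_le hrq
  -- The window lies on the side of `a` where at least half of `[0,1]` remains; it fits because `r ≤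
  -- 1`.
  obtain ⟨l, hl0, hl1, hla⟩ : ∃ l, 0 ≤ l ∧ l + r / 2 ≤ 1 ∧
      ∀ x ∈ Icc l (l + r / 2), |x - a| ≤ r := by
    rcases le_total a (1 / 2) with hle | hle
    · exact ⟨a, ha.1, by linarith, fun x hx => abs_le.2 ⟨by linarith [hx.1], by linarith [hx.2]⟩⟩
    · exact ⟨a - r / 2, by linarith, by linarith [ha.2],
        fun x hx => abs_le.2 ⟨by linarith [hx.1], by linarith [hx.2]⟩⟩
  have hcont : ContinuousOn (fun a => (1 - η * u₁ a)⁻¹) (Icc 0 1) :=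
    (h.continuousOn_inv hη).mono h.space.Icc_subset
  have hsub : Icc l (l + r / 2) ⊆ Icc 0 1 := Icc_subset_Icc hl0 hl1
  have hle : l ≤ l + r / 2 := by linarith
  have e1 : ∫ x in l..(l + r / 2), (1 - η * u₁ x)⁻¹ ≤ K0 u₁ η := by
    refine intervalIntegral.integral_mono_interval hl0 hle hl1 ?_
      (ContinuousOn.intervalIntegrable (by rwa [uIcc_of_le zero_le_one]))
    refine (MeasureTheory.ae_restrict_iff' measurableSet_Ioc).2 (Eventually.of_forall ?_)
    exact fun x hx =>
      (inv_pos.2 (h.denom_pos (h.space.Icc_subset (Ioc_subset_Icc_self hx)) hη)).le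
  have e2 : ∫ x in l..(l + r / 2), ((1 + C / M) * δ)⁻¹
      ≤ ∫ x in l..(l + r / 2), (1 - η * u₁ x)⁻¹ := by
    refine intervalIntegral.integral_mono_on hle (by simp)
      (ContinuousOn.intervalIntegrable (by rw [uIcc_of_le hle]; exact hcont.mono hsub))
      fun x hx => ?_
    refine inv_anti₀ (h.denom_pos (h.space.Icc_subset (hsub hx)) hη) ?_
    have b1 := hg x (hsub hx)
    have b2 : C * |x - a| ^ q ≤ C * δ :=
      mul_le_mul_of_nonneg_left ((pow_le_pow_left₀ (abs_nonneg _) (hla x hx) q).trans hrq) hC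
    have b3 : η * (M - u₁ x) ≤ 1 / M * (C * δ) :=
      mul_le_mul hη.2.le (b1.trans b2) (sub_nonneg.2 (h.le x (h.space.Icc_subset (hsub hx))))
        (by positivity)
    have : 1 - η * u₁ x = δ + η * (M - u₁ x) := by rw [hδ]; ring
    rw [this]
    calc δ + η * (M - u₁ x) ≤ δ + 1 / M * (C * δ) := by linarith
      _ = (1 + C / M) * δ := by ring
  rw [intervalIntegral.integral_const, add_sub_cancel_left, smul_eq_mul] at e2
  refine le_trans (le_of_eq ?_) (e2.trans e1)
  have : 0 < 1 + C / M := by positivity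
  field_simp

theorem one_sub_mul_mem (h : Profile S u₁ M) {η : ℝ} (hη : η ∈ Ico 0 (1 / M)) :
    0 < 1 - η * M ∧ 1 - η * M ≤ 1 := by
  have h2 : η * M < 1 := (lt_div_iff₀ h.pos).1 hη.2
  have := mul_nonneg hη.1 h.pos.le
  constructor <;> linarith

/-- If `u₁` has a flat enough maximum, the time change takes infinite time. -/
theorem integral_K0_sq_unbounded (h : Profile S u₁ M) (ha : a ∈ Icc (0 : ℝ) 1) (hC : 0 ≤ C)
    (hg : ∀ x ∈ Icc (0 : ℝ) 1, M - u₁ x ≤ C * |x - a| ^ 2) (B : ℝ) :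
    ∃ s ∈ Ico 0 (1 / M), B ≤ ∫ r in (0 : ℝ)..s, K0 u₁ r ^ 2 := by
  have hM := h.pos
  set c := 1 / (2 * (1 + C / M)) ^ 2 with hc
  have hc0 : 0 < c := by positivity
  have hK : ∀ η ∈ Ico 0 (1 / M), c / (1 - η * M) ≤ K0 u₁ η ^ 2 := by
    intro η hη
    obtain ⟨hδ0, hδ1⟩ := h.one_sub_mul_mem hη
    have := h.K0_lower ha hC hg hη (Real.sqrt_pos.2 hδ0) (Real.sqrt_le_one.2 hδ1)
      (Real.sq_sqrt hδ0.le).le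
    have h2 := pow_le_pow_left₀ (by positivity) this 2
    refine le_trans (le_of_eq ?_) h2
    rw [div_pow, Real.sq_sqrt hδ0.le, hc]
    field_simp
  -- Taking `r = √(1 - ηM)` gave `K0² ≥ c/(1 - ηM)`, whose primitive is the logarithm compared with
  -- here.
  have hmono : MonotoneOn (fun s => (∫ r in (0 : ℝ)..s, K0 u₁ r ^ 2)
      - c / M * (-Real.log (1 - s * M))) (Ico 0 (1 / M)) := by
    have hd : ∀ s ∈ Ico 0 (1 / M), HasDerivWithinAt (fun s => (∫ r in (0 : ℝ)..s, K0 u₁ r ^ 2)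
        - c / M * (-Real.log (1 - s * M))) (K0 u₁ s ^ 2 - c / (1 - s * M)) (Ico 0 (1 / M)) s := by
      intro s hs
      have hδ0 := (h.one_sub_mul_mem hs).1
      have := (h.hasDerivWithinAt_integral_K0_sq hs).fun_sub
        ((((((hasDerivWithinAt_id s (Ico 0 (1 / M))).mul_const M).const_sub 1).log
          hδ0.ne').fun_neg).const_mul (c / M))
      refine this.congr_deriv ?_
      simp only [id]
      field_simp
    refine monotoneOn_of_hasDerivWithinAt_nonneg h.timeInterval.ordConnected.convex
      (fun s hs => (hd s hs).continuousWithinAt)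
      (fun s hs => (hd s (interior_subset hs)).mono interior_subset)
      fun s hs => sub_nonneg.2 (hK s (interior_subset hs))
  -- At `s = (1 - e^{-L})/M` the logarithm equals `-L`, and `(c/M) L = max B 0`.
  set L := max B 0 * M / c with hL
  have hL0 : 0 ≤ L := by positivity
  refine ⟨(1 - Real.exp (-L)) / M, ⟨?_, ?_⟩, ?_⟩
  · have : Real.exp (-L) ≤ 1 := Real.exp_le_one_iff.2 (by linarith)
    exact div_nonneg (by linarith) hM.le
  · gcongr
    linarith [Real.exp_pos (-L)]
  · have hmem : (1 - Real.exp (-L)) / M ∈ Ico 0 (1 / M) := by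
      have : Real.exp (-L) ≤ 1 := Real.exp_le_one_iff.2 (by linarith)
      refine ⟨div_nonneg (by linarith) hM.le, ?_⟩
      gcongr
      linarith [Real.exp_pos (-L)]
    have := hmono h.timeInterval.zero_mem hmem hmem.1
    simp only [intervalIntegral.integral_same, zero_mul, sub_zero, Real.log_one, neg_zero,
      mul_zero] at this
    rw [div_mul_cancel₀ _ hM.ne', sub_sub_cancel, Real.log_exp, neg_neg, hL] at this
    have e : c / M * (max B 0 * M / c) = max B 0 := by field_simp
    rw [e] at this
    exact (le_max_left B 0).trans (by linarith)

/-- One of the two factors `1/(1 - ηu₁)` is bounded by its value at the maximum, the other is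
integrated. -/
theorem abs_K1_le (h : Profile S u₁ M) {B : ℝ} (hB : ∀ x ∈ S, |u₁ x| ≤ B) {η : ℝ}
    (hη : η ∈ Ico 0 (1 / M)) : |K1 u₁ η| ≤ B / (1 - η * M) * K0 u₁ η := by
  have hδ0 := (h.one_sub_mul_mem hη).1
  have hsub := h.space.uIcc_subset h.space.one_mem
  have hB0 : 0 ≤ B := (abs_nonneg _).trans (hB 0 h.space.zero_mem)
  have hc : IntervalIntegrable (fun a => (1 - η * u₁ a)⁻¹) MeasureTheory.volume 0 1 :=
    ((h.continuousOn_inv hη).mono hsub).intervalIntegrable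
  rw [K1, K0, ← intervalIntegral.integral_const_mul, ← Real.norm_eq_abs]
  refine intervalIntegral.norm_integral_le_of_norm_le zero_le_one
    (Eventually.of_forall fun x hx => ?_) (hc.const_mul _)
  have hxS : x ∈ S := h.space.Icc_subset (Ioc_subset_Icc_self hx)
  have hp := h.denom_pos hxS hη
  have hle : 1 - η * M ≤ 1 - η * u₁ x := by
    have := mul_le_mul_of_nonneg_left (h.le x hxS) hη.1
    linarith
  rw [Real.norm_eq_abs, abs_div, abs_of_pos (pow_pos hp 2), pow_two, ← div_div, div_eq_mul_inv]
  refine mul_le_mul_of_nonneg_right ?_ (inv_pos.2 hp).le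
  exact div_le_div₀ hB0 (hB x hxS) hδ0 hle

end Profile

theorem TimeChange.abs_strain_le {S : Set ℝ} {u₁ η : ℝ → ℝ} {M B : ℝ} (hη : TimeChange u₁ M η)
    (h : Profile S u₁ M) (hB : ∀ x ∈ S, |u₁ x| ≤ B) {a t : ℝ} (ha : a ∈ S)
    (ht : t ∈ Ici (0 : ℝ)) :
    |strain u₁ η a t| ≤ 2 * B / (1 - η t * M) / K0 u₁ (η t) ^ 2 := by
  have hm := hη.mem t ht
  have hδ0 := (h.one_sub_mul_mem hm).1
  have hK := hη.K0_pos h ht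
  have hp := hη.denom_pos h ha ht
  have hB0 : 0 ≤ B := (abs_nonneg _).trans (hB 0 h.space.zero_mem)
  rw [strain, abs_div, abs_of_pos (pow_pos hK 2)]
  refine div_le_div_of_nonneg_right ((abs_sub _ _).trans ?_) (pow_pos hK 2).le
  have e1 : |u₁ a / (1 - η t * u₁ a)| ≤ B / (1 - η t * M) := by
    rw [abs_div, abs_of_pos hp]
    refine div_le_div₀ hB0 (hB a ha) hδ0 ?_
    have := mul_le_mul_of_nonneg_left (h.le a ha) hm.1
    linarith
  have e2 : |K1 u₁ (η t) / K0 u₁ (η t)| ≤ B / (1 - η t * M) := by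
    rw [abs_div, abs_of_pos hK, div_le_iff₀ hK]
    exact h.abs_K1_le hB hm
  calc _ ≤ B / (1 - η t * M) + B / (1 - η t * M) := add_le_add e1 e2
    _ = _ := by ring

/-- A degenerate maximum: the strain decays uniformly. -/
theorem TimeChange.strain_tendsto_zero {S : Set ℝ} {u₁ η : ℝ → ℝ} {M a C : ℝ}
    (hη : TimeChange u₁ M η) (h : Profile S u₁ M) (ha : a ∈ Icc (0 : ℝ) 1) (hC : 0 ≤ C)
    (hg : ∀ x ∈ Icc (0 : ℝ) 1, M - u₁ x ≤ C * |x - a| ^ 3) :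
    ∃ E : ℝ → ℝ, Tendsto E atTop (𝓝 0) ∧
      ∀ t ∈ Ici (0 : ℝ), ∀ x ∈ S, |strain u₁ η x t| ≤ E t := by
  have hM := h.pos
  obtain ⟨B, hB⟩ := h.bdd
  have hB0 : 0 ≤ B := (abs_nonneg _).trans (hB 0 h.space.zero_mem)
  -- With `1 - ηM = r³` the lower bound on `K0` is of order `r⁻²`, so the strain is at most of order
  -- `r⁻³ r⁴ = r`.
  set r : ℝ → ℝ := fun t => (1 - η t * M) ^ ((3 : ℕ) : ℝ)⁻¹ with hr
  refine ⟨fun t => 2 * B * (2 * (1 + C / M)) ^ 2 * r t, ?_, fun t ht x hx => ?_⟩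
  · have h1 : Tendsto (fun t => 1 - η t * M) atTop (𝓝 0) := by
      have : Tendsto (fun t => 1 - η t * M) atTop (𝓝 (1 - 1 / M * M)) :=
        ((hη.tendsto.mono_right nhdsWithin_le_nhds).mul_const M).const_sub 1
      rwa [one_div_mul_cancel hM.ne', sub_self] at this
    have h2 : Tendsto r atTop (𝓝 (0 ^ ((3 : ℕ) : ℝ)⁻¹)) :=
      h1.rpow_const (Or.inr (by positivity))
    rw [Real.zero_rpow (by positivity)] at h2
    simpa using h2.const_mul (2 * B * (2 * (1 + C / M)) ^ 2)
  · have hm := hη.mem t ht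
    obtain ⟨hδ0, hδ1⟩ := h.one_sub_mul_mem hm
    have hr0 : 0 < r t := Real.rpow_pos_of_pos hδ0 _
    have hr3 : r t ^ 3 = 1 - η t * M := Real.rpow_inv_natCast_pow hδ0.le three_ne_zero
    have hr1 : r t ≤ 1 := Real.rpow_le_one hδ0.le hδ1 (by positivity)
    have hK := h.K0_lower ha hC hg hm hr0 hr1 hr3.le
    refine (hη.abs_strain_le h hB hx ht).trans ?_
    have hA : 0 < 2 * (1 + C / M) := by positivity
    set A := 2 * (1 + C / M) with hAdef
    rw [← hr3] at hK ⊢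
    have hK2 : (r t / (A * r t ^ 3)) ^ 2 ≤ K0 u₁ (η t) ^ 2 :=
      pow_le_pow_left₀ (by positivity) hK 2
    calc 2 * B / r t ^ 3 / K0 u₁ (η t) ^ 2 ≤ 2 * B / r t ^ 3 / (r t / (A * r t ^ 3)) ^ 2 := by
          gcongr
      _ = 2 * B * A ^ 2 * r t := by field_simp

/-! ### Laplace-type asymptotics -/

section Asymptotics

open MeasureTheory

/-- `∫ (1 + y²)⁻ᵐ` over the line. -/
noncomputable def bump (m : ℕ) : ℝ := ∫ y : ℝ, ((1 + y ^ 2) ^ m)⁻¹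

theorem bump_one : bump 1 = Real.pi := by
  simp [bump]

theorem abs_div_one_add_sq_le (y : ℝ) : |y / (1 + y ^ 2)| ≤ |y|⁻¹ := by
  rcases eq_or_ne y 0 with rfl | hy
  · simp
  · rw [abs_div, abs_of_pos (by positivity : 0 < 1 + y ^ 2), div_le_iff₀ (by positivity),
      ← div_eq_inv_mul, le_div_iff₀ (abs_pos.2 hy), abs_mul_abs_self]
    nlinarith

theorem inv_pow_succ_le_inv {x : ℝ} (hx : 1 ≤ x) (n : ℕ) : (x ^ (n + 1))⁻¹ ≤ x⁻¹ :=
  inv_anti₀ (by linarith) (by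
    calc x = x ^ 1 := (pow_one x).symm
      _ ≤ x ^ (n + 1) := pow_le_pow_right₀ hx (by omega))

theorem integrable_bump (n : ℕ) : Integrable fun y : ℝ => ((1 + y ^ 2) ^ (n + 1))⁻¹ := by
  refine integrable_inv_one_add_sq.mono' (Continuous.aestronglyMeasurable ?_)
    (Eventually.of_forall fun y => ?_)
  · exact ((continuous_const.add (continuous_pow 2)).pow _).inv₀ fun y =>
      (by positivity : (1 + y ^ 2 : ℝ) ^ (n + 1) ≠ 0)
  · rw [Real.norm_eq_abs, abs_of_pos (by positivity)]
    exact inv_pow_succ_le_inv (by nlinarith [sq_nonneg y]) n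

theorem bump_two : bump 2 = Real.pi / 2 := by
  have hd : ∀ y : ℝ, HasDerivAt (fun y => (Real.arctan y + y / (1 + y ^ 2)) / 2)
      (((1 + y ^ 2) ^ 2)⁻¹) y := by
    intro y
    have hne : (1 + y ^ 2 : ℝ) ≠ 0 := by positivity
    have := ((Real.hasDerivAt_arctan y).fun_add ((hasDerivAt_id y).fun_div
      (((hasDerivAt_id y).fun_pow 2).const_add 1) hne)).div_const 2
    refine this.congr_deriv ?_
    simp only [id]
    field_simp
    ring
  have hz : ∀ l : Filter ℝ, Tendsto (fun y : ℝ => |y|) l atTop →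
      Tendsto (fun y : ℝ => y / (1 + y ^ 2)) l (𝓝 0) := fun l hl =>
    squeeze_zero_norm abs_div_one_add_sq_le (tendsto_inv_atTop_zero.comp hl)
  have hb : Tendsto (fun y : ℝ => (Real.arctan y + y / (1 + y ^ 2)) / 2) atBot
      (𝓝 ((-(Real.pi / 2) + 0) / 2)) :=
    ((tendsto_nhds_of_tendsto_nhdsWithin Real.tendsto_arctan_atBot).add
      (hz _ tendsto_abs_atBot_atTop)).div_const 2
  have ht : Tendsto (fun y : ℝ => (Real.arctan y + y / (1 + y ^ 2)) / 2) atTop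
      (𝓝 ((Real.pi / 2 + 0) / 2)) :=
    ((tendsto_nhds_of_tendsto_nhdsWithin Real.tendsto_arctan_atTop).add
      (hz _ tendsto_abs_atTop_atTop)).div_const 2
  rw [bump, integral_of_hasDerivAt_of_tendsto hd (integrable_bump 1) hb ht]
  ring

theorem mul_sq_eq_sqrt_mul_sq {κ : ℝ} (hκ : 0 < κ) (y : ℝ) : κ * y ^ 2 = (√κ * y) ^ 2 := by
  rw [mul_pow, Real.sq_sqrt hκ.le]

theorem integrable_quadratic {κ : ℝ} (hκ : 0 < κ) (n : ℕ) :
    Integrable fun y : ℝ => ((1 + κ * y ^ 2) ^ (n + 1))⁻¹ := by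
  simp_rw [mul_sq_eq_sqrt_mul_sq hκ]
  exact (integrable_bump n).comp_mul_left' (Real.sqrt_pos.2 hκ).ne'

theorem integral_quadratic {κ : ℝ} (hκ : 0 < κ) (m : ℕ) :
    ∫ y : ℝ, ((1 + κ * y ^ 2) ^ m)⁻¹ = bump m / √κ := by
  simp_rw [mul_sq_eq_sqrt_mul_sq hκ]
  rw [Measure.integral_comp_mul_left (fun z => ((1 + z ^ 2) ^ m)⁻¹) (√κ),
    abs_of_pos (inv_pos.2 (Real.sqrt_pos.2 hκ)), smul_eq_mul, ← div_eq_inv_mul, bump]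

/-- The directions in which `[0, 1]` extends from `a`. -/
def side (a : ℝ) : Set ℝ := {y | (a = 0 → 0 ≤ y) ∧ (a = 1 → y ≤ 0)}

theorem side_zero : side 0 = Ici 0 := by ext y; simp [side]

theorem side_one : side 1 = Iic 0 := by ext y; simp [side]

theorem side_interior {a : ℝ} (h : ¬(a = 0 ∨ a = 1)) : side a = univ := by
  rw [not_or] at h
  ext y
  simp [side, h.1, h.2]

theorem measurableSet_side (a : ℝ) : MeasurableSet (side a) := by
  by_cases h : a = 0 ∨ a = 1
  · rcases h with rfl | rfl
    · rw [side_zero]; exact measurableSet_Ici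
    · rw [side_one]; exact measurableSet_Iic
  · rw [side_interior h]; exact MeasurableSet.univ

open Classical in
-- Source of the weights: at an end point of `[0,1]` only half of the even limiting profile is
-- integrated.
theorem integral_side {f : ℝ → ℝ} (hf : ∀ y, f (-y) = f y) (a : ℝ) :
    ∫ y in side a, f y = (if a = 0 ∨ a = 1 then (1 / 2 : ℝ) else 1) * ∫ y, f y := by
  have habs : ∫ y, f y = 2 * ∫ y in Ioi 0, f y := by
    rw [← integral_comp_abs]
    refine integral_congr_ae (Eventually.of_forall fun y => ?_)
    rcases abs_choice y with h | h <;> simp only [h, hf]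
  by_cases h : a = 0 ∨ a = 1
  · rw [if_pos h, habs]
    rcases h with rfl | rfl
    · rw [side_zero, integral_Ici_eq_integral_Ioi]; ring
    · have := integral_comp_neg_Iic 0 f
      simp only [hf, neg_zero] at this
      rw [side_one, this]; ring
  · rw [if_neg h, side_interior h, Measure.restrict_univ, one_mul]

theorem eventually_mem_of_side {a h y : ℝ} (ha : a ∈ Icc (0 : ℝ) 1) (hh : 0 < h)
    (hy : y ∈ side a) : ∀ᶠ s in 𝓝[>] (0 : ℝ), a + s * y ∈ Icc (0 : ℝ) 1 ∩ Metric.ball a h := by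
  have hc : Tendsto (fun s : ℝ => a + s * y) (𝓝[>] 0) (𝓝 a) := by
    have : Tendsto (fun s : ℝ => a + s * y) (𝓝 0) (𝓝 (a + 0 * y)) :=
      (by fun_prop : Continuous fun s : ℝ => a + s * y).tendsto 0
    rw [zero_mul, add_zero] at this
    exact this.mono_left nhdsWithin_le_nhds
  have h0 : ∀ᶠ s in 𝓝[>] (0 : ℝ), 0 ≤ a + s * y := by
    rcases ha.1.eq_or_lt with h0 | h0
    · filter_upwards [self_mem_nhdsWithin] with s hs
      rw [← h0, zero_add]
      exact mul_nonneg (le_of_lt hs) (hy.1 h0.symm)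
    · exact (hc.eventually (eventually_gt_nhds h0)).mono fun s hs => hs.le
  have h1 : ∀ᶠ s in 𝓝[>] (0 : ℝ), a + s * y ≤ 1 := by
    rcases ha.2.eq_or_lt with h1 | h1
    · filter_upwards [self_mem_nhdsWithin] with s hs
      have := mul_nonpos_of_nonneg_of_nonpos (le_of_lt hs) (hy.2 h1)
      linarith
    · exact (hc.eventually (eventually_lt_nhds h1)).mono fun s hs => hs.le
  filter_upwards [h0, h1, hc.eventually (Metric.ball_mem_nhds a hh)] with s e0 e1 e2
  exact ⟨⟨e0, e1⟩, e2⟩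

theorem notMem_of_notMem_side {a y s : ℝ} (hs : 0 < s) (hy : y ∉ side a) :
    a + s * y ∉ Icc (0 : ℝ) 1 := by
  intro hm
  refine hy ⟨fun h0 => ?_, fun h1 => ?_⟩
  · rw [h0, zero_add] at hm
    exact nonneg_of_mul_nonneg_right hm.1 hs
  · rw [h1] at hm
    have : s * y ≤ 0 := by linarith [hm.2]
    exact nonpos_of_mul_nonpos_right this hs

open Classical in
/-- Laplace-type asymptotics at one quadratic zero of `g`. -/
theorem tendsto_local {g : ℝ → ℝ} (hgc : Continuous g) {a κ C h : ℝ} (ha : a ∈ Icc (0 : ℝ) 1)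
    (hκ : 0 < κ) (hC : 0 ≤ C) (hh : 0 < h) (hCh : C * h ≤ κ / 2)
    (hg : ∀ x ∈ Icc (0 : ℝ) 1, |g x - κ * (x - a) ^ 2| ≤ C * |x - a| ^ 3) (n : ℕ) :
    Tendsto (fun s : ℝ => s ^ (2 * n + 1) *
        ∫ x in Icc (0 : ℝ) 1 ∩ Metric.ball a h, ((s ^ 2 + g x) ^ (n + 1))⁻¹) (𝓝[>] 0)
      (𝓝 ((if a = 0 ∨ a = 1 then (1 / 2 : ℝ) else 1) * (bump (n + 1) / √κ))) := by
  set N := Icc (0 : ℝ) 1 ∩ Metric.ball a h with hN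
  have hNm : MeasurableSet N := measurableSet_Icc.inter Metric.isOpen_ball.measurableSet
  -- The substitution `x = a + sy` turns the local integral into one over the line, whose integrand
  -- tends to `(1 + κy²)^{-(n+1)}` on `side a` and to zero off it.
  set G : ℝ → ℝ → ℝ := fun s => N.indicator
    fun x => s ^ (2 * (n + 1)) * ((s ^ 2 + g x) ^ (n + 1))⁻¹ with hG
  have hscale : ∀ s ∈ Ioi (0 : ℝ), ∫ y, G s (a + s * y)
      = s ^ (2 * n + 1) * ∫ x in N, ((s ^ 2 + g x) ^ (n + 1))⁻¹ := by
    intro s hs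
    have hs0 : (0 : ℝ) < s := hs
    rw [Measure.integral_comp_mul_left (fun z => G s (a + z)) s, integral_add_left_eq_self,
      hG, integral_indicator hNm, integral_const_mul, abs_of_pos (inv_pos.2 hs0), smul_eq_mul,
      ← mul_assoc]
    congr 1
    rw [show 2 * (n + 1) = (2 * n + 1) + 1 by ring, pow_succ]
    field_simp
  -- The choice `C h ≤ κ/2` lets half of the quadratic term absorb the cubic error; this yields the
  -- `s`-independent dominating function.
  have hbelow : ∀ s : ℝ, 0 < s → ∀ y, a + s * y ∈ N →
      s ^ 2 * (1 + κ / 2 * y ^ 2) ≤ s ^ 2 + g (a + s * y) := by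
    intro s hs y hy
    have b1 := (abs_le.1 (hg _ hy.1)).1
    have b2 : |s * y| < h := by
      have := hy.2
      rwa [Metric.mem_ball, Real.dist_eq, add_sub_cancel_left] at this
    rw [add_sub_cancel_left] at b1
    have b3 : C * |s * y| ^ 3 ≤ κ / 2 * (s * y) ^ 2 := by
      rw [← sq_abs (s * y)]
      have : C * |s * y| ≤ κ / 2 := (mul_le_mul_of_nonneg_left b2.le hC).trans hCh
      nlinarith [mul_le_mul_of_nonneg_right this (sq_nonneg |s * y|)]
    nlinarith
  have hlim : Tendsto (fun s => ∫ y, G s (a + s * y)) (𝓝[>] 0)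
      (𝓝 (∫ y, (side a).indicator (fun y => ((1 + κ * y ^ 2) ^ (n + 1))⁻¹) y)) := by
    refine tendsto_integral_filter_of_dominated_convergence
      (fun y => (1 + κ / 2 * y ^ 2)⁻¹) ?_ ?_ ?_ ?_
    · refine Eventually.of_forall fun s => Measurable.aestronglyMeasurable ?_
      have hm : Measurable (G s) := by
        refine Measurable.indicator ?_ hNm
        have := hgc.measurable
        fun_prop
      exact hm.comp (by fun_prop)
    · filter_upwards [self_mem_nhdsWithin] with s hs
      have hs0 : (0 : ℝ) < s := hs
      refine Eventually.of_forall fun y => ?_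
      by_cases hy : a + s * y ∈ N
      · have hb := hbelow s hs0 y hy
        have hq : 0 < 1 + κ / 2 * y ^ 2 := by positivity
        rw [hG]
        simp only [indicator_of_mem hy]
        have hp : 0 < s ^ 2 + g (a + s * y) := lt_of_lt_of_le (by positivity) hb
        rw [Real.norm_eq_abs, abs_of_pos (by positivity)]
        refine le_trans ?_ (inv_pow_succ_le_inv (x := 1 + κ / 2 * y ^ 2)
          (by nlinarith [mul_nonneg hκ.le (sq_nonneg y)]) n)
        rw [← div_eq_mul_inv, div_le_iff₀ (by positivity), ← div_eq_inv_mul,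
          le_div_iff₀ (by positivity), pow_mul, ← mul_pow]
        exact pow_le_pow_left₀ (by positivity) hb _
      · rw [hG]
        simp only [indicator_of_notMem hy, norm_zero]
        positivity
    · simpa using integrable_quadratic (half_pos hκ) 0
    · refine Eventually.of_forall fun y => ?_
      by_cases hy : y ∈ side a
      · rw [indicator_of_mem hy]
        have hev := eventually_mem_of_side ha hh hy
        have hq : Tendsto (fun s : ℝ => g (a + s * y) / s ^ 2) (𝓝[>] 0) (𝓝 (κ * y ^ 2)) := by
          rw [tendsto_iff_dist_tendsto_zero]
          have hz : Tendsto (fun s : ℝ => C * |y| ^ 3 * s) (𝓝[>] 0) (𝓝 0) := by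
            have : Tendsto (fun s : ℝ => C * |y| ^ 3 * s) (𝓝 0) (𝓝 (C * |y| ^ 3 * 0)) :=
              (by fun_prop : Continuous fun s : ℝ => C * |y| ^ 3 * s).tendsto 0
            rw [mul_zero] at this
            exact this.mono_left nhdsWithin_le_nhds
          refine squeeze_zero' (Eventually.of_forall fun _ => dist_nonneg) ?_ hz
          filter_upwards [hev, self_mem_nhdsWithin] with s hs hs0
          have hs0 : (0 : ℝ) < s := hs0
          have b := hg _ hs.1
          rw [add_sub_cancel_left] at b
          have e : g (a + s * y) / s ^ 2 - κ * y ^ 2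
              = (g (a + s * y) - κ * (s * y) ^ 2) / s ^ 2 := by field_simp
          rw [Real.dist_eq, e, abs_div, abs_of_pos (by positivity : 0 < s ^ 2),
            div_le_iff₀ (by positivity)]
          refine b.trans (le_of_eq ?_)
          rw [abs_mul, abs_of_pos hs0]
          ring
        have hq2 : Tendsto (fun s : ℝ => ((1 + g (a + s * y) / s ^ 2) ^ (n + 1))⁻¹) (𝓝[>] 0)
            (𝓝 (((1 + κ * y ^ 2) ^ (n + 1))⁻¹)) :=
          ((hq.const_add 1).pow (n + 1)).inv₀ (by positivity)
        refine hq2.congr' ?_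
        filter_upwards [hev, self_mem_nhdsWithin] with s hs hs0
        have hs0 : (0 : ℝ) < s := hs0
        rw [hG]
        simp only [indicator_of_mem (show a + s * y ∈ N from hs)]
        have e : 1 + g (a + s * y) / s ^ 2 = (s ^ 2 + g (a + s * y)) / s ^ 2 := by field_simp
        rw [e, div_pow, inv_div, pow_mul, div_eq_mul_inv]
      · rw [indicator_of_notMem hy]
        refine tendsto_const_nhds.congr' ?_
        filter_upwards [self_mem_nhdsWithin] with s hs
        rw [hG]
        exact (indicator_of_notMem (fun hm => notMem_of_notMem_side hs hy hm.1) _).symm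
  rw [integral_indicator (measurableSet_side a), integral_side (fun y => by rw [neg_sq]),
    integral_quadratic hκ] at hlim
  refine hlim.congr' ?_
  filter_upwards [self_mem_nhdsWithin] with s hs using hscale s hs

open Classical in
/-- Laplace-type asymptotics for a function with finitely many quadratic zeros in `[0, 1]`. -/
theorem tendsto_laplace {g : ℝ → ℝ} (hgc : Continuous g) {A : Finset ℝ} {κ : ℝ → ℝ}
    (hA : ∀ a ∈ A, a ∈ Icc (0 : ℝ) 1) (hκ : ∀ a ∈ A, 0 < κ a)
    (hg : ∀ a ∈ A, ∃ C, 0 ≤ C ∧ ∀ x ∈ Icc (0 : ℝ) 1,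
      |g x - κ a * (x - a) ^ 2| ≤ C * |x - a| ^ 3)
    (hg0 : ∀ x ∈ Icc (0 : ℝ) 1, 0 ≤ g x) (hpos : ∀ x ∈ Icc (0 : ℝ) 1, x ∉ A → 0 < g x) (n : ℕ) :
    Tendsto (fun s : ℝ => s ^ (2 * n + 1) * ∫ x in (0 : ℝ)..1, ((s ^ 2 + g x) ^ (n + 1))⁻¹)
      (𝓝[>] 0)
      (𝓝 (∑ a ∈ A, (if a = 0 ∨ a = 1 then (1 / 2 : ℝ) else 1) * (bump (n + 1) / √(κ a)))) := by
  choose! C hC0 hC using hg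
  -- One radius making the balls disjoint and the local expansion effective at every zero.
  obtain ⟨h, hh, hsep, hsmall⟩ : ∃ h > 0, (∀ a ∈ A, ∀ b ∈ A, a ≠ b → 2 * h ≤ |a - b|) ∧
      ∀ a ∈ A, C a * h ≤ κ a / 2 := by
    have e1 : ∀ᶠ h in 𝓝[>] (0 : ℝ), ∀ a ∈ A, ∀ b ∈ A, a ≠ b → 2 * h ≤ |a - b| := by
      refine (eventually_all_finset A).2 fun a _ => (eventually_all_finset A).2 fun b _ => ?_
      rcases eq_or_ne a b with hab | hab
      · exact Eventually.of_forall fun _ h => absurd hab h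
      · filter_upwards [mem_nhdsWithin_of_mem_nhds (Iio_mem_nhds
          (half_pos (abs_pos.2 (sub_ne_zero.2 hab))))] with h hlt _
        have : h < |a - b| / 2 := hlt
        linarith
    have e2 : ∀ᶠ h in 𝓝[>] (0 : ℝ), ∀ a ∈ A, C a * h ≤ κ a / 2 := by
      refine (eventually_all_finset A).2 fun a ha => ?_
      have : Tendsto (fun h : ℝ => C a * h) (𝓝 0) (𝓝 (C a * 0)) :=
        (by fun_prop : Continuous fun h : ℝ => C a * h).tendsto 0
      rw [mul_zero] at this
      exact ((this.mono_left nhdsWithin_le_nhds).eventually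
        (eventually_lt_nhds (half_pos (hκ a ha)))).mono fun _ h => h.le
    obtain ⟨h, ⟨h1, h2⟩, h3⟩ := ((e1.and e2).and self_mem_nhdsWithin).exists
    exact ⟨h, h3, h1, h2⟩
  set T := ⋃ a ∈ A, Metric.ball a h with hT
  have hTo : IsOpen T := isOpen_biUnion fun a _ => Metric.isOpen_ball
  have hR : IsCompact (Icc (0 : ℝ) 1 \ T) := isCompact_Icc.diff hTo
  obtain ⟨g0, hg0pos, hg0le⟩ : ∃ g0 > 0, ∀ x ∈ Icc (0 : ℝ) 1 \ T, g0 ≤ g x := by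
    rcases (Icc (0 : ℝ) 1 \ T).eq_empty_or_nonempty with he | hne
    · exact ⟨1, one_pos, fun x hx => by rw [he] at hx; exact absurd hx (notMem_empty x)⟩
    · obtain ⟨x, hx, hmin⟩ := hR.exists_isMinOn hne hgc.continuousOn
      refine ⟨g x, hpos x hx.1 fun hxA => hx.2 ?_, fun y hy => hmin hy⟩
      exact mem_biUnion hxA (Metric.mem_ball_self hh)
  have hint : ∀ s : ℝ, 0 < s → IntegrableOn (fun x => ((s ^ 2 + g x) ^ (n + 1))⁻¹) (Icc 0 1) := by
    intro s hs
    refine ContinuousOn.integrableOn_compact isCompact_Icc ?_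
    refine ContinuousOn.inv₀ ((continuous_const.add hgc).pow _).continuousOn fun x hx => ?_
    have := hg0 x hx
    positivity
  have hsplit : ∀ s ∈ Ioi (0 : ℝ), ∫ x in (0 : ℝ)..1, ((s ^ 2 + g x) ^ (n + 1))⁻¹
      = (∑ a ∈ A, ∫ x in Icc (0 : ℝ) 1 ∩ Metric.ball a h, ((s ^ 2 + g x) ^ (n + 1))⁻¹)
        + ∫ x in Icc (0 : ℝ) 1 \ T, ((s ^ 2 + g x) ^ (n + 1))⁻¹ := by
    intro s hs
    rw [intervalIntegral.integral_of_le zero_le_one, ← integral_Icc_eq_integral_Ioc,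
      ← integral_inter_add_sdiff hTo.measurableSet (hint s hs)]
    congr 1
    rw [hT, inter_iUnion₂]
    refine integral_biUnion_finset A
      (fun a _ => measurableSet_Icc.inter Metric.isOpen_ball.measurableSet) ?_
      fun a _ => (hint s hs).mono_set inter_subset_left
    intro a ha b hb hab
    refine Disjoint.mono inter_subset_right inter_subset_right (Metric.ball_disjoint_ball ?_)
    rw [Real.dist_eq, ← two_mul]
    exact hsep a ha b hb hab
  -- Off the balls `g` is bounded below by compactness, so the integral stays bounded and the power
  -- of `s` removes it.
  have hrest : Tendsto (fun s : ℝ => s ^ (2 * n + 1) *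
      ∫ x in Icc (0 : ℝ) 1 \ T, ((s ^ 2 + g x) ^ (n + 1))⁻¹) (𝓝[>] 0) (𝓝 0) := by
    set V := (g0 ^ (n + 1))⁻¹ * volume.real (Icc (0 : ℝ) 1 \ T) with hV
    have hz : Tendsto (fun s : ℝ => s ^ (2 * n + 1) * V) (𝓝[>] 0) (𝓝 0) := by
      have : Tendsto (fun s : ℝ => s ^ (2 * n + 1) * V) (𝓝 0) (𝓝 (0 ^ (2 * n + 1) * V)) :=
        (by fun_prop : Continuous fun s : ℝ => s ^ (2 * n + 1) * V).tendsto 0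
      rw [zero_pow (by omega), zero_mul] at this
      exact this.mono_left nhdsWithin_le_nhds
    refine squeeze_zero_norm' ?_ hz
    filter_upwards [self_mem_nhdsWithin] with s hs
    have hs0 : (0 : ℝ) < s := hs
    rw [norm_mul, Real.norm_eq_abs (s ^ _), abs_of_pos (pow_pos hs0 _)]
    refine mul_le_mul_of_nonneg_left ?_ (pow_pos hs0 _).le
    refine norm_setIntegral_le_of_norm_le_const hR.measure_lt_top fun x hx => ?_
    have := hg0le x hx
    have hp : 0 < s ^ 2 + g x := add_pos (pow_pos hs0 2) (hg0pos.trans_le this)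
    rw [Real.norm_eq_abs, abs_of_pos (by positivity)]
    exact inv_anti₀ (by positivity) (pow_le_pow_left₀ hg0pos.le
      (by nlinarith [sq_nonneg s]) _)
  have hsum := tendsto_finsetSum A fun a ha =>
    tendsto_local hgc (hA a ha) (hκ a ha) (hC0 a ha) hh (hsmall a ha) (hC a ha) n
  have := hsum.add hrest
  rw [add_zero] at this
  refine this.congr' ?_
  filter_upwards [self_mem_nhdsWithin] with s hs
  rw [hsplit s hs, mul_add, Finset.mul_sum]

end Asymptotics

/-! ### Limits of the strain along particle paths -/

section Limits

variable {S : Set ℝ} {u₁ η : ℝ → ℝ} {M : ℝ}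

/-- Write `1 - ηu₁ = ηD` with `D = 1/η - M + (M - u₁)`, and `u₁ = 1/η - D` in the numerators. Then
`K0 = η⁻¹P₁`, `K1 = η⁻³P₂ - η⁻²P₁`, and all powers of `η` cancel. -/
theorem TimeChange.strain_eq (hη : TimeChange u₁ M η) (h : Profile S u₁ M) {a t : ℝ}
    (ha : a ∈ S) (ht : t ∈ Ici (0 : ℝ)) (hη0 : 0 < η t) :
    strain u₁ η a t = (1 / (1 / η t - M + (M - u₁ a))
      - (∫ x in (0 : ℝ)..1, ((1 / η t - M + (M - u₁ x)) ^ 2)⁻¹)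
        / ∫ x in (0 : ℝ)..1, (1 / η t - M + (M - u₁ x))⁻¹)
      / (∫ x in (0 : ℝ)..1, (1 / η t - M + (M - u₁ x))⁻¹) ^ 2 := by
  have hm := hη.mem t ht
  have hK := hη.K0_pos h ht
  set e := η t with he
  have hsub := h.space.uIcc_subset h.space.one_mem
  have hden : ∀ x, 1 - e * u₁ x = e * (1 / e - M + (M - u₁ x)) := fun x => by
    field_simp; ring
  have hpos : ∀ x ∈ S, 0 < 1 / e - M + (M - u₁ x) := fun x hx => by
    have := h.denom_pos hx hm
    rw [hden x] at this
    exact pos_of_mul_pos_right this hη0.le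
  have hcd : ContinuousOn (fun x => 1 / e - M + (M - u₁ x)) (uIcc 0 1) :=
    continuousOn_const.add (continuousOn_const.sub h.continuousOn_Icc)
  have i1 : IntervalIntegrable (fun x => (1 / e - M + (M - u₁ x))⁻¹)
      MeasureTheory.volume 0 1 :=
    (hcd.inv₀ fun x hx => (hpos x (hsub hx)).ne').intervalIntegrable
  have i2 : IntervalIntegrable (fun x => ((1 / e - M + (M - u₁ x)) ^ 2)⁻¹)
      MeasureTheory.volume 0 1 :=
    ((hcd.pow 2).inv₀ fun x hx => (pow_pos (hpos x (hsub hx)) 2).ne').intervalIntegrable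
  set P1 := ∫ x in (0 : ℝ)..1, (1 / e - M + (M - u₁ x))⁻¹ with hP1
  set P2 := ∫ x in (0 : ℝ)..1, ((1 / e - M + (M - u₁ x)) ^ 2)⁻¹ with hP2
  have e0 : K0 u₁ e = e⁻¹ * P1 := by
    rw [K0, hP1, ← intervalIntegral.integral_const_mul]
    refine intervalIntegral.integral_congr fun x _ => ?_
    simp only [hden x, mul_inv]
  have e1 : K1 u₁ e = (e⁻¹) ^ 3 * P2 - (e⁻¹) ^ 2 * P1 := by
    rw [K1, hP1, hP2, ← intervalIntegral.integral_const_mul,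
      ← intervalIntegral.integral_const_mul, ← intervalIntegral.integral_sub
        (i2.const_mul _) (i1.const_mul _)]
    refine intervalIntegral.integral_congr fun x hx => ?_
    have hx0 := (hpos x (hsub hx)).ne'
    simp only [hden x]
    have hu : u₁ x = 1 / e - (1 / e - M + (M - u₁ x)) := by ring
    set D := 1 / e - M + (M - u₁ x)
    rw [hu]
    field_simp
  have hP1pos : 0 < P1 := by
    rw [e0] at hK
    exact pos_of_mul_pos_right hK (inv_pos.2 hη0).le
  have ha0 := (hpos a ha).ne'
  rw [strain, ← he, e0, e1, hden a]
  have hu : u₁ a = 1 / e - (1 / e - M + (M - u₁ a)) := by ring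
  set D := 1 / e - M + (M - u₁ a)
  rw [hu]
  field_simp
  ring

theorem TimeChange.tendsto_sqrt (hη : TimeChange u₁ M η) (hM : 0 < M) :
    Tendsto (fun t => √(1 / η t - M)) atTop (𝓝[>] 0) := by
  have hlt : ∀ᶠ t in atTop, η t < 1 / M :=
    hη.tendsto.eventually eventually_mem_nhdsWithin
  have h0 : Tendsto η atTop (𝓝 (1 / M)) := hη.tendsto.mono_right nhdsWithin_le_nhds
  have hpos : ∀ᶠ t in atTop, 0 < η t := h0.eventually (eventually_gt_nhds (one_div_pos.2 hM))
  refine tendsto_nhdsWithin_iff.2 ⟨?_, ?_⟩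
  · have h1 : Tendsto (fun t => 1 / η t - M) atTop (𝓝 (1 / (1 / M) - M)) :=
      (tendsto_const_nhds.div h0 (one_div_pos.2 hM).ne').sub_const M
    rw [one_div_one_div, sub_self] at h1
    simpa using h1.sqrt
  · filter_upwards [hlt, hpos] with t h1 h2
    refine Real.sqrt_pos.2 (sub_pos.2 ?_)
    rw [lt_div_iff₀ h2, mul_comm]
    exact (lt_div_iff₀ hM).1 h1

open Classical in
/-- The strain along particle paths, for finitely many quadratic maxima. -/
theorem TimeChange.strain_tendsto (hη : TimeChange u₁ M η) (h : Profile S u₁ M) {A : Finset ℝ}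
    (hne : A.Nonempty) {κ : ℝ → ℝ} (hA : ∀ a, a ∈ A ↔ a ∈ Icc (0 : ℝ) 1 ∧ u₁ a = M)
    (hκ : ∀ a ∈ A, 0 < κ a)
    (hg : ∀ a ∈ A, ∃ C, 0 ≤ C ∧ ∀ x ∈ Icc (0 : ℝ) 1,
      |M - u₁ x - κ a * (x - a) ^ 2| ≤ C * |x - a| ^ 3) {W : ℝ}
    (hW : W = ∑ a ∈ A, (if a = 0 ∨ a = 1 then (1 / 2 : ℝ) else 1) / √(κ a)) :
    0 < W ∧ (∀ a ∈ A, Tendsto (fun t => strain u₁ η a t) atTop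
        (𝓝 (1 / (2 * (Real.pi * W) ^ 2)))) ∧
      ∀ a ∈ Icc (0 : ℝ) 1, a ∉ A → Tendsto (fun t => strain u₁ η a t) atTop
        (𝓝 (-(1 / (2 * (Real.pi * W) ^ 2)))) := by
  have hM := h.pos
  have hW0 : 0 < W := by
    rw [hW]
    refine Finset.sum_pos (fun a ha => div_pos ?_ (Real.sqrt_pos.2 (hκ a ha))) hne
    split_ifs <;> norm_num
  -- An extension continuous on the whole line, as the Laplace lemma requires; only its values on
  -- `[0,1]` enter.
  set G : ℝ → ℝ := IccExtend (zero_le_one (α := ℝ)) ((Icc (0 : ℝ) 1).domRestrict fun x => M - u₁ x)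
    with hG
  have hGe : ∀ x ∈ Icc (0 : ℝ) 1, G x = M - u₁ x := fun x hx => by
    rw [hG, IccExtend_of_mem _ _ hx]; rfl
  have hGc : Continuous G := by
    refine Continuous.Icc_extend' (continuousOn_iff_continuous_domRestrict.1 ?_)
    exact (continuousOn_const.sub h.smooth.continuousOn).mono h.space.Icc_subset
  have hlap := tendsto_laplace hGc (A := A) (κ := κ) (fun a ha => ((hA a).1 ha).1) hκ
    (fun a ha => by
      obtain ⟨C, hC, hb⟩ := hg a ha
      exact ⟨C, hC, fun x hx => by rw [hGe x hx]; exact hb x hx⟩)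
    (fun x hx => by rw [hGe x hx]; exact sub_nonneg.2 (h.le x (h.space.Icc_subset hx)))
    (fun x hx hxA => by
      rw [hGe x hx]
      exact sub_pos.2 (lt_of_le_of_ne (h.le x (h.space.Icc_subset hx))
        fun e => hxA ((hA x).2 ⟨hx, e⟩)))
  have hs := hη.tendsto_sqrt hM
  have hX := (hlap 0).comp hs
  have hY := (hlap 1).comp hs
  have hsum : ∀ m, ∑ a ∈ A, (if a = 0 ∨ a = 1 then (1 / 2 : ℝ) else 1) * (bump m / √(κ a))
      = bump m * W := by
    intro m
    rw [hW, Finset.mul_sum]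
    refine Finset.sum_congr rfl fun a _ => ?_
    ring
  rw [hsum] at hX hY
  rw [zero_add, bump_one] at hX
  rw [one_add_one_eq_two, bump_two] at hY
  set s : ℝ → ℝ := fun t => √(1 / η t - M) with hsdef
  set X : ℝ → ℝ := (fun s : ℝ => s ^ (2 * 0 + 1) * ∫ x in (0 : ℝ)..1, ((s ^ 2 + G x) ^ 1)⁻¹) ∘ s
    with hXdef
  set Y : ℝ → ℝ := (fun s : ℝ => s ^ (2 * 1 + 1) * ∫ x in (0 : ℝ)..1, ((s ^ 2 + G x) ^ 2)⁻¹) ∘ s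
    with hYdef
  have hpW : 0 < Real.pi * W := mul_pos Real.pi_pos hW0
  have hev : ∀ᶠ t in atTop, 0 < η t ∧ 0 ≤ t ∧ 0 < s t := by
    filter_upwards [(hη.tendsto.mono_right nhdsWithin_le_nhds).eventually
      (eventually_gt_nhds (one_div_pos.2 hM)), eventually_ge_atTop 0,
      hs.eventually eventually_mem_nhdsWithin] with t h1 h2 h3 using ⟨h1, h2, h3⟩
  have hformula : ∀ a ∈ Icc (0 : ℝ) 1, ∀ᶠ t in atTop,
      (s t ^ 2 / (s t ^ 2 + (M - u₁ a)) - Y t / X t) / X t ^ 2 = strain u₁ η a t := by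
    intro a ha
    filter_upwards [hev] with t ht
    obtain ⟨h1, h2, h3⟩ := ht
    have hd : 1 / η t - M = s t ^ 2 := (Real.sq_sqrt (Real.sqrt_pos.1 h3).le).symm
    rw [hη.strain_eq h (h.space.Icc_subset ha) h2 h1, hd]
    have eX : X t = s t * ∫ x in (0 : ℝ)..1, (s t ^ 2 + (M - u₁ x))⁻¹ := by
      simp only [hXdef, Function.comp, mul_zero, zero_add, pow_one]
      congr 1
      refine intervalIntegral.integral_congr fun x hx => ?_
      rw [uIcc_of_le zero_le_one] at hx
      simp only [hGe x hx]
    have eY : Y t = s t ^ 3 * ∫ x in (0 : ℝ)..1, ((s t ^ 2 + (M - u₁ x)) ^ 2)⁻¹ := by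
      simp only [hYdef, Function.comp]
      congr 1
      refine intervalIntegral.integral_congr fun x hx => ?_
      rw [uIcc_of_le zero_le_one] at hx
      simp only [hGe x hx]
    rw [eX, eY]
    set P1 := ∫ x in (0 : ℝ)..1, (s t ^ 2 + (M - u₁ x))⁻¹
    set P2 := ∫ x in (0 : ℝ)..1, ((s t ^ 2 + (M - u₁ x)) ^ 2)⁻¹
    have : s t ^ 3 * P2 / (s t * P1) = s t ^ 2 * (P2 / P1) := by
      rw [show s t ^ 3 * P2 = s t * (s t ^ 2 * P2) by ring, mul_div_mul_left _ _ h3.ne',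
        mul_div_assoc]
    rw [this, mul_pow, ← mul_div_mul_left (1 / (s t ^ 2 + (M - u₁ a)) - P2 / P1) (P1 ^ 2)
      (pow_pos h3 2).ne']
    congr 1
    ring
  -- The ratio of `bump 2 = π/2` to `bump 1 = π`; the weights `W` cancel.
  have hratio : Tendsto (fun t => Y t / X t) atTop (𝓝 (1 / 2)) := by
    have := hY.div hX hpW.ne'
    rwa [div_mul_eq_mul_div, div_div, mul_comm (2 : ℝ), ← div_div, div_self hpW.ne'] at this
  have hs0 : Tendsto (fun t => s t ^ 2) atTop (𝓝 0) := by
    have := (hs.mono_right nhdsWithin_le_nhds).pow 2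
    rwa [zero_pow two_ne_zero] at this
  refine ⟨hW0, fun a ha => ?_, fun a ha haA => ?_⟩
  · obtain ⟨haI, hau⟩ := (hA a).1 ha
    have h1 : Tendsto (fun t => s t ^ 2 / (s t ^ 2 + (M - u₁ a))) atTop (𝓝 1) := by
      refine tendsto_const_nhds.congr' ?_
      filter_upwards [hev] with t ht
      rw [hau, sub_self, add_zero, div_self (pow_pos ht.2.2 2).ne']
    have := ((h1.sub hratio).div (hX.pow 2) (pow_pos hpW 2).ne').congr' (hformula a haI)
    refine this.trans_eq ?_
    congr 1
    field_simp
    norm_num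
  · have hpos : 0 < M - u₁ a := sub_pos.2 (lt_of_le_of_ne (h.le a (h.space.Icc_subset ha))
      fun e => haA ((hA a).2 ⟨ha, e⟩))
    have h1 : Tendsto (fun t => s t ^ 2 / (s t ^ 2 + (M - u₁ a))) atTop
        (𝓝 (0 / (0 + (M - u₁ a)))) :=
      hs0.div (hs0.add_const _) (by linarith)
    rw [zero_div] at h1
    have := ((h1.sub hratio).div (hX.pow 2) (pow_pos hpW 2).ne').congr' (hformula a ha)
    refine this.trans_eq ?_
    congr 1
    field_simp
    norm_num

end Limits

/-! ### The constant in terms of `u₀'''`, and the theorem -/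

/-- The second-order coefficient of a nonnegative function is nonnegative. -/
theorem coeff_pos_of_expansion {g : ℝ → ℝ} {a κ C : ℝ} (ha : a ∈ Icc (0 : ℝ) 1) (hκ : κ ≠ 0)
    (hC : 0 ≤ C) (hg0 : ∀ x ∈ Icc (0 : ℝ) 1, 0 ≤ g x)
    (hg : ∀ x ∈ Icc (0 : ℝ) 1, |g x - κ * (x - a) ^ 2| ≤ C * |x - a| ^ 3) : 0 < κ := by
  refine lt_of_le_of_ne (le_of_not_gt fun hneg => ?_) hκ.symm
  -- At distance `ρ` a negative quadratic term beats the cubic error; `ρ ≤ 1/2` keeps `a + ρ` or `a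
  -- - ρ` in `[0,1]`.
  obtain ⟨ρ, hρ0, hρ1, hρC⟩ : ∃ ρ : ℝ, 0 < ρ ∧ ρ ≤ 1 / 2 ∧ C * ρ < -κ := by
    refine ⟨min (1 / 2) (-κ / (C + 1)), lt_min (by norm_num)
      (div_pos (by linarith) (by linarith)), min_le_left _ _, ?_⟩
    refine (mul_le_mul_of_nonneg_left (min_le_right _ _) hC).trans_lt ?_
    rw [mul_div_assoc', div_lt_iff₀ (by linarith)]
    nlinarith
  obtain ⟨x, hx, hxa⟩ : ∃ x ∈ Icc (0 : ℝ) 1, |x - a| = ρ := by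
    rcases le_total a (1 / 2) with h | h
    · exact ⟨a + ρ, ⟨by linarith [ha.1], by linarith⟩, by
        rw [add_sub_cancel_left, abs_of_pos hρ0]⟩
    · exact ⟨a - ρ, ⟨by linarith, by linarith [ha.2]⟩, by
        rw [sub_sub_cancel_left, abs_neg, abs_of_pos hρ0]⟩
  have h1 := (abs_le.1 (hg x hx)).2
  have h2 := hg0 x hx
  rw [← sq_abs (x - a), hxa] at h1
  nlinarith [pow_pos hρ0 2]

theorem iteratedDerivWithin_two_eq (f : ℝ → ℝ) (S : Set ℝ) :
    iteratedDerivWithin 2 f S = derivWithin (derivWithin f S) S := by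
  rw [iteratedDerivWithin_succ, iteratedDerivWithin_one]

theorem iteratedDerivWithin_three_eq (f : ℝ → ℝ) (S : Set ℝ) :
    iteratedDerivWithin 3 f S = derivWithin (derivWithin (derivWithin f S) S) S := by
  rw [iteratedDerivWithin_succ, iteratedDerivWithin_two_eq]

theorem HasZeroOfOrder.eq_zero {S : Set ℝ} {f : ℝ → ℝ} {k : ℕ} {a : ℝ}
    (h : HasZeroOfOrder S f k a) (hk : 1 ≤ k) : f a = 0 := by
  simpa using h.1 0 hk

theorem HasZeroOfOrder.derivWithin_eq_zero {S : Set ℝ} {f : ℝ → ℝ} {k : ℕ} {a : ℝ}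
    (h : HasZeroOfOrder S f k a) (hk : 1 < k) : derivWithin f S a = 0 := by
  simpa [iteratedDerivWithin_one] using h.1 1 hk

theorem HasZeroOfOrder.derivWithin_ne_zero {S : Set ℝ} {f : ℝ → ℝ} {a : ℝ}
    (h : HasZeroOfOrder S f 1 a) : derivWithin f S a ≠ 0 := by
  simpa [iteratedDerivWithin_one] using h.2

open Classical in
-- As `κ = |u₀'''|/2`, the two weighted sums differ by a factor `√2`, which turns `2π²` into
-- `(2π)²`.
theorem limitValue_eq {bc : BoundaryCondition} {u₀ : ℝ → ℝ} {A : Finset ℝ} {κ : ℝ → ℝ}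
    (hκ : ∀ a ∈ A, 0 < κ a) (h3 : ∀ a ∈ A, iteratedDerivWithin 3 u₀ bc.domain a = -(2 * κ a)) :
    limitValue bc u₀ A = 1 / (2 * (Real.pi *
      ∑ a ∈ A, (if a = 0 ∨ a = 1 then (1 / 2 : ℝ) else 1) / √(κ a)) ^ 2) := by
  have e : ∑ a ∈ A, (if a = 0 ∨ a = 1 then (1 / 2 : ℝ) else 1) / √(κ a)
      = √2 * ∑ a ∈ A, (if a = 0 ∨ a = 1 then (1 / 2 : ℝ) else 1) /
        Real.sqrt |iteratedDerivWithin 3 u₀ bc.domain a| := by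
    rw [Finset.mul_sum]
    refine Finset.sum_congr rfl fun a ha => ?_
    rw [h3 a ha, abs_neg, abs_of_pos (mul_pos two_pos (hκ a ha)), Real.sqrt_mul zero_le_two]
    have h2 : √(2 : ℝ) ≠ 0 := (Real.sqrt_pos.2 two_pos).ne'
    have hk : √(κ a) ≠ 0 := (Real.sqrt_pos.2 (hκ a ha)).ne'
    field_simp
  rw [e, limitValue]
  congr 1
  have h2 := Real.sq_sqrt (zero_le_two (α := ℝ))
  generalize (∑ a ∈ A, (if a = 0 ∨ a = 1 then (1 / 2 : ℝ) else 1) /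
    Real.sqrt |iteratedDerivWithin 3 u₀ bc.domain a|) = X
  linear_combination (-2 * Real.pi ^ 2 * X ^ 2) * h2

end StagnationEuler

open StagnationEuler in
theorem theorem3p2 (bc : StagnationEuler.BoundaryCondition) (u₀ : ℝ → ℝ)
    (hu₀ : ContDiffOn ℝ ∞ u₀ bc.domain) (hbc : bc.Holds u₀)
    (M₀ : ℝ) (hM₀ : 0 < M₀)
    (hmax : IsGreatest ((fun α => derivWithin u₀ bc.domain α) '' Icc (0 : ℝ) 1) M₀)
    (A : Finset ℝ)
    (hA : ∀ a : ℝ, a ∈ A ↔ a ∈ Icc (0 : ℝ) 1 ∧ derivWithin u₀ bc.domain a = M₀) :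
    ((∃ a ∈ A, iteratedDerivWithin 2 u₀ bc.domain a = 0) →
      StagnationEuler.SolutionsStaySmooth bc u₀) ∧
    (∀ k : ℕ, 1 ≤ k →
      (∀ a ∈ A, StagnationEuler.HasZeroOfOrder bc.domain
        (fun x => iteratedDerivWithin 2 u₀ bc.domain x) k a) →
      StagnationEuler.SolutionsStaySmooth bc u₀ ∧
      ∀ u : ℝ → ℝ → ℝ, StagnationEuler.IsSmoothSolution bc u₀ (Ici 0) u →
        (k = 1 →
          0 < StagnationEuler.limitValue bc u₀ A ∧
          (∃ γ : ℝ → ℝ → ℝ, StagnationEuler.IsFlow bc u γ) ∧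
          ∀ γ : ℝ → ℝ → ℝ, StagnationEuler.IsFlow bc u γ →
            (∀ a ∈ A, Tendsto (fun t => StagnationEuler.ux bc.domain u (γ a t) t) atTop
              (𝓝 (StagnationEuler.limitValue bc u₀ A))) ∧
            (∀ α ∈ Icc (0 : ℝ) 1, α ∉ A →
              Tendsto (fun t => StagnationEuler.ux bc.domain u (γ α t) t) atTop
                (𝓝 (-StagnationEuler.limitValue bc u₀ A)))) ∧
        (1 < k →
          TendstoUniformlyOn (fun t x => StagnationEuler.ux bc.domain u x t) (fun _ => 0) atTop
            bc.domain)) := by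
  classical
  have hS := bc.spaceInterval
  have hP := profile_of_isGreatest hu₀ hbc hM₀ hmax
  set S := bc.domain with hSdef
  set u₁ := derivWithin u₀ S with hu₁
  have hsolve : (∃ a ∈ A, iteratedDerivWithin 2 u₀ S a = 0) →
      ∃ η β, TimeChange u₁ M₀ η ∧ FlowInverse S u₁ η (u₀ 0) β ∧
        IsSmoothSolution bc u₀ (Ici 0) (fun x t => flowVel u₁ η (u₀ 0) (β x t) t) := by
    rintro ⟨a, haA, ha2⟩
    obtain ⟨haI, hau⟩ := (hA a).1 haA
    rw [iteratedDerivWithin_two_eq] at ha2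
    obtain ⟨C, hC, hb⟩ := growth_two hS hP.smooth haI hau ha2
    obtain ⟨η, hη⟩ := hP.exists_timeChange (hP.integral_K0_sq_unbounded haI hC hb)
    obtain ⟨β, hβ⟩ := exists_flowInverse hη hP hbc
    exact ⟨η, β, hη, hβ, hβ.isSmoothSolution hη hP hbc hu₀⟩
  have hne : A.Nonempty := by
    obtain ⟨a, ha, hau⟩ := hmax.1
    exact ⟨a, (hA a).2 ⟨ha, hau⟩⟩
  refine ⟨fun h2 => ?_, fun k hk hzero => ?_⟩
  · obtain ⟨η, β, -, -, hV⟩ := hsolve h2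
    exact solutionsStaySmooth_of_global hV
  have h2 : ∀ a ∈ A, derivWithin u₁ S a = 0 := fun a ha => by
    have := (hzero a ha).eq_zero hk
    rwa [iteratedDerivWithin_two_eq] at this
  obtain ⟨a₀, ha₀⟩ := hne
  obtain ⟨η, β, hη, hβ, hV⟩ := hsolve ⟨a₀, ha₀, (hzero a₀ ha₀).eq_zero hk⟩
  refine ⟨solutionsStaySmooth_of_global hV, fun u hu => ?_⟩
  obtain ⟨c, g, hc0, hcg, hcd, hrep⟩ := hV.representation hu timeInterval_Ici
  refine ⟨fun hk1 => ?_, fun hk1 => ?_⟩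
  · subst hk1
    have hexp : ∀ a ∈ A, ∃ C, 0 ≤ C ∧ ∀ x ∈ Icc (0 : ℝ) 1,
        |M₀ - u₁ x - (-derivWithin (derivWithin u₁ S) S a / 2) * (x - a) ^ 2| ≤ C * |x - a| ^ 3 :=
      fun a ha => growth_three hS hP.smooth ((hA a).1 ha).1 ((hA a).1 ha).2 (h2 a ha)
    -- Nonzero because the zero of `u₀''` is simple, positive because `u₀'` is maximal.
    have hκ : ∀ a ∈ A, 0 < -derivWithin (derivWithin u₁ S) S a / 2 := by
      intro a ha
      obtain ⟨C, hC, hb⟩ := hexp a ha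
      have h3 := (hzero a ha).derivWithin_ne_zero
      simp only [iteratedDerivWithin_two_eq] at h3
      refine coeff_pos_of_expansion ((hA a).1 ha).1 ?_ hC
        (fun x hx => sub_nonneg.2 (hP.le x (hS.Icc_subset hx))) hb
      exact div_ne_zero (neg_ne_zero.2 h3) two_ne_zero
    obtain ⟨hW, hin, hout⟩ := hη.strain_tendsto hP ⟨a₀, ha₀⟩ hA hκ hexp rfl
    have hlim := limitValue_eq (bc := bc) (u₀ := u₀) hκ fun a _ => by
      rw [iteratedDerivWithin_three_eq]; ring
    rw [← hlim] at hin hout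
    refine ⟨?_, hβ.exists_isFlow hη hP hcd hc0 hcg hrep, fun γ hγ => ?_⟩
    · rw [hlim]
      have := mul_pos Real.pi_pos hW
      positivity
    · have hux : ∀ α ∈ Icc (0 : ℝ) 1, ∀ᶠ t in atTop,
          strain u₁ η α t = ux S u (γ α t) t := by
        intro α hα
        filter_upwards [eventually_ge_atTop 0] with t ht
        rw [hβ.ux_eq_strain hη hP hcd hrep (hγ.mem_domain α hα t ht) ht,
          hβ.label_eq hη hP hcd hc0 hcg hrep hγ hα ht]
      exact ⟨fun a ha => (hin a ha).congr' (hux a ((hA a).1 ha).1),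
        fun α hα hαA => (hout α hα hαA).congr' (hux α hα)⟩
  · obtain ⟨haI, hau⟩ := (hA a₀).1 ha₀
    obtain ⟨C, hC, hb⟩ := growth_three hS hP.smooth haI hau (h2 a₀ ha₀)
    have h3 := (hzero a₀ ha₀).derivWithin_eq_zero hk1
    simp only [iteratedDerivWithin_two_eq] at h3
    -- For `k > 1` the quadratic coefficient vanishes, and the Taylor bound becomes the cubic
    -- flatness that forces decay; one maximum point suffices.
    obtain ⟨E, hE, hbound⟩ := hη.strain_tendsto_zero hP haI hC fun x hx => by
      have := hb x hx
      rw [h3, neg_zero, zero_div, zero_mul, sub_zero] at this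
      exact (le_abs_self _).trans this
    refine Metric.tendstoUniformlyOn_iff.2 fun ε hε => ?_
    filter_upwards [hE.eventually (eventually_lt_nhds hε), eventually_ge_atTop 0]
      with t ht ht0 x hx
    rw [dist_zero_left, Real.norm_eq_abs, hβ.ux_eq_strain hη hP hcd hrep hx ht0]
    exact (hbound t ht0 _ (hβ.mem t ht0 _ (sub_mem_domain hcd hx t))).trans_lt ht
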